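/- Let $G$ be a connected reductive complex algebraic group with (reductive) Lie algebra $\mathfrak g=\mathfrak n_-\oplus\mathfrak t\oplus\mathfrak n$, where $\mathfrak t$ is a Cartan subalgebra and $\mathfrak n,\mathfrak n_-$ are the sums of the root spaces of the positive and of the negative roots. Let $\alpha_1,\dots,\alpha_r\in\mathfrak t^*$ be the simple roots, $s_1,\dots,s_r$ the simple reflections, $H_i=\alpha_i^\vee\in\mathfrak t$ the simple coroots, $E_i,F_i$ root vectors for $\alpha_i,-\alpha_i$ with $[E_i,F_i]=H_i$, and let $\mathfrak g_i$ be the span of $E_i,F_i,H_i$. Let $V$ be a locally finite $G$-module, i.e. a direct sum of irreducible finite-dimensional $G$-modules, regarded also as a $\mathfrak g$-module. Let $M=\mathrm U(\mathfrak g)\otimes V$ with the $\mathrm U(\mathfrak g)$-bimodule structure given for $X\in\mathfrak g$ by $$X(u\otimes v)=(Xu)\otimes v,\qquad (u\otimes v)X=(uX)\otimes v-u\otimes(Xv),$$ with the adjoint action $(\mathrm{ad}\,X)m=Xm-mX$, and with the diagonal action of $G$. Put $Z=M/(\mathfrak n_-M+M\mathfrak n)$, let $Z^0\subset Z$ be the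 zero weight subspace for the adjoint action of $\mathfrak t$ and $V^0\subset V$ the zero weight subspace of $V$; write $v\in Z$ also for the class of $1\otimes v$, $v\in V$. Let $\overline{\mathrm U(\mathfrak t)}$ be the ring of fractions of $\mathrm U(\mathfrak t)$ with respect to the denominators $H_\alpha+k$ ($H_\alpha$ the coroot of a root $\alpha$, $k\in\mathbb Z$), and $\overline M$, $\overline Z$ the corresponding modules of fractions of the left $\mathrm U(\mathfrak t)$-modules $M$, $Z$. For each $i$ let $\hat s_i$ be a representative of $s_i$, in the normalizer of the maximal torus with Lie algebra $\mathfrak t$, which lies in the connected subgroup of $G$ with Lie algebra $\mathfrak g_i$. The Zhelobenko operator $\xi_i:Z\to\overline Z$ is the map induced by $$\eta_i:M\to\overline M,\qquad \eta_i(m)=\sum_{k\ge0}\bigl(k!\,H_i(H_i-1)\cdots(H_i-k+1)\bigr)^{-1}E_i^k\,(\mathrm{ad}\,F_i)^k\,\hat s_i(m),$$ and $$Q=\{z\in Z^0\mid \xi_i(z)=z\ \text{ in }\overline Z\ \text{ for } i=1,\dots,r\}.$$ Let the shifted action of $s_i$ on $\mathrm U(\mathfrak t)$, viewed as the algebra of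 polynomial functions on $\mathfrak t^*$, be $(s_i\circ\Phi)(\lambda)=\Phi(s_i(\lambda+\alpha_i))$. For $j=0,1,2,\dots$ let $V_{ij}$ be the sum of the $(2j+1)$-dimensional irreducible $\mathfrak g_i$-submodules of $V$, and put $\Psi_{ij}=(H_i+2)(H_i+3)\cdots(H_i+j+1)$. Then $Z^0=\mathrm U(\mathfrak t)V^0$, and an element $z\in Z^0$ lies in $Q$ if and only if for each $i=1,\dots,r$ it can be written as a finite sum of products of the form $\Theta\,\Psi_{ij}\,v$, where $j\ge0$, $v\in V^0\cap V_{ij}$, $\Theta\in\mathrm U(\mathfrak t)$ and $s_i\circ\Theta=\Theta$. -/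

import Mathlib

open scoped TensorProduct

attribute [local instance 100] LieRing.ofAssociativeRing

noncomputable section

namespace HarishChandra

/-! ### Linear algebraic groups and their modules -/

section Groups

variable {n : ℕ}

/-- The polynomial `p` in the `n²` matrix entries, evaluated at `g ∈ GL_n(ℂ)`. -/
def evalGL (p : MvPolynomial (Fin n × Fin n) ℂ) (g : GL (Fin n) ℂ) : ℂ :=
  MvPolynomial.eval (fun ij => (g : Matrix (Fin n) (Fin n) ℂ) ij.1 ij.2) p

/-- Zariski closed subsets of `GL_n(ℂ)`. -/
def IsZariskiClosed (A : Set (GL (Fin n) ℂ)) : Prop :=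
  ∃ P : Set (MvPolynomial (Fin n × Fin n) ℂ), A = {g | ∀ p ∈ P, evalGL p g = 0}

/-- Connectedness of a subset of `GL_n(ℂ)` in the Zariski topology: it is not covered by two
closed sets which both meet it and whose traces on it are disjoint. -/
def IsZariskiConnected (A : Set (GL (Fin n) ℂ)) : Prop :=
  ∀ B C : Set (GL (Fin n) ℂ), IsZariskiClosed B → IsZariskiClosed C →
    A ⊆ B ∪ C → A ∩ (B ∩ C) = ∅ → A ⊆ B ∨ A ⊆ C

/-- A connected reductive complex algebraic group, embedded as a closed subgroup of `GL_n(ℂ)`: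
its unipotent radical is trivial, that is, every closed connected normal subgroup consisting of
unipotent matrices is trivial. -/
structure IsConnectedReductive (G : Subgroup (GL (Fin n) ℂ)) : Prop where
  closed : IsZariskiClosed (G : Set (GL (Fin n) ℂ))
  connected : IsZariskiConnected (G : Set (GL (Fin n) ℂ))
  unipotentRadical_trivial : ∀ U : Subgroup (GL (Fin n) ℂ), U ≤ G →
    IsZariskiClosed (U : Set (GL (Fin n) ℂ)) → IsZariskiConnected (U : Set (GL (Fin n) ℂ)) →
    (∀ g ∈ G, ∀ u ∈ U, g * u * g⁻¹ ∈ U) →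
    (∀ u ∈ U, IsNilpotent ((u : Matrix (Fin n) (Fin n) ℂ) - 1)) → U = ⊥

/-- `𝔤` is the Lie algebra of the (closed) group `G`: the matrices `X` such that
`exp (sX) ∈ G` for all `s ∈ ℂ`. -/
def IsLieAlgebraOf (𝔤 : LieSubalgebra ℂ (Matrix (Fin n) (Fin n) ℂ))
    (G : Subgroup (GL (Fin n) ℂ)) : Prop :=
  ∀ X : Matrix (Fin n) (Fin n) ℂ,
    X ∈ 𝔤 ↔ ∀ s : ℂ, ∃ g ∈ G, (g : Matrix (Fin n) (Fin n) ℂ) = NormedSpace.exp (s • X)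

/-- Regular functions on `G`: polynomials in the matrix entries and the inverse determinant. -/
def IsRegularFun {G : Subgroup (GL (Fin n) ℂ)} (f : G → ℂ) : Prop :=
  ∃ (p : MvPolynomial (Fin n × Fin n) ℂ) (k : ℕ), ∀ g : G,
    f g * ((g : GL (Fin n) ℂ) : Matrix (Fin n) (Fin n) ℂ).det ^ k = evalGL p g

variable {V : Type*} [AddCommGroup V] [Module ℂ V]

/-- A locally finite module over the algebraic group `G`: a representation which acts by regular
matrix coefficients and is a direct sum of irreducible finite-dimensional subrepresentations. -/
structure IsLocallyFiniteModule {G : Subgroup (GL (Fin n) ℂ)} (ρ : Representation ℂ G V) :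
    Prop where
  regular : ∀ (v : V) (φ : Module.Dual ℂ V), IsRegularFun fun g : G => φ (ρ g v)
  decomposes : ∃ 𝒲 : Set (Subrepresentation ρ),
    (∀ W ∈ 𝒲, W.toRepresentation.IsIrreducible ∧ FiniteDimensional ℂ W.toSubmodule) ∧
    iSupIndep (fun W : 𝒲 => W.1.toSubmodule) ∧ ⨆ W : 𝒲, W.1.toSubmodule = ⊤

/-- The action of `𝔤 = Lie G` on `V` is the differential of the action `ρ` of `G`:
`X v` is the derivative at `s = 0` of `ρ (exp (sX)) v`. -/
def IsDifferential {G : Subgroup (GL (Fin n) ℂ)}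
    (𝔤 : LieSubalgebra ℂ (Matrix (Fin n) (Fin n) ℂ)) [LieRingModule 𝔤 V]
    (ρ : Representation ℂ G V) : Prop :=
  ∀ (X : 𝔤) (g : ℂ → G),
    (∀ s, ((g s : GL (Fin n) ℂ) : Matrix (Fin n) (Fin n) ℂ) =
      NormedSpace.exp (s • (X : Matrix (Fin n) (Fin n) ℂ))) →
    ∀ (v : V) (φ : Module.Dual ℂ V), HasDerivAt (fun s => φ (ρ (g s) v)) (φ ⁅X, v⁆) 0

/-- The connected subgroup of `GL_n(ℂ)` corresponding to a set (a Lie subalgebra) of matrices. -/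
def connectedSubgroup (𝔥 : Set (Matrix (Fin n) (Fin n) ℂ)) : Subgroup (GL (Fin n) ℂ) :=
  Subgroup.closure {g | ∃ X ∈ 𝔥, (g : Matrix (Fin n) (Fin n) ℂ) = NormedSpace.exp X}

/-- `𝔤` is stable under conjugation by `G`. -/
theorem conj_mem {G : Subgroup (GL (Fin n) ℂ)}
    {𝔤 : LieSubalgebra ℂ (Matrix (Fin n) (Fin n) ℂ)} (h𝔤 : IsLieAlgebraOf 𝔤 G)
    {g : GL (Fin n) ℂ} (hg : g ∈ G) {X : Matrix (Fin n) (Fin n) ℂ} (hX : X ∈ 𝔤) :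
    (g : Matrix (Fin n) (Fin n) ℂ) * X * ((g⁻¹ : GL (Fin n) ℂ) : Matrix (Fin n) (Fin n) ℂ)
      ∈ 𝔤 := by
  rw [h𝔤]
  intro s
  obtain ⟨y, hy, hyX⟩ := (h𝔤 X).1 hX s
  refine ⟨g * y * g⁻¹, G.mul_mem (G.mul_mem hg hy) (G.inv_mem hg), ?_⟩
  have := Matrix.exp_units_conj g (s • X)
  rw [Units.val_mul, Units.val_mul, hyX, ← this]
  simp

/-- The adjoint action `X ↦ g X g⁻¹` of `g ∈ G` on `𝔤 = Lie G`. -/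
def Ad {G : Subgroup (GL (Fin n) ℂ)}
    {𝔤 : LieSubalgebra ℂ (Matrix (Fin n) (Fin n) ℂ)} (h𝔤 : IsLieAlgebraOf 𝔤 G) (g : G) :
    𝔤 →ₗ⁅ℂ⁆ 𝔤 where
  toFun X := ⟨_, conj_mem h𝔤 g.2 X.2⟩
  map_add' X Y := by ext1; simp [mul_add, add_mul]
  map_smul' c X := by ext1; simp
  map_lie' {X Y} := by
    ext1
    simp only [LieSubalgebra.coe_bracket, LieRing.of_associative_ring_bracket, mul_sub, sub_mul]
    simp [mul_assoc]

end Groups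

/-! ### Universal enveloping algebras -/

/-- The universal enveloping algebra of a complex Lie algebra. -/
abbrev U (L : Type*) [LieRing L] [LieAlgebra ℂ L] : Type _ := UniversalEnvelopingAlgebra ℂ L

section Enveloping

variable {L L' : Type*} [LieRing L] [LieAlgebra ℂ L] [LieRing L'] [LieAlgebra ℂ L']

/-- The canonical map of a Lie algebra to its universal enveloping algebra. -/
abbrev ι (X : L) : U L := UniversalEnvelopingAlgebra.ι ℂ X

/-- The algebra homomorphism `U(L) → U(L')` induced by a homomorphism `L → L'`. -/
def U.map (f : L →ₗ⁅ℂ⁆ L') : U L →ₐ[ℂ] U L' :=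
  UniversalEnvelopingAlgebra.lift ℂ ((UniversalEnvelopingAlgebra.ι ℂ).comp f)

/-- `U(L)` is generated by `L`. -/
theorem U.mem_of_subalgebra (A : Subalgebra ℂ (U L)) (hA : ∀ X : L, ι X ∈ A) (u : U L) :
    u ∈ A := by
  let f : L →ₗ⁅ℂ⁆ A :=
    { toFun := fun X => ⟨ι X, hA X⟩
      map_add' := fun X Y => by ext1; simp [ι]
      map_smul' := fun c X => by ext1; simp [ι]
      map_lie' := fun {X Y} => by
        ext1; simp [ι, LieRing.of_associative_ring_bracket] }
  have h : A.val.comp (UniversalEnvelopingAlgebra.lift ℂ f) = AlgHom.id ℂ (U L) := by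
    apply UniversalEnvelopingAlgebra.hom_ext
    ext X
    simp [f]
  have := congrArg (fun F : U L →ₐ[ℂ] U L => F u) h
  simp only [AlgHom.comp_apply, AlgHom.id_apply] at this
  rw [← this]
  exact Subtype.property _

/-- The universal enveloping algebra of an abelian Lie algebra is commutative. -/
instance U.instCommRing [IsLieAbelian L] : CommRing (U L) :=
  { (inferInstance : Ring (U L)) with
    mul_comm := fun a b => by
      have h1 : ∀ (X : L) (u : U L), u * ι X = ι X * u := fun X u => by
        have := U.mem_of_subalgebra (Subalgebra.centralizer ℂ {ι X}) (fun Y => by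
          rw [Subalgebra.mem_centralizer_iff]
          rintro _ rfl
          have h := LieHom.map_lie (UniversalEnvelopingAlgebra.ι ℂ) X Y
          rw [trivial_lie_zero, _root_.map_zero, LieRing.of_associative_ring_bracket] at h
          exact (sub_eq_zero.1 h.symm)) u
        rw [Subalgebra.mem_centralizer_iff] at this
        exact (this _ rfl).symm
      have := U.mem_of_subalgebra (Subalgebra.centralizer ℂ {a}) (fun Y => by
        rw [Subalgebra.mem_centralizer_iff]
        intro g hg
        rw [Set.mem_singleton_iff.1 hg]
        exact h1 Y a) b
      rw [Subalgebra.mem_centralizer_iff] at this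
      exact this a rfl }

end Enveloping

/-! ### Triangular decompositions -/

section Triangular

variable {𝔤 : Type*} [LieRing 𝔤] [LieAlgebra ℂ 𝔤] (𝔱 : LieSubalgebra ℂ 𝔤) [IsLieAbelian 𝔱]

/-- `β ∈ 𝔱*` is a root of `𝔤` relative to `𝔱`. -/
def IsRoot (β : Module.Dual ℂ 𝔱) : Prop :=
  β ≠ 0 ∧ LieAlgebra.rootSpace 𝔱 β ≠ ⊥

/-- `h ∈ 𝔱` is the coroot corresponding to the root `β`: it lies in `[𝔤_β, 𝔤_{-β}]` and
`β(h) = 2`. -/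
def IsCoroot (β : Module.Dual ℂ 𝔱) (h : 𝔱) : Prop :=
  β h = 2 ∧ ∃ x ∈ LieAlgebra.rootSpace 𝔱 β, ∃ y ∈ LieAlgebra.rootSpace 𝔱 (-β), ⁅x, y⁆ = (h : 𝔤)

/-- A choice of simple roots `α_1, …, α_r` of `𝔤` relative to the Cartan subalgebra `𝔱`, with
root vectors `E_i`, `F_i` for `α_i`, `-α_i` normalised by `[E_i, F_i] = H_i = α_i^∨`. -/
structure SimpleRoots (r : ℕ) where
  /-- the simple roots -/
  α : Fin r → Module.Dual ℂ 𝔱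
  /-- the simple root vectors -/
  E : Fin r → 𝔤
  /-- the root vectors of the negatives of the simple roots -/
  F : Fin r → 𝔤
  /-- the simple coroots -/
  H : Fin r → 𝔱
  linearIndependent : LinearIndependent ℂ α
  root_eq : ∀ β, IsRoot 𝔱 β → ∃ c : Fin r → ℕ, β = ∑ i, c i • α i ∨ β = -∑ i, c i • α i
  lie_E : ∀ i (h : 𝔱), ⁅(h : 𝔤), E i⁆ = α i h • E i
  lie_F : ∀ i (h : 𝔱), ⁅(h : 𝔤), F i⁆ = -(α i h • F i)
  lie_E_F : ∀ i, ⁅E i, F i⁆ = (H i : 𝔤)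
  α_H : ∀ i, α i (H i) = 2

variable {𝔱} {r : ℕ} (D : SimpleRoots 𝔱 r)

namespace SimpleRoots

/-- The positive roots. -/
def IsPositive (β : Module.Dual ℂ 𝔱) : Prop :=
  IsRoot 𝔱 β ∧ ∃ c : Fin r → ℕ, β = ∑ i, c i • D.α i

/-- `𝔫`, the sum of the root spaces of the positive roots. -/
def nPlus : LieSubmodule ℂ 𝔱 𝔤 :=
  ⨆ (β : Module.Dual ℂ 𝔱) (_ : D.IsPositive β), LieAlgebra.rootSpace 𝔱 β

/-- `𝔫₋`, the sum of the root spaces of the negative roots. -/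
def nMinus : LieSubmodule ℂ 𝔱 𝔤 :=
  ⨆ (β : Module.Dual ℂ 𝔱) (_ : D.IsPositive β), LieAlgebra.rootSpace 𝔱 (-β)

/-- The `𝔰𝔩₂`-subalgebra `𝔤_i` generated (and in fact spanned) by `E_i`, `F_i`, `H_i`. -/
def sl2 (i : Fin r) : LieSubalgebra ℂ 𝔤 :=
  LieSubalgebra.lieSpan ℂ 𝔤 {D.E i, D.F i, (D.H i : 𝔤)}

/-- The simple reflection `s_i` on `𝔱`. -/
def s (i : Fin r) : 𝔱 →ₗ[ℂ] 𝔱 :=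
  LinearMap.id - (D.α i).smulRight (D.H i)

/-- The simple reflection `s_i` on `𝔱*`. -/
def sDual (i : Fin r) : Module.Dual ℂ 𝔱 →ₗ[ℂ] Module.Dual ℂ 𝔱 :=
  (D.s i).dualMap

/-- The shifted action `Φ ↦ s_i ∘ Φ` of `s_i` on `U(𝔱)`. It is the automorphism with
`s_i ∘ h = s_i(h) - α_i(h)` for `h ∈ 𝔱`; see `eval_shifted` for its description through
polynomial functions on `𝔱*`. -/
def shifted (i : Fin r) : U 𝔱 →ₐ[ℂ] U 𝔱 :=
  UniversalEnvelopingAlgebra.lift ℂ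
    { toFun := fun h => ι (D.s i h) - algebraMap ℂ (U 𝔱) (D.α i h)
      map_add' := fun h h' => by simp only [ι, map_add]; abel
      map_smul' := fun c h => by
        simp only [ι, map_smul, smul_sub, smul_eq_mul, map_mul, RingHom.id_apply]
        rw [Algebra.smul_def c (algebraMap ℂ (U 𝔱) _)]
      map_lie' := fun {h h'} => by
        rw [LieRing.of_associative_ring_bracket, mul_comm, sub_self, trivial_lie_zero]
        simp [ι] }

end SimpleRoots

/-- The value at `μ ∈ 𝔱*` of an element of `U(𝔱)`, regarded as a polynomial function on `𝔱*`. -/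
def evalAt (μ : Module.Dual ℂ 𝔱) : U 𝔱 →ₐ[ℂ] ℂ :=
  UniversalEnvelopingAlgebra.lift ℂ
    { (μ : 𝔱 →ₗ[ℂ] ℂ) with
      map_lie' := fun {h h'} => by
        rw [LieRing.of_associative_ring_bracket, mul_comm, sub_self, trivial_lie_zero]
        simp }

/-- The shifted action through polynomial functions: `(s_i ∘ Φ)(μ) = Φ(s_i ∘ μ)`, where
`s_i ∘ μ = s_i(μ + α_i)` (and `s_i` is its own inverse). -/
theorem SimpleRoots.eval_shifted (i : Fin r) (Φ : U 𝔱) (μ : Module.Dual ℂ 𝔱) :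
    evalAt μ (D.shifted i Φ) = evalAt (D.sDual i (μ + D.α i)) Φ := by
  have : (evalAt μ).comp (D.shifted i) = evalAt (D.sDual i (μ + D.α i)) := by
    apply UniversalEnvelopingAlgebra.hom_ext
    ext h
    have hl : ∀ (μ : Module.Dual ℂ 𝔱) (h : 𝔱),
        evalAt μ (UniversalEnvelopingAlgebra.ι ℂ h) = μ h := fun μ h => by
      rw [evalAt, UniversalEnvelopingAlgebra.lift_ι_apply]
      rfl
    have hs : D.shifted i (UniversalEnvelopingAlgebra.ι ℂ h) =
        ι (D.s i h) - algebraMap ℂ (U 𝔱) (D.α i h) := by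
      rw [SimpleRoots.shifted, UniversalEnvelopingAlgebra.lift_ι_apply]
      rfl
    simp only [LieHom.coe_comp, Function.comp_apply, AlgHom.coe_toLieHom, AlgHom.comp_apply]
    rw [hl, hs, map_sub, ι, hl, AlgHom.commutes]
    simp [SimpleRoots.sDual, SimpleRoots.s, D.α_H, Algebra.algebraMap_self]
    ring
  exact congrArg (fun f : U 𝔱 →ₐ[ℂ] ℂ => f Φ) this

variable (𝔱) in
/-- The multiplicative set of denominators in `U(𝔱)`, generated by the elements `H_β + k`
where `H_β` runs over the coroots and `k ∈ ℤ`. -/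
def denominators : Submonoid (U 𝔱) :=
  Submonoid.closure
    {x | ∃ (β : Module.Dual ℂ 𝔱) (h : 𝔱) (k : ℤ), IsRoot 𝔱 β ∧ IsCoroot 𝔱 β h ∧ x = ι h + k}

end Triangular

/-! ### The bimodule `M = U(𝔤) ⊗ V`, the quotient `Z`, and the Zhelobenko operators -/

section Zhelobenko

variable {𝔤 : Type*} [LieRing 𝔤] [LieAlgebra ℂ 𝔤] {𝔱 : LieSubalgebra ℂ 𝔤} [IsLieAbelian 𝔱]
variable {r : ℕ} (D : SimpleRoots 𝔱 r)
variable (V : Type*) [AddCommGroup V] [Module ℂ V] [LieRingModule 𝔤 V] [LieModule ℂ 𝔤 V]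

/-- `U(𝔤)` as a left module over `U(𝔱)`. -/
instance U.instModule : Module (U 𝔱) (U 𝔤) :=
  Module.compHom (U 𝔤) (U.map 𝔱.incl).toRingHom

theorem U.smul_eq (a : U 𝔱) (u : U 𝔤) : a • u = U.map 𝔱.incl a * u := rfl

instance U.instScalarTower : IsScalarTower ℂ (U 𝔱) (U 𝔤) where
  smul_assoc c a u := by simp [U.smul_eq]

instance U.instSMulComm : SMulCommClass ℂ (U 𝔱) (U 𝔤) where
  smul_comm c a u := by simp [U.smul_eq]

/-- `M = U(𝔤) ⊗ V`; the left actions of `U(𝔤)` and of `U(𝔱)` on `M` are the module structures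
coming from the first tensor factor. -/
abbrev M (𝔤 V : Type*) [LieRing 𝔤] [LieAlgebra ℂ 𝔤] [AddCommGroup V] [Module ℂ V] : Type _ :=
  U 𝔤 ⊗[ℂ] V

/-- The left action on `M`: `X (u ⊗ v) = (X u) ⊗ v`. -/
def lAct (X : 𝔤) : M 𝔤 V →ₗ[ℂ] M 𝔤 V :=
  TensorProduct.map (LinearMap.mulLeft ℂ (ι X)) LinearMap.id

/-- The right action on `M`: `(u ⊗ v) X = (u X) ⊗ v - u ⊗ (X v)`. -/
def rAct (X : 𝔤) : M 𝔤 V →ₗ[ℂ] M 𝔤 V :=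
  TensorProduct.map (LinearMap.mulRight ℂ (ι X)) LinearMap.id -
    TensorProduct.map LinearMap.id (LieModule.toEnd ℂ 𝔤 V X)

/-- The adjoint action on `M`: `(ad X) m = X m - m X`. -/
def ad (X : 𝔤) : M 𝔤 V →ₗ[ℂ] M 𝔤 V :=
  lAct V X - rAct V X

theorem lAct_tmul (X : 𝔤) (u : U 𝔤) (v : V) :
    lAct V X (u ⊗ₜ v) = (ι X * u) ⊗ₜ[ℂ] v := rfl

theorem rAct_tmul (X : 𝔤) (u : U 𝔤) (v : V) :
    rAct V X (u ⊗ₜ v) = (u * ι X) ⊗ₜ[ℂ] v - u ⊗ₜ[ℂ] ⁅X, v⁆ := rfl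

theorem ι_lie (X Y : 𝔤) : ι ⁅X, Y⁆ = ι X * ι Y - ι Y * ι X := by
  rw [ι, LieHom.map_lie, LieRing.of_associative_ring_bracket]

theorem ι_smul (h : 𝔱) (m : M 𝔤 V) : ι h • m = lAct V (h : 𝔤) m := by
  induction m using TensorProduct.induction_on with
  | zero => simp
  | add x y hx hy => rw [smul_add, hx, hy, map_add]
  | tmul u v =>
    rw [TensorProduct.smul_tmul', lAct_tmul, U.smul_eq, U.map, ι,
      UniversalEnvelopingAlgebra.lift_ι_apply]
    rfl

theorem rAct_smul (X : 𝔤) (a : U 𝔱) (m : M 𝔤 V) : rAct V X (a • m) = a • rAct V X m := by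
  induction m using TensorProduct.induction_on with
  | zero => simp
  | add x y hx hy => rw [smul_add, map_add, hx, hy, map_add, smul_add]
  | tmul u v =>
    rw [TensorProduct.smul_tmul', rAct_tmul, rAct_tmul, smul_sub, TensorProduct.smul_tmul',
      TensorProduct.smul_tmul', U.smul_eq, U.smul_eq, mul_assoc]

theorem lAct_lAct (X Y : 𝔤) (m : M 𝔤 V) :
    lAct V X (lAct V Y m) = lAct V Y (lAct V X m) + lAct V ⁅X, Y⁆ m := by
  induction m using TensorProduct.induction_on with
  | zero => simp
  | add x y hx hy => simp only [map_add, hx, hy]; abel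
  | tmul u v =>
    simp only [lAct_tmul, ι_lie, ← TensorProduct.add_tmul]
    congr 1
    noncomm_ring

theorem lAct_rAct (X Y : 𝔤) (m : M 𝔤 V) :
    lAct V X (rAct V Y m) = rAct V Y (lAct V X m) := by
  induction m using TensorProduct.induction_on with
  | zero => simp
  | add x y hx hy => simp only [map_add, hx, hy]
  | tmul u v => simp only [lAct_tmul, rAct_tmul, map_sub, mul_assoc]

theorem rAct_rAct (X Y : 𝔤) (m : M 𝔤 V) :
    rAct V Y (rAct V X m) = rAct V X (rAct V Y m) + rAct V ⁅X, Y⁆ m := by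
  induction m using TensorProduct.induction_on with
  | zero => simp
  | add x y hx hy => simp only [map_add, hx, hy]; abel
  | tmul u v =>
    simp only [rAct_tmul, map_sub, ι_lie, lie_lie, mul_sub, TensorProduct.sub_tmul,
      TensorProduct.tmul_sub, mul_assoc]
    abel

namespace SimpleRoots

/-- The set of all products `X m` with `X ∈ 𝔫₋` and `m X` with `X ∈ 𝔫`, where `m ∈ M`. -/
def generators : Set (M 𝔤 V) :=
  {m | ∃ X ∈ D.nMinus, ∃ m', m = lAct V X m'} ∪ {m | ∃ X ∈ D.nPlus, ∃ m', m = rAct V X m'}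

theorem lAct_mem (h : 𝔱) {m : M 𝔤 V} (hm : m ∈ Submodule.span ℂ (D.generators V)) :
    lAct V (h : 𝔤) m ∈ Submodule.span ℂ (D.generators V) := by
  induction hm using Submodule.span_induction with
  | zero => simp
  | add x y _ _ hx hy => rw [map_add]; exact add_mem hx hy
  | smul c x _ hx => rw [map_smul]; exact Submodule.smul_mem _ _ hx
  | mem x hx =>
    rcases hx with ⟨X, hX, m', rfl⟩ | ⟨X, hX, m', rfl⟩
    · rw [lAct_lAct]
      refine add_mem (Submodule.subset_span (Or.inl ⟨X, hX, _, rfl⟩))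
        (Submodule.subset_span (Or.inl ⟨_, ?_, _, rfl⟩))
      exact D.nMinus.lie_mem (x := h) hX
    · rw [lAct_rAct]
      exact Submodule.subset_span (Or.inr ⟨X, hX, _, rfl⟩)

theorem rAct_mem (h : 𝔱) {m : M 𝔤 V} (hm : m ∈ Submodule.span ℂ (D.generators V)) :
    rAct V (h : 𝔤) m ∈ Submodule.span ℂ (D.generators V) := by
  induction hm using Submodule.span_induction with
  | zero => simp
  | add x y _ _ hx hy => rw [map_add]; exact add_mem hx hy
  | smul c x _ hx => rw [map_smul]; exact Submodule.smul_mem _ _ hx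
  | mem x hx =>
    rcases hx with ⟨X, hX, m', rfl⟩ | ⟨X, hX, m', rfl⟩
    · rw [← lAct_rAct]
      exact Submodule.subset_span (Or.inl ⟨X, hX, _, rfl⟩)
    · rw [rAct_rAct, ← lie_skew, ← neg_lie, ← lie_skew]
      refine add_mem (Submodule.subset_span (Or.inr ⟨X, hX, _, rfl⟩))
        (Submodule.subset_span (Or.inr ⟨_, ?_, _, rfl⟩))
      rw [lie_neg, neg_neg, ← lie_skew]
      exact neg_mem (D.nPlus.lie_mem (x := h) hX)

/-- The subspace `𝔫₋ M + M 𝔫` of `M`, which is stable under the left action of `U(𝔱)`. -/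
def J : Submodule (U 𝔱) (M 𝔤 V) where
  __ := (Submodule.span ℂ (D.generators V)).toAddSubmonoid
  smul_mem' a m hm := by
    let A : Subalgebra ℂ (U 𝔱) :=
      { carrier := {a | ∀ m ∈ Submodule.span ℂ (D.generators V),
          a • m ∈ Submodule.span ℂ (D.generators V)}
        mul_mem' := fun {a b} ha hb m hm => by rw [mul_smul]; exact ha _ (hb _ hm)
        add_mem' := fun {a b} ha hb m hm => by rw [add_smul]; exact add_mem (ha _ hm) (hb _ hm)
        algebraMap_mem' := fun c m hm => by
          rw [algebraMap_smul]; exact Submodule.smul_mem _ _ hm }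
    refine U.mem_of_subalgebra A (fun h m hm => ?_) a m hm
    rw [ι_smul]
    exact D.lAct_mem V h hm

theorem mem_J {m : M 𝔤 V} : m ∈ D.J V ↔ m ∈ Submodule.span ℂ (D.generators V) := Iff.rfl

/-- The quotient `Z = M / (𝔫₋ M + M 𝔫)`, as a left module over `U(𝔱)`. -/
abbrev Z : Type _ := M 𝔤 V ⧸ D.J V

/-- The adjoint action of `h ∈ 𝔱` on `Z`, induced by that on `M`. -/
def adZ (h : 𝔱) : D.Z V →ₗ[U 𝔱] D.Z V :=
  (D.J V).mapQ (D.J V)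
    { toFun := ad V (h : 𝔤)
      map_add' := map_add _
      map_smul' := fun a m => by
        simp only [ad, LinearMap.sub_apply, ← ι_smul, rAct_smul, RingHom.id_apply, smul_sub,
          smul_comm a (ι h) m] }
    (fun m hm => by
      rw [mem_J] at hm
      exact sub_mem (D.lAct_mem V h hm) (D.rAct_mem V h hm))

/-- The zero weight subspace `Z⁰` of `Z` relative to the adjoint action of `𝔱`. -/
def Z0 : Submodule (U 𝔱) (D.Z V) :=
  ⨅ h : 𝔱, LinearMap.ker (D.adZ V h)

/-- The image of `v ∈ V` in `Z`, that is, the class of `1 ⊗ v`. -/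
def ofV (v : V) : D.Z V := (D.J V).mkQ (1 ⊗ₜ[ℂ] v)

/-- `M̄`, the module of fractions of the left `U(𝔱)`-module `M` relative to the denominators
`H_β + k`. -/
abbrev Mbar (_D : SimpleRoots 𝔱 r) : Type _ := LocalizedModule (denominators 𝔱) (M 𝔤 V)

/-- `Z̄`, the module of fractions of the left `U(𝔱)`-module `Z` relative to the denominators
`H_β + k`. -/
abbrev Zbar : Type _ := LocalizedModule (denominators 𝔱) (D.Z V)

/-- The natural map `Z → Z̄`. -/
def toZbar : D.Z V →ₗ[U 𝔱] D.Zbar V := LocalizedModule.mkLinearMap _ _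

/-- The natural map `M̄ → Z̄`, induced by the projection `M → Z`. -/
def projBar : D.Mbar V →ₗ[U 𝔱] D.Zbar V :=
  IsLocalizedModule.map (denominators 𝔱) (LocalizedModule.mkLinearMap _ _)
    (LocalizedModule.mkLinearMap _ _) (D.J V).mkQ

theorem isCoroot_H (i : Fin r) : IsRoot 𝔱 (D.α i) ∧ IsCoroot 𝔱 (D.α i) (D.H i) := by
  have hE : D.E i ∈ LieAlgebra.rootSpace 𝔱 (D.α i) :=
    LieModule.weightSpace_le_genWeightSpace 𝔤 _ ((LieModule.mem_weightSpace _ _).2 (D.lie_E i))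
  have hF : D.F i ∈ LieAlgebra.rootSpace 𝔱 (-(D.α i)) :=
    LieModule.weightSpace_le_genWeightSpace 𝔤 _ ((LieModule.mem_weightSpace _ _).2 fun h => by
      simpa using D.lie_F i h)
  refine ⟨⟨fun h0 => by simpa [h0] using D.α_H i, fun h0 => ?_⟩, D.α_H i, _, hE, _, hF,
    D.lie_E_F i⟩
  have hE0 : D.E i = 0 := by simpa [h0] using hE
  have h1 : D.H i = 0 := by
    have := D.lie_E_F i
    rw [hE0, zero_lie] at this
    exact Subtype.ext this.symm
  simpa [h1] using D.α_H i

/-- The denominator `H_i (H_i - 1) ⋯ (H_i - k + 1)`. -/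
def den (i : Fin r) (k : ℕ) : denominators 𝔱 :=
  ⟨∏ l ∈ Finset.range k, (ι (D.H i) - (l : U 𝔱)), Submonoid.prod_mem _ fun l _ =>
    Submonoid.subset_closure ⟨D.α i, D.H i, -l, (D.isCoroot_H i).1, (D.isCoroot_H i).2, by
      push_cast; rw [sub_eq_add_neg]⟩⟩

/-- The map `η_i : M → M̄` for a given action `σ` on `M` of the representative of `s_i`:
`η_i(m) = ∑_k (k! H_i (H_i - 1) ⋯ (H_i - k + 1))⁻¹ E_i^k (ad F_i)^k σ(m)`,
where only finitely many summands are non-zero. -/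
def η (i : Fin r) (σ : M 𝔤 V →ₗ[ℂ] M 𝔤 V) (m : M 𝔤 V) : D.Mbar V :=
  ∑ᶠ k : ℕ, LocalizedModule.mk
    ((k.factorial : ℂ)⁻¹ • (lAct V (D.E i) ^ k) ((ad V (D.F i) ^ k) (σ m))) (D.den i k)

/-- `ξ_i(z) = w`, where `ξ_i : Z → Z̄` is the Zhelobenko operator, the map induced by `η_i`: the
class of `η_i(m)` in `Z̄` is `w` for every representative `m ∈ M` of `z`. -/
def XiEq (i : Fin r) (σ : M 𝔤 V →ₗ[ℂ] M 𝔤 V) (z : D.Z V) (w : D.Zbar V) : Prop :=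
  ∀ m : M 𝔤 V, (D.J V).mkQ m = z → D.projBar V (D.η V i σ m) = w

/-- The subset `Q` of `Z⁰` of the elements invariant under all the Zhelobenko operators, where
`σ i` is the action on `M` of the chosen representative of `s_i`. -/
def Q (σ : Fin r → M 𝔤 V →ₗ[ℂ] M 𝔤 V) : Set (D.Z V) :=
  {z | z ∈ D.Z0 V ∧ ∀ i, D.XiEq V i (σ i) z (D.toZbar V z)}

/-- The sum `V_{ij}` of the `(2j+1)`-dimensional irreducible `𝔤_i`-submodules of `V`. -/
def isotypic (i : Fin r) (j : ℕ) : LieSubmodule ℂ (D.sl2 i) V :=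
  sSup {W | LieModule.IsIrreducible ℂ (D.sl2 i) W ∧ Module.finrank ℂ W = 2 * j + 1}

/-- `Ψ_{ij} = (H_i + 2)(H_i + 3) ⋯ (H_i + j + 1)`. -/
def Ψ (i : Fin r) (j : ℕ) : U 𝔱 :=
  ∏ l ∈ Finset.range j, (ι (D.H i) + ((l + 2 : ℕ) : U 𝔱))

end SimpleRoots

end Zhelobenko

/-- The diagonal action of `g ∈ G` on `M = U(𝔤) ⊗ V`. -/
def diagonal {n : ℕ} {G : Subgroup (GL (Fin n) ℂ)}
    {𝔤 : LieSubalgebra ℂ (Matrix (Fin n) (Fin n) ℂ)} (h𝔤 : IsLieAlgebraOf 𝔤 G)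
    {V : Type*} [AddCommGroup V] [Module ℂ V] (ρ : Representation ℂ G V) (g : G) :
    M 𝔤 V →ₗ[ℂ] M 𝔤 V :=
  TensorProduct.map (U.map (Ad h𝔤 g)).toLinearMap (ρ g)

end HarishChandra

end

/-!
With denominators allowed, everything is diagonal: `ξ_i(v) = (Ψ_ij / (s_i ∘ Ψ_ij)) v` for
`v ∈ V⁰ ∩ V_ij` (`shifted_Ψ_smul_xi`), and `ξ_i(Θ z) = (s_i ∘ Θ) ξ_i(z)` for `Θ ∈ U(𝔱)`.
Hence for a basis `(v_a)` of `V⁰` with `v_a ∈ V_{i j_a}` the element `∑ Θ_a v_a` is invariant under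
`ξ_i` exactly when `(s_i ∘ Θ_a) Ψ_a = (s_i ∘ Ψ_a) Θ_a` for all `a`. As polynomials in `H_i`,
`Ψ_a` has negative and `s_i ∘ Ψ_a` has nonnegative roots, so the two are coprime (`isCoprime_Ψ`); then `Ψ_a`
divides `Θ_a`, and the quotient is invariant under the shifted action (`exists_invariant`).

This comparison of coefficients needs `Z` to be free over `U(𝔱)` on `V` (`ofTensor_bijective`),
which is the triangular decomposition `U(𝔤) = U(𝔫₋) U(𝔱) U(𝔫)` (`mul₃_bijective`). It also gives
`Z⁰ = U(𝔱) V⁰` (`Z0_eq_span`) and the injectivity of `Z → Z̄` (`toZbar_injective`), because `U(𝔱)`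
is a domain in which no denominator vanishes. The triangular decomposition comes from the
Poincaré–Birkhoff–Witt theorem. Its spanning half is straightening (`eq_top_of_words`). Its
independence half is easy for a Lie algebra of matrices (`linearIndependent_word`): `U(𝔤)` acts on
polynomials in the matrix entries by left-invariant vector fields, and the leading symbols at the
identity of the ordered monomials in a basis of `𝔤` are distinct monomials.

That `V⁰` has such a basis is the theory of locally finite `𝔰𝔩₂`-modules: `F_i E_i` is
diagonalizable on `V⁰`, with eigenvalues `j (j + 1)` (`weightSpace_le_span`), and the eigenvectors
are the elements of `V⁰ ∩ V_ij` (`mem_isotypic_iff`).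

The value `ξ_i(v)` has two ingredients. The representative of `s_i` acts on `V⁰ ∩ V_ij` by
`(-1) ^ j` (`rho_reflection`). Indeed, if `v` generates an irreducible module with highest weight
vector `u`, then `aE_i + bH_i + cF_i ↦ (a - 2bt - ct²) ^ j` is a homogeneous polynomial map of
degree `j` from `𝔤_i` to this module, realized on the polynomials of degree at most `2j` in a
variable `t`. It commutes with one-parameter subgroups, hence with the connected subgroup with Lie
algebra `𝔤_i`; it sends `H_i` to a multiple of `v`, and the representative of `s_i` sends `H_i` to
`-H_i`. Secondly, the series for `ξ_i(v)` is evaluated by the Chu–Vandermonde identity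
(`den_smul_xi_one_tmul`).

Finally `ξ_i` is well defined on `Z` (`xi_comp_eq_zero`) and semilinear (`xi_comp_smul`). The
representative of `s_i`, `E_i` and `ad F_i` preserve the parts of `𝔫₋ M` and `M 𝔫` which belong to
root vectors not proportional to `α_i`. For the remaining generators `E_i`, `F_i` and `h ∈ 𝔱` the
partial sums of the series telescope.
-/

noncomputable section

set_option linter.unusedSectionVars false

namespace HarishChandra

/-! ### Ordered monomials in enveloping algebras -/

section Monomials

variable {L : Type*} [LieRing L] [LieAlgebra ℂ L] {σ : Type*}

/-- The monomial in `U(L)` spelled by a word `l` in the letters `e i`. -/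
def word (e : σ → L) (l : List σ) : U L := (l.map fun i => ι (e i)).prod

@[simp] theorem word_nil (e : σ → L) : word e [] = 1 := rfl

@[simp] theorem word_cons (e : σ → L) (i : σ) (l : List σ) :
    word e (i :: l) = ι (e i) * word e l := by simp [word]

@[simp] theorem word_append (e : σ → L) (l l' : List σ) :
    word e (l ++ l') = word e l * word e l' := by simp [word]

theorem word_map {τ : Type*} (e : σ → L) (f : τ → σ) (l : List τ) :
    word e (l.map f) = word (e ∘ f) l := by simp [word, Function.comp_def]

theorem map_word {L' : Type*} [LieRing L'] [LieAlgebra ℂ L'] (f : L →ₗ⁅ℂ⁆ L') (e : σ → L)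
    (l : List σ) : U.map f (word e l) = word (f ∘ e) l := by
  induction l with
  | nil => simp
  | cons i l ih =>
    rw [word_cons, map_mul, ih, word_cons]
    simp [U.map, ι]

/-- The span of the monomials of degree less than `k`. -/
def wordsLT (e : σ → L) (k : ℕ) : Submodule ℂ (U L) :=
  Submodule.span ℂ {u | ∃ l : List σ, l.length < k ∧ u = word e l}

theorem wordsLT_cons {e : σ → L} (i : σ) {k : ℕ} {u : U L} (hu : u ∈ wordsLT e k) :
    ι (e i) * u ∈ wordsLT e (k + 1) := by
  induction hu using Submodule.span_induction with
  | zero => simp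
  | add x y _ _ hx hy => rw [mul_add]; exact add_mem hx hy
  | smul c x _ hx => rw [mul_smul_comm]; exact Submodule.smul_mem _ _ hx
  | mem x hx =>
    obtain ⟨l, hl, rfl⟩ := hx
    exact Submodule.subset_span ⟨i :: l, by simpa using hl, by simp⟩

/-- Straightening: permuting the letters of a monomial changes it by terms of lower degree. -/
theorem word_sub_word_mem {e : σ → L} (he : Submodule.span ℂ (Set.range e) = ⊤)
    {l l' : List σ} (h : l.Perm l') : word e l - word e l' ∈ wordsLT e l.length := by
  induction h with
  | nil => simp
  | cons i h ih =>
    rw [word_cons, word_cons, ← mul_sub]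
    exact wordsLT_cons i ih
  | swap i j l =>
    have h1 : ∀ x : L, ι x * word e l ∈ wordsLT e (l.length + 2) := fun x => by
      have hx : x ∈ Submodule.span ℂ (Set.range e) := he ▸ Submodule.mem_top
      induction hx using Submodule.span_induction with
      | zero => simp [ι]
      | add x y _ _ hx hy => rw [ι, map_add, add_mul]; exact add_mem hx hy
      | smul c x _ hx => rw [ι, map_smul, smul_mul_assoc]; exact Submodule.smul_mem _ _ hx
      | mem x hx =>
        obtain ⟨k, rfl⟩ := hx
        exact Submodule.subset_span ⟨k :: l, by simp, by simp⟩
    have := h1 ⁅e j, e i⁆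
    rw [ι_lie, sub_mul] at this
    simpa [mul_assoc] using this
  | trans h h' ih ih' =>
    rw [← h.length_eq] at ih'
    simpa using add_mem ih ih'

/-- The spanning half of the Poincaré–Birkhoff–Witt theorem: a subspace of `U(L)` which contains,
for each word in a spanning set of `L`, the monomial of some rearrangement, is everything. -/
theorem eq_top_of_words {e : σ → L} (he : Submodule.span ℂ (Set.range e) = ⊤)
    (S : Submodule ℂ (U L)) (hS : ∀ l : List σ, ∃ l', l.Perm l' ∧ word e l' ∈ S) : S = ⊤ := by
  have h1 : ∀ k, wordsLT e k ≤ S := fun k => by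
    induction k with
    | zero =>
      refine Submodule.span_le.2 ?_
      rintro _ ⟨l, hl, rfl⟩
      exact absurd hl (by simp)
    | succ k ih =>
      refine Submodule.span_le.2 ?_
      rintro _ ⟨l, hl, rfl⟩
      obtain ⟨l', hl', hm⟩ := hS l
      rcases Nat.lt_succ_iff_lt_or_eq.1 hl with hlt | heq
      · exact ih (Submodule.subset_span ⟨l, hlt, rfl⟩)
      · have := ih (heq ▸ word_sub_word_mem he hl')
        simpa using add_mem this hm
  rw [eq_top_iff]
  rintro u -
  let A : Subalgebra ℂ (U L) :=
    { carrier := {u | ∃ k, u ∈ wordsLT e k}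
      mul_mem' := by
        rintro a b ⟨k, ha⟩ ⟨m, hb⟩
        refine ⟨k + m, ?_⟩
        induction ha using Submodule.span_induction with
        | zero => simp
        | add x y _ _ hx hy => rw [add_mul]; exact add_mem hx hy
        | smul c x _ hx => rw [smul_mul_assoc]; exact Submodule.smul_mem _ _ hx
        | mem x hx =>
          obtain ⟨l, hl, rfl⟩ := hx
          induction hb using Submodule.span_induction with
          | zero => simp
          | add x y _ _ hx hy => rw [mul_add]; exact add_mem hx hy
          | smul c x _ hx => rw [mul_smul_comm]; exact Submodule.smul_mem _ _ hx
          | mem x hx =>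
            obtain ⟨l', hl', rfl⟩ := hx
            exact Submodule.subset_span ⟨l ++ l', by simp; omega, by simp⟩
      add_mem' := by
        rintro a b ⟨k, ha⟩ ⟨m, hb⟩
        have mono : ∀ {p q : ℕ}, p ≤ q → wordsLT e p ≤ wordsLT e q := fun hpq =>
          Submodule.span_mono fun u ⟨l, hl, hu⟩ => ⟨l, hl.trans_le hpq, hu⟩
        exact ⟨max k m, add_mem (mono (le_max_left _ _) ha) (mono (le_max_right _ _) hb)⟩
      algebraMap_mem' := fun c => ⟨1, by
        rw [Algebra.algebraMap_eq_smul_one]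
        exact Submodule.smul_mem _ _ (Submodule.subset_span ⟨[], by simp, rfl⟩)⟩ }
  obtain ⟨k, hk⟩ := U.mem_of_subalgebra A (fun x => by
    refine ⟨2, ?_⟩
    have hx : x ∈ Submodule.span ℂ (Set.range e) := he ▸ Submodule.mem_top
    induction hx using Submodule.span_induction with
    | zero => simp [ι]
    | add x y _ _ hx hy => rw [ι, map_add]; exact add_mem hx hy
    | smul c x _ hx => rw [ι, map_smul]; exact Submodule.smul_mem _ _ hx
    | mem x hx =>
      obtain ⟨k, rfl⟩ := hx
      exact Submodule.subset_span ⟨[k], by simp, by simp⟩) u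
  exact h1 k hk

end Monomials

/-! ### Independence of ordered monomials for matrix Lie algebras -/

section Independence

/-- A derivation lowers the order of vanishing along an ideal by at most one. -/
theorem derivation_mem_pow {S : Type*} [CommRing S] [Algebra ℂ S] (D : Derivation ℂ S S)
    (I : Ideal S) {k : ℕ} {f : S} (hf : f ∈ I ^ (k + 1)) : D f ∈ I ^ k := by
  induction k generalizing f with
  | zero => simp
  | succ k ih =>
    rw [pow_succ'] at hf
    induction hf using Submodule.mul_induction_on' with
    | mem_mul_mem a ha b hb =>
      rw [Derivation.leibniz, smul_eq_mul, smul_eq_mul]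
      refine add_mem ?_ (Ideal.mul_mem_right _ _ hb)
      rw [pow_succ']
      exact Ideal.mul_mem_mul ha (ih hb)
    | add a _ b _ ha hb => rw [map_add]; exact add_mem ha hb

theorem derivation_mem_pow_of_map {S : Type*} [CommRing S] [Algebra ℂ S] (D : Derivation ℂ S S)
    (I : Ideal S) (hD : ∀ f ∈ I, D f ∈ I) {k : ℕ} {f : S} (hf : f ∈ I ^ k) : D f ∈ I ^ k := by
  induction k generalizing f with
  | zero => simp
  | succ k ih =>
    rw [pow_succ'] at hf ⊢
    induction hf using Submodule.mul_induction_on' with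
    | mem_mul_mem a ha b hb =>
      rw [Derivation.leibniz, smul_eq_mul, smul_eq_mul, mul_comm b]
      exact add_mem (Ideal.mul_mem_mul ha (ih hb)) (Ideal.mul_mem_mul (hD a ha) hb)
    | add a _ b _ ha hb => rw [map_add]; exact add_mem ha hb

variable {n : ℕ}

open MvPolynomial

/-- The polynomial functions on `n × n` matrices. The coordinates are centred at the identity
matrix: `X (i, j)` is the function `g ↦ (g - 1) i j`. -/
abbrev MatPoly (n : ℕ) : Type := MvPolynomial (Fin n × Fin n) ℂ

/-- The constant vector field `∂_A` on the space of matrices. -/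
def constField (A : Matrix (Fin n) (Fin n) ℂ) : Derivation ℂ (MatPoly n) (MatPoly n) :=
  mkDerivation ℂ fun p => C (A p.1 p.2)

/-- The linear vector field `y ↦ y A` on the space of matrices. -/
def linField (A : Matrix (Fin n) (Fin n) ℂ) : Derivation ℂ (MatPoly n) (MatPoly n) :=
  mkDerivation ℂ fun p => ∑ k, X (p.1, k) * C (A k p.2)

@[simp] theorem constField_X (A : Matrix (Fin n) (Fin n) ℂ) (p : Fin n × Fin n) :
    constField A (X p) = C (A p.1 p.2) := mkDerivation_X _ _ _

@[simp] theorem linField_X (A : Matrix (Fin n) (Fin n) ℂ) (p : Fin n × Fin n) :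
    linField A (X p) = ∑ k, X (p.1, k) * C (A k p.2) := mkDerivation_X _ _ _

/-- The left invariant vector field `y ↦ (1 + y) A`; these give an action of `𝔤𝔩_n`. -/
def leftField : Matrix (Fin n) (Fin n) ℂ →ₗ⁅ℂ⁆ Module.End ℂ (MatPoly n) where
  toFun A := ((constField A + linField A : Derivation ℂ (MatPoly n) (MatPoly n)) :
    MatPoly n →ₗ[ℂ] MatPoly n)
  map_add' A B := by
    have : constField (A + B) + linField (A + B) =
        (constField A + linField A) + (constField B + linField B) := by
      ext p : 1
      simp [mul_add, Finset.sum_add_distrib]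
      abel
    rw [this]; rfl
  map_smul' c A := by
    have : constField (c • A) + linField (c • A) = c • (constField A + linField A) := by
      ext p : 1
      simp [smul_eq_C_mul, Finset.mul_sum, mul_left_comm]
    rw [this]; rfl
  map_lie' {A B} := by
    have : constField ⁅A, B⁆ + linField ⁅A, B⁆ =
        ⁅constField A + linField A, constField B + linField B⁆ := by
      ext p : 1
      simp only [Derivation.commutator_apply, Derivation.add_apply, constField_X, linField_X,
        LieRing.of_associative_ring_bracket, Matrix.sub_apply, Matrix.mul_apply, map_add, map_sub,
        map_sum, Derivation.leibniz, derivation_C, smul_eq_mul, map_mul, mul_zero,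
        zero_add, mul_add, Finset.sum_add_distrib, mul_sub, Finset.sum_sub_distrib, Finset.mul_sum]
      have h : ∀ A B : Matrix (Fin n) (Fin n) ℂ,
          (∑ x, ∑ i, (C (B x p.2) * (X (p.1, i) * C (A i x)) : MatPoly n)) =
            ∑ x, ∑ i, X (p.1, x) * (C (A x i) * C (B i p.2)) := fun A B => by
        rw [Finset.sum_comm]
        refine Finset.sum_congr rfl fun _ _ => Finset.sum_congr rfl fun _ _ => by ring
      rw [h A B, h B A]
      simp only [mul_comm (C (B _ p.2)) (C (A p.1 _)), mul_comm (C (A _ p.2)) (C (B p.1 _))]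
      abel
    rw [this]
    ext1 f
    rfl

theorem leftField_apply (A : Matrix (Fin n) (Fin n) ℂ) (f : MatPoly n) :
    leftField A f = constField A f + linField A f := rfl

/-- The ideal of the polynomial functions that vanish at the identity matrix. -/
def idIdeal (n : ℕ) : Ideal (MatPoly n) := RingHom.ker (constantCoeff (σ := Fin n × Fin n) (R := ℂ))

theorem linField_mem (A : Matrix (Fin n) (Fin n) ℂ) (f : MatPoly n) : linField A f ∈ idIdeal n := by
  induction f using MvPolynomial.induction_on with
  | C a => simp
  | add p q hp hq => rw [map_add]; exact add_mem hp hq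
  | mul_X p i hp =>
    rw [Derivation.leibniz, linField_X, smul_eq_mul, smul_eq_mul]
    refine add_mem (Ideal.mul_mem_left _ _ (sum_mem fun k _ => Ideal.mul_mem_right _ _ ?_))
      (Ideal.mul_mem_left _ _ hp)
    simp [idIdeal, RingHom.mem_ker]

variable {σ : Type*}

/-- On functions vanishing to high order at the identity, the left invariant vector fields agree
with the constant ones up to functions vanishing to one order more. -/
theorem leftField_word (e : σ → Matrix (Fin n) (Fin n) ℂ) (l : List σ) (m : ℕ) {f : MatPoly n}
    (hf : f ∈ idIdeal n ^ (m + l.length)) :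
    (l.map fun i => leftField (e i)).prod f ∈ idIdeal n ^ m ∧
      (l.map fun i => leftField (e i)).prod f -
        (l.map fun i => (constField (e i)).toLinearMap).prod f ∈
          idIdeal n ^ (m + 1) := by
  induction l generalizing m with
  | nil => simpa using hf
  | cons i l ih =>
    obtain ⟨h1, h2⟩ := ih (m + 1) (by rwa [List.length_cons, ← add_assoc, add_right_comm] at hf)
    simp only [List.map_cons, List.prod_cons, Module.End.mul_apply, leftField_apply]
    have h3 := derivation_mem_pow_of_map (linField (e i)) _ (fun f _ => linField_mem _ f) h1
    refine ⟨add_mem (derivation_mem_pow _ _ h1) (Ideal.pow_le_pow_right (Nat.le_succ m) h3), ?_⟩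
    have h4 := derivation_mem_pow (constField (e i)) _ h2
    rw [map_sub] at h4
    convert add_mem h4 h3 using 1
    simp only [Derivation.coeFn_coe]
    ring

theorem pderiv_word (l : List σ) (s : σ →₀ ℕ) (c : ℂ) :
    ∃ N : ℕ, (l.map fun i => (pderiv (R := ℂ) i).toLinearMap).prod
        (monomial s c) = monomial (s - (l.map fun i => Finsupp.single i 1).sum) (c * N) ∧
      (N ≠ 0 ↔ (l.map fun i => Finsupp.single i 1).sum ≤ s) := by
  classical
  induction l with
  | nil => exact ⟨1, by simp⟩
  | cons i l ih =>
    obtain ⟨N, h1, h2⟩ := ih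
    refine ⟨N * (s - (l.map fun i => Finsupp.single i 1).sum : σ →₀ ℕ) i, ?_, ?_⟩
    · rw [List.map_cons, List.prod_cons, Module.End.mul_apply, h1, Derivation.coeFn_coe,
        pderiv_monomial, List.map_cons, List.sum_cons, add_comm, tsub_add_eq_tsub_tsub]
      push_cast
      rw [mul_assoc]
    · rw [mul_ne_zero_iff, h2, List.map_cons, List.sum_cons]
      set t := (l.map fun i => Finsupp.single i 1).sum
      constructor
      · rintro ⟨h3, h4⟩ k
        have := h3 k
        rw [Finsupp.tsub_apply] at h4
        rw [Finsupp.add_apply, Finsupp.single_apply]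
        split_ifs with hk
        · subst hk; omega
        · omega
      · intro h
        refine ⟨le_trans (by simp) h, ?_⟩
        have := h i
        rw [Finsupp.add_apply, Finsupp.single_apply, if_pos rfl] at this
        rw [Finsupp.tsub_apply]
        omega

theorem sum_single_eq [DecidableEq σ] (l : List σ) :
    (l.map fun i => Finsupp.single i 1).sum = Multiset.toFinsupp (l : Multiset σ) := by
  induction l with
  | nil => simp
  | cons i l ih =>
    rw [List.map_cons, List.sum_cons, ih, ← Multiset.cons_coe, ← Multiset.singleton_add, map_add,
      Multiset.toFinsupp_singleton]

theorem exists_dual_of_linearIndependent [DecidableEq σ] {W : Type*} [AddCommGroup W] [Module ℂ W]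
    {e : σ → W} (he : LinearIndependent ℂ e) (i : σ) :
    ∃ φ : W →ₗ[ℂ] ℂ, ∀ k, φ (e k) = if k = i then 1 else 0 := by
  obtain ⟨φ, hφ⟩ := LinearMap.exists_extend (Finsupp.lapply i ∘ₗ he.repr)
  refine ⟨φ, fun k => ?_⟩
  have h1 := congrArg (fun f => f ⟨e k, Submodule.subset_span ⟨k, rfl⟩⟩) hφ
  simp only [LinearMap.comp_apply, Submodule.subtype_apply] at h1
  rw [h1, he.repr_eq_single k _ rfl]
  simp [Finsupp.single_apply]

/-- The independence half of the Poincaré–Birkhoff–Witt theorem, for a Lie algebra of matrices: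
monomials in linearly independent elements are linearly independent if no two of them are
rearrangements of each other. Such monomials act as left invariant differential operators; their
leading symbols at the identity are distinct monomials in independent directions. -/
theorem linearIndependent_word {L : Type*} [LieRing L] [LieAlgebra ℂ L]
    (j : L →ₗ⁅ℂ⁆ Matrix (Fin n) (Fin n) ℂ) (hj : Function.Injective j) {e : σ → L}
    (he : LinearIndependent ℂ e) {K : Type*} (l : K → List σ)
    (hl : Function.Injective fun k => (l k : Multiset σ)) :
    LinearIndependent ℂ fun k => word e (l k) := by
  classical
  -- linear forms `φ i` on the space of matrices, dual to the `e i`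
  have he' : LinearIndependent ℂ (fun i => j (e i)) :=
    LinearIndependent.map' he (j : L →ₗ[ℂ] Matrix (Fin n) (Fin n) ℂ) (LinearMap.ker_eq_bot.2 hj)
  have hφ := fun i => exists_dual_of_linearIndependent he' i
  choose φ hφ using hφ
  let lin : σ → MatPoly n := fun i => ∑ p : Fin n × Fin n, C (φ i (Matrix.single p.1 p.2 1)) * X p
  have hlin : ∀ i, lin i ∈ idIdeal n := fun i => sum_mem fun p _ => Ideal.mul_mem_left _ _ (by
    simp [idIdeal, RingHom.mem_ker])
  have hconst : ∀ (A : Matrix (Fin n) (Fin n) ℂ) i, constField A (lin i) = C (φ i A) := fun A i => by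
    conv_rhs => rw [Matrix.matrix_eq_sum_single A, ← Finset.sum_product']
    simp only [lin, map_sum, Derivation.leibniz, constField_X, derivation_C, mul_zero, add_zero,
      smul_eq_mul, Finset.univ_product_univ]
    refine Finset.sum_congr rfl fun p _ => ?_
    have : Matrix.single p.1 p.2 (A p.1 p.2) = A p.1 p.2 • Matrix.single p.1 p.2 (1 : ℂ) := by
      simp [Matrix.smul_single]
    rw [this, map_smul, smul_eq_mul, ← C_mul, mul_comm]
  let θ : MvPolynomial σ ℂ →ₐ[ℂ] MatPoly n := aeval lin
  have hθ : ∀ (i : σ) (p : MvPolynomial σ ℂ), constField (j (e i)) (θ p) = θ (pderiv i p) :=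
    fun i p => by
      induction p using MvPolynomial.induction_on with
      | C a => simp [θ]
      | add p q hp hq => simp only [map_add, hp, hq]
      | mul_X p k hp =>
        rw [map_mul, Derivation.leibniz, hp, Derivation.leibniz, pderiv_X, map_add]
        have : θ (X k) = lin k := by simp [θ]
        rw [this, hconst, hφ, smul_eq_mul, smul_eq_mul, smul_eq_mul, smul_eq_mul, map_mul, map_mul,
          this]
        congr 2
        by_cases h : i = k
        · subst h; simp
        · simp [h, Ne.symm h]
  have hθw : ∀ (l : List σ) (p : MvPolynomial σ ℂ),
      (l.map fun i => (constField (j (e i))).toLinearMap).prod (θ p) =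
        θ ((l.map fun i => (pderiv (R := ℂ) i).toLinearMap).prod p) :=
    fun l p => by
      induction l with
      | nil => simp
      | cons i l ih =>
        simp only [List.map_cons, List.prod_cons, Module.End.mul_apply, ih]
        exact hθ i _
  have hcc : ∀ p, constantCoeff (θ p) = constantCoeff p := fun p => by
    induction p using MvPolynomial.induction_on with
    | C a => simp [θ]
    | add p q hp hq => simp only [map_add, hp, hq]
    | mul_X p k hp =>
      have : constantCoeff (lin k) = 0 := hlin k
      simp [θ, this]
  have hmon : ∀ l : List σ,
      θ (monomial (l.map fun i => Finsupp.single i 1).sum 1) ∈ idIdeal n ^ l.length := fun l => by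
    induction l with
    | nil => simp
    | cons i l ih =>
      rw [List.map_cons, List.sum_cons, ← one_mul (1 : ℂ), ← monomial_mul, map_mul, List.length_cons,
        pow_succ']
      refine Ideal.mul_mem_mul ?_ ih
      have : θ (X i) = lin i := by simp [θ]
      rw [X] at this
      rw [this]
      exact hlin i
  let Φ : U L →ₐ[ℂ] Module.End ℂ (MatPoly n) :=
    UniversalEnvelopingAlgebra.lift ℂ (leftField.comp j)
  have hΦ : ∀ l : List σ, Φ (word e l) = (l.map fun i => leftField (j (e i))).prod := fun l => by
    induction l with
    | nil => simp
    | cons i l ih =>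
      rw [word_cons, map_mul, ih, List.map_cons, List.prod_cons, ι,
        UniversalEnvelopingAlgebra.lift_ι_apply]
      rfl
  rw [linearIndependent_iff']
  intro t g hg
  by_contra! hne
  obtain ⟨k₁, hk₁, hgk₁⟩ := hne
  -- a monomial of maximal degree among those with a non-zero coefficient
  obtain ⟨k₀, hk₀, hmax⟩ := Finset.exists_max_image (t.filter fun k => g k ≠ 0)
    (fun k => (l k).length) ⟨k₁, by simp [hk₁, hgk₁]⟩
  rw [Finset.mem_filter] at hk₀
  set f : MatPoly n := θ (monomial ((l k₀).map fun i => Finsupp.single i 1).sum 1) with hf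
  have h0 := congrArg (fun u => constantCoeff (Φ u f)) hg
  simp only [map_sum, map_smul, LinearMap.sum_apply, LinearMap.smul_apply, map_zero,
    LinearMap.zero_apply, hΦ] at h0
  rw [Finset.sum_eq_single k₀] at h0
  · have h1 := (leftField_word (fun i => j (e i)) (l k₀) 0 (f := f) (by simpa using hmon (l k₀))).2
    rw [zero_add, pow_one, idIdeal, RingHom.mem_ker, map_sub, sub_eq_zero] at h1
    obtain ⟨N, hN1, hN2⟩ := pderiv_word (l k₀) ((l k₀).map fun i => Finsupp.single i 1).sum 1
    rw [smul_eq_C_mul, map_mul, constantCoeff_C, h1, hf, hθw, hcc, hN1, tsub_self, one_mul,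
      constantCoeff_monomial, if_pos rfl] at h0
    rcases mul_eq_zero.1 h0 with h | h
    · exact hk₀.2 h
    · exact hN2.2 le_rfl (by exact_mod_cast h)
  · intro k hk hkk
    by_cases hgk : g k = 0
    · simp [hgk]
    rw [smul_eq_C_mul, map_mul]
    refine mul_eq_zero_of_right _ ?_
    rcases (hmax k (by simp [hk, hgk])).lt_or_eq with hlt | heq
    · obtain ⟨d, hd⟩ := Nat.exists_eq_add_of_lt hlt
      have h1 := (leftField_word (fun i => j (e i)) (l k) (d + 1) (f := f) (by
        have := hmon (l k₀)
        rwa [hd, add_assoc, add_comm] at this)).1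
      have h2 := Ideal.pow_le_self (Nat.succ_ne_zero d) h1
      exact h2
    · have h1 := (leftField_word (fun i => j (e i)) (l k) 0 (f := f) (by
        simpa [heq] using hmon (l k₀))).2
      rw [zero_add, pow_one, idIdeal, RingHom.mem_ker, map_sub, sub_eq_zero] at h1
      obtain ⟨N, hN1, hN2⟩ := pderiv_word (l k) ((l k₀).map fun i => Finsupp.single i 1).sum 1
      have hN : N = 0 := by
        by_contra hN
        have h3 := hN2.1 hN
        rw [sum_single_eq, sum_single_eq] at h3
        have h4 : (l k : Multiset σ) ≤ (l k₀ : Multiset σ) := Multiset.le_iff_count.2 fun a => h3 a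
        exact hkk (hl (Multiset.eq_of_le_of_card_le h4 (by simp [heq])))
      rw [h1, hf, hθw, hcc, hN1, hN]
      simp
  · intro h; exact absurd hk₀.1 h

end Independence

/-! ### The enveloping algebra of an abelian Lie algebra -/

section Abelian

variable {L : Type*} [LieRing L] [LieAlgebra ℂ L] [IsLieAbelian L]

/-- The enveloping algebra of an abelian Lie algebra embeds into a polynomial ring. -/
theorem U.exists_injective_mvPolynomial :
    ∃ f : U L →ₐ[ℂ] MvPolynomial (Module.Basis.ofVectorSpaceIndex ℂ L) ℂ,
      Function.Injective f := by
  let b := Module.Basis.ofVectorSpace ℂ L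
  let f : U L →ₐ[ℂ] MvPolynomial (Module.Basis.ofVectorSpaceIndex ℂ L) ℂ :=
    UniversalEnvelopingAlgebra.lift ℂ
      { b.constr ℂ MvPolynomial.X with
        map_lie' := fun {x y} => by
          rw [LieRing.of_associative_ring_bracket, mul_comm, sub_self, trivial_lie_zero]
          exact map_zero (b.constr ℂ _) }
  refine ⟨f, Function.LeftInverse.injective (g := MvPolynomial.aeval fun i => ι (b i)) ?_⟩
  intro u
  have : ((MvPolynomial.aeval fun i => ι (b i)).comp f : U L →ₐ[ℂ] U L) = AlgHom.id ℂ _ := by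
    apply UniversalEnvelopingAlgebra.hom_ext
    ext x
    have h : ((MvPolynomial.aeval fun i => ι (b i)) : _ →ₐ[ℂ] U L).toLinearMap ∘ₗ
        b.constr ℂ MvPolynomial.X = (UniversalEnvelopingAlgebra.ι ℂ : L →ₗ⁅ℂ⁆ U L) :=
      b.ext fun i => by simp [ι]
    have h2 := congrArg (fun g => g x) h
    simp only [LinearMap.comp_apply] at h2
    simp only [LieHom.coe_comp, Function.comp_apply, AlgHom.coe_toLieHom, AlgHom.comp_apply, f,
      UniversalEnvelopingAlgebra.lift_ι_apply, AlgHom.id_apply]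
    exact h2
  exact congrArg (fun g : U L →ₐ[ℂ] U L => g u) this

instance U.instIsDomain : IsDomain (U L) := by
  obtain ⟨f, hf⟩ := U.exists_injective_mvPolynomial (L := L)
  exact hf.isDomain f.toRingHom

end Abelian

/-! ### Root spaces -/

section Roots

open LieAlgebra LieModule

variable {𝔤 : Type*} [LieRing 𝔤] [LieAlgebra ℂ 𝔤] [FiniteDimensional ℂ 𝔤]
variable {𝔱 : LieSubalgebra ℂ 𝔤} [𝔱.IsCartanSubalgebra] [IsLieAbelian 𝔱]

/-- In a reductive Lie algebra the negative of a root is a root: otherwise its root space would lie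
in the kernel of the Killing form, hence in the centre. -/
theorem rootSpace_ne_bot_of_neg [HasCentralRadical ℂ 𝔤] {β : Module.Dual ℂ 𝔱} (hβ : β ≠ 0)
    (h : rootSpace 𝔱 (-β : Module.Dual ℂ 𝔱) ≠ ⊥) : rootSpace 𝔱 β ≠ ⊥ := by
  intro hbot
  apply h
  rw [eq_bot_iff]
  intro x hx
  have h1 : x ∈ LinearMap.ker (killingForm ℂ 𝔤) := by
    refine mem_ker_killingForm_of_mem_rootSpace_of_forall_rootSpace_neg ℂ 𝔤 𝔱 hx fun y hy => ?_
    have : -⇑(-β) = ⇑β := by ext; simp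
    rw [this, hbot] at hy
    rw [(LieSubmodule.mem_bot _).1 hy, map_zero]
  have h2 : x ∈ LieIdeal.killingCompl ℂ 𝔤 ⊤ := by
    rw [LieIdeal.mem_killingCompl]
    intro y _
    rw [LieModule.traceForm_comm]
    exact congrArg (fun f => f y) (LinearMap.mem_ker.1 h1)
  have h3 := killingCompl_top_le_radical ℂ 𝔤 h2
  rw [HasCentralRadical.radical_eq_center] at h3
  have h4 : x ∈ rootSpace 𝔱 (0 : 𝔱 → ℂ) :=
    weightSpace_le_genWeightSpace 𝔤 _ ((mem_weightSpace _ _).2 fun y => by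
      simpa using (LieModule.mem_maxTrivSubmodule ℂ 𝔤 𝔤 x).1 h3 (y : 𝔤))
  have h5 : (⇑(-β) : 𝔱 → ℂ) ≠ 0 := fun h0 => hβ (by
    ext y
    simpa using congrArg (fun f => f y) h0)
  have := (disjoint_genWeightSpace ℂ 𝔱 𝔤 h5).le_bot ⟨hx, h4⟩
  exact this

theorem mem_cartan_of_lie_eq_zero {x : 𝔤} (hx : ∀ y : 𝔱, ⁅(y : 𝔤), x⁆ = 0) : x ∈ 𝔱 := by
  have h4 : x ∈ rootSpace 𝔱 (0 : 𝔱 → ℂ) :=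
    weightSpace_le_genWeightSpace 𝔤 _ ((mem_weightSpace _ _).2 fun y => by
      simpa using hx y)
  rw [rootSpace_zero_eq] at h4
  exact h4

/-- A root `α` with an `𝔰𝔩₂`-triple inside `𝔤_α + 𝔱 + 𝔤_{-α}`: no multiple `k α` with `k ≥ 2` is a
root, and `𝔤_α` is a line. For a highest weight vector in `⨁ 𝔤_{kα}` of weight `2k` the `𝔰𝔩₂`-string
reaches weight `-2k`, whereas it stops at `𝔤_{-α} ∩ [f, 𝔱] = ℂ f`. -/
theorem rootSpace_smul_eq_bot_and_le_span {α : Module.Dual ℂ 𝔱} {h : 𝔱} {e f : 𝔤} (hα : α h = 2)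
    (hef : ⁅e, f⁆ = (h : 𝔤)) (he : ∀ x : 𝔱, ⁅(x : 𝔤), e⁆ = α x • e)
    (hf : ∀ x : 𝔱, ⁅(x : 𝔤), f⁆ = -(α x • f)) :
    (∀ k : ℕ, 2 ≤ k → rootSpace 𝔱 (k • α : Module.Dual ℂ 𝔱) = ⊥) ∧
      ∀ x ∈ rootSpace 𝔱 α, x ∈ Submodule.span ℂ {e} := by
  have hα0 : α ≠ 0 := fun h0 => by simp [h0] at hα
  have t : IsSl2Triple (h : 𝔤) e f :=
    { h_ne_zero := fun h0 => by
        have : h = 0 := Subtype.ext h0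
        simp [this] at hα
      lie_e_f := hef
      lie_h_e_nsmul := by rw [he, hα, two_smul, two_nsmul]
      lie_h_f_nsmul := by rw [hf, hα, two_smul, two_nsmul] }
  have hecell : e ∈ rootSpace 𝔱 α :=
    weightSpace_le_genWeightSpace 𝔤 _ ((mem_weightSpace _ _).2 he)
  have hfcell : f ∈ rootSpace 𝔱 (-α : Module.Dual ℂ 𝔱) :=
    weightSpace_le_genWeightSpace 𝔤 _ ((mem_weightSpace _ _).2 fun x => by simpa using hf x)
  have hft : ∀ z ∈ 𝔱, ⁅f, ⁅f, z⁆⁆ = 0 := fun z hz => by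
    have h1 : ⁅f, z⁆ = α ⟨z, hz⟩ • f := by
      rw [← lie_skew, ← neg_neg (α _ • f)]
      exact congrArg Neg.neg (hf ⟨z, hz⟩)
    rw [h1, lie_smul, lie_self, smul_zero]
  have h1 : ∀ k : ℕ, 2 ≤ k → rootSpace 𝔱 (k • α : Module.Dual ℂ 𝔱) = ⊥ := by
    by_contra! hne
    obtain ⟨k₀, hk₀, hbot₀⟩ := hne
    have hfin : {k : ℕ | rootSpace 𝔱 (k • α : Module.Dual ℂ 𝔱) ≠ ⊥}.Finite := by
      refine Set.Finite.preimage (f := fun k : ℕ => (⇑(k • α : Module.Dual ℂ 𝔱) : 𝔱 → ℂ)) ?_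
        (finite_genWeightSpace_ne_bot ℂ 𝔱 𝔤)
      intro k _ m _ hkm
      have := congrArg (fun g => g h) hkm
      simpa [hα] using this
    obtain ⟨k, hk, hmax⟩ := Set.exists_max_image _ id hfin ⟨k₀, hbot₀⟩
    have hk2 : 2 ≤ k := hk₀.trans (hmax k₀ hbot₀)
    obtain ⟨y, hy0, hy⟩ := exists_forall_lie_eq_smul ℂ 𝔱 𝔤 ⟨_, hk⟩
    replace hy : ∀ x : 𝔱, ⁅(x : 𝔤), y⁆ = (k * α x) • y := fun x => by simpa using hy x
    have hycell : y ∈ rootSpace 𝔱 (k • α : Module.Dual ℂ 𝔱) :=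
      weightSpace_le_genWeightSpace 𝔤 _ ((mem_weightSpace _ _).2 fun x => by simpa using hy x)
    have P : t.HasPrimitiveVectorWith y ((2 * k : ℕ) : ℂ) :=
      { ne_zero := hy0
        lie_h := by rw [hy, hα]; push_cast; rw [mul_comm]
        lie_e := by
          have h2 := lie_mem_genWeightSpace_of_mem_genWeightSpace hecell hycell
          have h3 : ¬ rootSpace 𝔱 ((k + 1) • α : Module.Dual ℂ 𝔱) ≠ ⊥ := fun h3 => by
            have := hmax (k + 1) h3
            simp at this
          rw [not_not] at h3
          have h4 : (⇑α + ⇑(k • α : Module.Dual ℂ 𝔱) : 𝔱 → ℂ) =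
              ⇑((k + 1) • α : Module.Dual ℂ 𝔱) := by
            ext x; simp; ring
          rw [h4] at h2
          replace h2 : ⁅e, y⁆ ∈ rootSpace 𝔱 ((k + 1) • α : Module.Dual ℂ 𝔱) := h2
          rw [h3] at h2
          exact (LieSubmodule.mem_bot _).1 h2 }
    have h2 : ∀ (m : ℕ) (x : 𝔱), ⁅(x : 𝔤), (toEnd ℂ 𝔤 𝔤 f ^ m) y⁆ =
        ((k - m : ℂ) * α x) • (toEnd ℂ 𝔤 𝔤 f ^ m) y := fun m => by
      induction m with
      | zero => simpa using hy
      | succ m ih =>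
        intro x
        rw [pow_succ', Module.End.mul_apply, toEnd_apply_apply, leibniz_lie, hf, ih, lie_smul,
          neg_lie, smul_lie, ← neg_smul, ← add_smul]
        congr 1
        push_cast
        ring
    have h3 := P.pow_toEnd_f_ne_zero_of_eq_nat rfl (i := k + 2) (by omega)
    apply h3
    rw [add_comm, pow_add, Module.End.mul_apply, pow_two, Module.End.mul_apply]
    exact hft _ (mem_cartan_of_lie_eq_zero fun x => by rw [h2]; simp)
  refine ⟨h1, ?_⟩
  have hcell : ∀ x ∈ rootSpace 𝔱 α, ⁅f, x⁆ ∈ 𝔱 := fun x hx => by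
    have h2 := lie_mem_genWeightSpace_of_mem_genWeightSpace hfcell hx
    have h4 : (⇑(-α : Module.Dual ℂ 𝔱) + ⇑α : 𝔱 → ℂ) = 0 := by ext x; simp
    rw [h4] at h2
    have h5 : ⁅f, x⁆ ∈ rootSpace 𝔱 (0 : 𝔱 → ℂ) := h2
    rw [rootSpace_zero_eq] at h5
    exact h5
  -- the part of `𝔤_α` annihilated by `(ad f)²`
  let K : LieSubmodule ℂ 𝔱 𝔤 :=
    { (rootSpace 𝔱 α).toSubmodule ⊓
        LinearMap.ker ((toEnd ℂ 𝔤 𝔤 f) ∘ₗ (toEnd ℂ 𝔤 𝔤 f)) with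
      lie_mem := by
        rintro x y ⟨hy, hy'⟩
        refine ⟨(rootSpace 𝔱 α).lie_mem hy, ?_⟩
        change ⁅f, ⁅f, y⁆⁆ = 0 at hy'
        change ⁅f, ⁅f, ⁅(x : 𝔤), y⁆⁆⁆ = 0
        have h6 : ⁅(x : 𝔤), ⁅f, y⁆⁆ = 0 := by
          have := trivial_lie_zero 𝔱 𝔱 x ⟨_, hcell y hy⟩
          simpa using congrArg Subtype.val this
        rw [leibniz_lie f (x : 𝔤) y, h6, add_zero, ← lie_skew f (x : 𝔤), hf, neg_neg, smul_lie,
          lie_smul, hy', smul_zero] }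
  have hK : K = ⊥ := by
    by_contra hK
    have : Nontrivial K := (LieSubmodule.nontrivial_iff_ne_bot ℂ 𝔱 𝔤).2 hK
    obtain ⟨χ, hχ⟩ := exists_nontrivial_weightSpace_of_isNilpotent ℂ 𝔱 K
    obtain ⟨⟨y, hy⟩, hy0⟩ := exists_ne (0 : weightSpace K χ)
    have hyK : (y : 𝔤) ∈ K := y.2
    have hy0' : (y : 𝔤) ≠ 0 := fun h0 => hy0 (Subtype.ext (Subtype.ext h0))
    have hyw : ∀ x : 𝔱, ⁅(x : 𝔤), (y : 𝔤)⁆ = χ x • (y : 𝔤) := fun x =>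
      congrArg Subtype.val ((mem_weightSpace _ _).1 hy x)
    have hχα : (χ : 𝔱 → ℂ) = ⇑α := by
      by_contra hne
      refine hy0' ((disjoint_genWeightSpace ℂ 𝔱 𝔤 hne).le_bot ⟨?_, hyK.1⟩)
      exact weightSpace_le_genWeightSpace 𝔤 _ ((mem_weightSpace _ _).2 hyw)
    have P : t.HasPrimitiveVectorWith (y : 𝔤) ((2 : ℕ) : ℂ) :=
      { ne_zero := hy0'
        lie_h := by rw [hyw, hχα, hα]; push_cast; rfl
        lie_e := by
          have h2 := lie_mem_genWeightSpace_of_mem_genWeightSpace hecell hyK.1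
          have h4 : (⇑α + ⇑α : 𝔱 → ℂ) = ⇑((2 : ℕ) • α : Module.Dual ℂ 𝔱) := by
            ext x; simp; ring
          rw [h4] at h2
          replace h2 : ⁅e, (y : 𝔤)⁆ ∈ rootSpace 𝔱 (2 • α : Module.Dual ℂ 𝔱) := h2
          rw [h1 2 le_rfl] at h2
          exact (LieSubmodule.mem_bot _).1 h2 }
    refine P.pow_toEnd_f_ne_zero_of_eq_nat rfl (i := 2) le_rfl ?_
    rw [pow_two]
    exact hyK.2
  intro x hx
  set z : 𝔱 := ⟨⁅f, x⁆, hcell x hx⟩ with hz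
  have h2 : x + (α z / 2) • e ∈ K := by
    refine ⟨add_mem hx (Submodule.smul_mem _ _ hecell), ?_⟩
    change ⁅f, ⁅f, x + (α z / 2) • e⁆⁆ = 0
    have h3 : ⁅f, x⁆ = (z : 𝔤) := rfl
    rw [lie_add, lie_add, h3, ← lie_skew, hf, lie_smul, ← lie_skew f e, hef, smul_neg, lie_neg,
      lie_smul, ← lie_skew f (h : 𝔤), hf, hα]
    simp only [neg_neg, smul_smul]
    rw [div_mul_cancel₀ _ two_ne_zero]
    abel
  rw [hK] at h2
  rw [Submodule.mem_span_singleton]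
  exact ⟨-(α z / 2), by rw [neg_smul, ← eq_neg_iff_add_eq_zero.2 ((LieSubmodule.mem_bot _).1 h2)]⟩

namespace SimpleRoots

variable {r : ℕ} (D : SimpleRoots 𝔱 r)

theorem coeff_ext {c d : Fin r → ℂ} (h : ∑ j, c j • D.α j = ∑ j, d j • D.α j) (j : Fin r) :
    c j = d j := by
  have := Fintype.linearIndependent_iff.1 D.linearIndependent (fun j => c j - d j)
    (by simp [sub_smul, h]) j
  exact sub_eq_zero.1 this

theorem sum_nsmul_eq (c : Fin r → ℕ) :
    ∑ j, c j • D.α j = ∑ j, (c j : ℂ) • D.α j := by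
  simp [Nat.cast_smul_eq_nsmul]

/-- The weights which have a positive integral coefficient at some simple root other than `α_i`.
This class is stable under `s_i` and under adding multiples of `α_i`; a root in it is positive. -/
def IsOff (i : Fin r) (β : Module.Dual ℂ 𝔱) : Prop :=
  ∃ c : Fin r → ℂ, β = ∑ j, c j • D.α j ∧ ∃ j ≠ i, ∃ m : ℕ, 0 < m ∧ c j = m

variable {D} in
theorem IsOff.shift {i : Fin r} {β : Module.Dual ℂ 𝔱} (h : D.IsOff i β) (x : ℂ) :
    D.IsOff i (β + x • D.α i) := by
  obtain ⟨c, rfl, j, hj, m, hm, hc⟩ := h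
  refine ⟨c + Pi.single i x, ?_, j, hj, m, hm, by simp [hj, hc]⟩
  simp [add_smul, Finset.sum_add_distrib, Pi.single_apply, ite_smul]

variable {D} in
theorem IsOff.ne_zero {i : Fin r} {β : Module.Dual ℂ 𝔱} (h : D.IsOff i β) : β ≠ 0 := by
  obtain ⟨c, rfl, j, hj, m, hm, hc⟩ := h
  intro h0
  have := D.coeff_ext (c := c) (d := 0) (by simpa using h0) j
  rw [hc] at this
  simp only [Pi.zero_apply, Nat.cast_eq_zero] at this
  omega

variable {D} in
theorem IsOff.isPositive {i : Fin r} {β : Module.Dual ℂ 𝔱} (h : D.IsOff i β)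
    (hβ : rootSpace 𝔱 β ≠ ⊥) : D.IsPositive β := by
  refine ⟨⟨h.ne_zero, hβ⟩, ?_⟩
  obtain ⟨d, hd | hd⟩ := D.root_eq β ⟨h.ne_zero, hβ⟩
  · exact ⟨d, hd⟩
  · obtain ⟨c, hc, j, hj, m, hm, hcj⟩ := h
    rw [hc, sum_nsmul_eq, ← Finset.sum_neg_distrib] at hd
    simp only [← neg_smul] at hd
    have := D.coeff_ext hd j
    rw [hcj, ← sub_eq_zero, sub_neg_eq_add] at this
    norm_cast at this
    omega

theorem isPositive_or {β : Module.Dual ℂ 𝔱} (i : Fin r) (h : D.IsPositive β) :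
    D.IsOff i β ∨ ∃ k : ℕ, 1 ≤ k ∧ β = k • D.α i := by
  obtain ⟨⟨hβ0, hβ⟩, c, hc⟩ := h
  by_cases hj : ∃ j ≠ i, 0 < c j
  · obtain ⟨j, hj, hcj⟩ := hj
    exact Or.inl ⟨fun j => c j, by rw [hc, sum_nsmul_eq], j, hj, c j, hcj, rfl⟩
  · push Not at hj
    have h1 : β = c i • D.α i := by
      rw [hc, Finset.sum_eq_single i]
      · intro j _ hji
        simp [Nat.le_zero.1 (hj j hji)]
      · simp
    refine Or.inr ⟨c i, ?_, h1⟩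
    by_contra h0
    exact hβ0 (by rw [h1, Nat.lt_one_iff.1 (not_le.1 h0), zero_smul])

/-- The sum of the root spaces of the positive roots other than `α_i`. -/
def nPlusOff (i : Fin r) : Submodule ℂ 𝔤 :=
  ⨆ (β : Module.Dual ℂ 𝔱) (_ : D.IsOff i β), (rootSpace 𝔱 β).toSubmodule

/-- The sum of the root spaces of the negative roots other than `-α_i`. -/
def nMinusOff (i : Fin r) : Submodule ℂ 𝔤 :=
  ⨆ (β : Module.Dual ℂ 𝔱) (_ : D.IsOff i β), (rootSpace 𝔱 (-β : Module.Dual ℂ 𝔱)).toSubmodule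

theorem nPlusOff_le (i : Fin r) : D.nPlusOff i ≤ D.nPlus.toSubmodule := by
  refine iSup₂_le fun β hβ => ?_
  by_cases h : rootSpace 𝔱 β = ⊥
  · rw [h]; simp
  · exact (LieSubmodule.toSubmodule_le_toSubmodule _ _).2
      (le_iSup₂_of_le (f := fun β (_ : D.IsPositive β) => rootSpace 𝔱 β) β (hβ.isPositive h) le_rfl)

theorem nMinusOff_le [HasCentralRadical ℂ 𝔤] (i : Fin r) :
    D.nMinusOff i ≤ D.nMinus.toSubmodule := by
  refine iSup₂_le fun β hβ => ?_
  by_cases h : rootSpace 𝔱 (-β : Module.Dual ℂ 𝔱) = ⊥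
  · rw [h]; simp
  · exact (LieSubmodule.toSubmodule_le_toSubmodule _ _).2
      (le_iSup₂_of_le
        (f := fun β (_ : D.IsPositive β) => rootSpace 𝔱 (-β : Module.Dual ℂ 𝔱)) β
        (hβ.isPositive (rootSpace_ne_bot_of_neg hβ.ne_zero h)) le_rfl)

theorem nPlusOff_map_le (i : Fin r) (f : 𝔤 →ₗ[ℂ] 𝔤)
    (hf : ∀ β, D.IsOff i β → ∀ x ∈ rootSpace 𝔱 β, f x ∈ D.nPlusOff i) {x : 𝔤}
    (hx : x ∈ D.nPlusOff i) : f x ∈ D.nPlusOff i := by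
  have : D.nPlusOff i ≤ (D.nPlusOff i).comap f := iSup₂_le fun β hβ x hx => hf β hβ x hx
  exact this hx

theorem nMinusOff_map_le (i : Fin r) (f : 𝔤 →ₗ[ℂ] 𝔤)
    (hf : ∀ β, D.IsOff i β → ∀ x ∈ rootSpace 𝔱 (-β : Module.Dual ℂ 𝔱), f x ∈ D.nMinusOff i)
    {x : 𝔤} (hx : x ∈ D.nMinusOff i) : f x ∈ D.nMinusOff i := by
  have : D.nMinusOff i ≤ (D.nMinusOff i).comap f := iSup₂_le fun β hβ x hx => hf β hβ x hx
  exact this hx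

theorem mem_nPlusOff {i : Fin r} {β : Module.Dual ℂ 𝔱} (hβ : D.IsOff i β) {x : 𝔤}
    (hx : x ∈ rootSpace 𝔱 β) : x ∈ D.nPlusOff i :=
  (le_iSup₂_of_le (f := fun β (_ : D.IsOff i β) => (rootSpace 𝔱 β).toSubmodule) β hβ le_rfl) hx

theorem mem_nMinusOff {i : Fin r} {β : Module.Dual ℂ 𝔱} (hβ : D.IsOff i β) {x : 𝔤}
    (hx : x ∈ rootSpace 𝔱 (-β : Module.Dual ℂ 𝔱)) : x ∈ D.nMinusOff i :=
  (le_iSup₂_of_le (f := fun β (_ : D.IsOff i β) =>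
    (rootSpace 𝔱 (-β : Module.Dual ℂ 𝔱)).toSubmodule) β hβ le_rfl) hx

theorem E_mem (i : Fin r) : D.E i ∈ rootSpace 𝔱 (D.α i) :=
  weightSpace_le_genWeightSpace 𝔤 _ ((mem_weightSpace _ _).2 (D.lie_E i))

theorem F_mem (i : Fin r) : D.F i ∈ rootSpace 𝔱 (-D.α i : Module.Dual ℂ 𝔱) :=
  weightSpace_le_genWeightSpace 𝔤 _ ((mem_weightSpace _ _).2 fun h => by
    simpa using D.lie_F i h)

theorem lie_mem_rootSpace {β γ δ : Module.Dual ℂ 𝔱} (h : β + γ = δ) {x y : 𝔤}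
    (hx : x ∈ rootSpace 𝔱 β) (hy : y ∈ rootSpace 𝔱 γ) : ⁅x, y⁆ ∈ rootSpace 𝔱 δ := by
  subst h
  exact lie_mem_genWeightSpace_of_mem_genWeightSpace hx hy

theorem lie_F_mem_nPlusOff (i : Fin r) {x : 𝔤} (hx : x ∈ D.nPlusOff i) :
    ⁅D.F i, x⁆ ∈ D.nPlusOff i :=
  D.nPlusOff_map_le i (toEnd ℂ 𝔤 𝔤 (D.F i)) (fun β hβ x hx =>
    D.mem_nPlusOff (hβ.shift (-1)) (lie_mem_rootSpace (by simp; abel) (D.F_mem i) hx)) hx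

theorem lie_E_mem_nMinusOff (i : Fin r) {x : 𝔤} (hx : x ∈ D.nMinusOff i) :
    ⁅D.E i, x⁆ ∈ D.nMinusOff i :=
  D.nMinusOff_map_le i (toEnd ℂ 𝔤 𝔤 (D.E i)) (fun β hβ x hx =>
    D.mem_nMinusOff (hβ.shift (-1)) (lie_mem_rootSpace (by simp) (D.E_mem i) hx)) hx

theorem lie_F_mem_nMinusOff (i : Fin r) {x : 𝔤} (hx : x ∈ D.nMinusOff i) :
    ⁅D.F i, x⁆ ∈ D.nMinusOff i :=
  D.nMinusOff_map_le i (toEnd ℂ 𝔤 𝔤 (D.F i)) (fun β hβ x hx =>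
    D.mem_nMinusOff (hβ.shift 1) (lie_mem_rootSpace (by simp) (D.F_mem i) hx)) hx

theorem s_s (i : Fin r) (h : 𝔱) : D.s i (D.s i h) = h := by
  simp only [s, LinearMap.sub_apply, LinearMap.id_apply, LinearMap.smulRight_apply, map_sub,
    map_smul, D.α_H]
  module

/-- A Lie algebra endomorphism inducing `s_i` on `𝔱` maps the root space of `β` to that of
`s_i β`. -/
theorem map_mem_rootSpace (i : Fin r) (φ : 𝔤 →ₗ⁅ℂ⁆ 𝔤) (hφ : ∀ h : 𝔱, φ h = (D.s i h : 𝔤))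
    {β : Module.Dual ℂ 𝔱} {x : 𝔤} (hx : x ∈ rootSpace 𝔱 β) :
    φ x ∈ rootSpace 𝔱 (β + (-β (D.H i)) • D.α i : Module.Dual ℂ 𝔱) := by
  rw [mem_genWeightSpace] at hx ⊢
  intro h
  obtain ⟨k, hk⟩ := hx (D.s i h)
  refine ⟨k, ?_⟩
  have h1 : β (D.s i h) = (β + (-β (D.H i)) • D.α i) h := by
    simp [s]; ring
  have h2 : ∀ (m : ℕ) (y : 𝔤),
      ((toEnd ℂ 𝔱 𝔤 h - (β + (-β (D.H i)) • D.α i) h • 1) ^ m) (φ y) =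
        φ (((toEnd ℂ 𝔱 𝔤 (D.s i h) - β (D.s i h) • 1) ^ m) y) := fun m => by
    induction m with
    | zero => simp
    | succ m ih =>
      intro y
      rw [pow_succ, Module.End.mul_apply, pow_succ, Module.End.mul_apply, ← ih]
      congr 1
      have h3 : ⁅(h : 𝔤), φ y⁆ = φ ⁅(D.s i h : 𝔤), y⁆ := by
        rw [LieHom.map_lie, hφ, s_s]
      simp only [LinearMap.sub_apply, toEnd_apply_apply, LinearMap.smul_apply, Module.End.one_apply,
        map_sub, map_smul, h1]
      congr 1
  rw [h2, hk, map_zero]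

/-- The roots occurring in `nPlusOff` are permuted by `s_i`, so its representatives preserve it. -/
theorem map_mem_nPlusOff (i : Fin r) (φ : 𝔤 →ₗ⁅ℂ⁆ 𝔤) (hφ : ∀ h : 𝔱, φ h = (D.s i h : 𝔤))
    {x : 𝔤} (hx : x ∈ D.nPlusOff i) : φ x ∈ D.nPlusOff i :=
  D.nPlusOff_map_le i φ (fun _ hβ _ hx =>
    D.mem_nPlusOff (hβ.shift _) (D.map_mem_rootSpace i φ hφ hx)) hx

theorem map_mem_nMinusOff (i : Fin r) (φ : 𝔤 →ₗ⁅ℂ⁆ 𝔤) (hφ : ∀ h : 𝔱, φ h = (D.s i h : 𝔤))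
    {x : 𝔤} (hx : x ∈ D.nMinusOff i) : φ x ∈ D.nMinusOff i :=
  D.nMinusOff_map_le i φ (fun β hβ x hx => by
    refine D.mem_nMinusOff (hβ.shift (-β (D.H i))) ?_
    have h1 := D.map_mem_rootSpace i φ hφ hx
    have h2 : -β + (-(-β) (D.H i)) • D.α i = -(β + (-β (D.H i)) • D.α i) := by
      ext y; simp; ring
    rw [h2] at h1
    exact h1) hx

/-- No `k α_i` with `k ≥ 2` is a root, and the root space of `α_i` is the line of `E_i`. -/
theorem rootSpace_simple (i : Fin r) :
    (∀ k : ℕ, 2 ≤ k → rootSpace 𝔱 (k • D.α i : Module.Dual ℂ 𝔱) = ⊥) ∧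
      ∀ x ∈ rootSpace 𝔱 (D.α i), x ∈ Submodule.span ℂ {D.E i} :=
  rootSpace_smul_eq_bot_and_le_span (D.α_H i) (D.lie_E_F i) (D.lie_E i) (D.lie_F i)

theorem rootSpace_neg_simple (i : Fin r) :
    (∀ k : ℕ, 2 ≤ k → rootSpace 𝔱 (k • (-D.α i) : Module.Dual ℂ 𝔱) = ⊥) ∧
      ∀ x ∈ rootSpace 𝔱 (-D.α i : Module.Dual ℂ 𝔱), x ∈ Submodule.span ℂ {D.F i} :=
  rootSpace_smul_eq_bot_and_le_span (h := -D.H i) (e := D.F i) (f := D.E i)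
    (by simp [D.α_H]) (by rw [← lie_skew, D.lie_E_F]; rfl)
    (fun x => by simpa using D.lie_F i x) (fun x => by simpa using D.lie_E i x)

theorem nPlus_le (i : Fin r) :
    D.nPlus.toSubmodule ≤ D.nPlusOff i ⊔ Submodule.span ℂ {D.E i} := by
  rw [nPlus, LieSubmodule.iSup_toSubmodule]
  refine iSup_le fun β => ?_
  rw [LieSubmodule.iSup_toSubmodule]
  refine iSup_le fun hβ => ?_
  rcases D.isPositive_or i hβ with h | ⟨k, hk, rfl⟩
  · exact fun x hx => Submodule.mem_sup_left (D.mem_nPlusOff h hx)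
  · rcases hk.eq_or_lt with rfl | hk
    · rw [one_smul]
      exact fun x hx => Submodule.mem_sup_right ((D.rootSpace_simple i).2 x hx)
    · rw [(D.rootSpace_simple i).1 k hk]
      simp

theorem nMinus_le (i : Fin r) :
    D.nMinus.toSubmodule ≤ D.nMinusOff i ⊔ Submodule.span ℂ {D.F i} := by
  rw [nMinus, LieSubmodule.iSup_toSubmodule]
  refine iSup_le fun β => ?_
  rw [LieSubmodule.iSup_toSubmodule]
  refine iSup_le fun hβ => ?_
  rcases D.isPositive_or i hβ with h | ⟨k, hk, rfl⟩
  · exact fun x hx => Submodule.mem_sup_left (D.mem_nMinusOff h hx)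
  · have h1 : -⇑(k • D.α i) = ⇑(k • (-D.α i) : Module.Dual ℂ 𝔱) := by ext x; simp
    rcases hk.eq_or_lt with rfl | hk
    · rw [h1, one_smul]
      exact fun x hx => Submodule.mem_sup_right ((D.rootSpace_neg_simple i).2 x hx)
    · rw [h1, (D.rootSpace_neg_simple i).1 k hk]
      simp

theorem F_mem_nMinus [HasCentralRadical ℂ 𝔤] (i : Fin r) : D.F i ∈ D.nMinus := by
  have h1 : D.IsPositive (D.α i) := ⟨(D.isCoroot_H i).1, Pi.single i 1, by
    simp [Pi.single_apply, ite_smul]⟩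
  exact (le_iSup₂_of_le (f := fun β (_ : D.IsPositive β) =>
    rootSpace 𝔱 (-β : Module.Dual ℂ 𝔱)) _ h1 le_rfl) (D.F_mem i)

theorem E_mem_nPlus (i : Fin r) : D.E i ∈ D.nPlus := by
  have h1 : D.IsPositive (D.α i) := ⟨(D.isCoroot_H i).1, Pi.single i 1, by
    simp [Pi.single_apply, ite_smul]⟩
  exact (le_iSup₂_of_le (f := fun β (_ : D.IsPositive β) => rootSpace 𝔱 β) _ h1 le_rfl) (D.E_mem i)

theorem isPositive_add_ne_zero {β γ : Module.Dual ℂ 𝔱} (hβ : D.IsPositive β)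
    (hγ : D.IsPositive γ) : β + γ ≠ 0 := by
  obtain ⟨⟨hβ0, -⟩, c, rfl⟩ := hβ
  obtain ⟨-, d, rfl⟩ := hγ
  intro h
  apply hβ0
  rw [← Finset.sum_add_distrib] at h
  simp only [← add_smul] at h
  rw [D.sum_nsmul_eq (fun j => c j + d j)] at h
  refine Finset.sum_eq_zero fun j _ => ?_
  have h1 : ((c j + d j : ℕ) : ℂ) = 0 :=
    D.coeff_ext (c := fun j => ((c j + d j : ℕ) : ℂ)) (d := 0) (by rw [h]; simp) j
  norm_cast at h1
  rw [(Nat.add_eq_zero_iff.1 h1).1, zero_smul]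

theorem isPositive_add {β γ : Module.Dual ℂ 𝔱} (hβ : D.IsPositive β)
    (hγ : D.IsPositive γ) (h : rootSpace 𝔱 (β + γ : Module.Dual ℂ 𝔱) ≠ ⊥) :
    D.IsPositive (β + γ) := by
  refine ⟨⟨D.isPositive_add_ne_zero hβ hγ, h⟩, ?_⟩
  obtain ⟨-, c, rfl⟩ := hβ
  obtain ⟨-, d, rfl⟩ := hγ
  exact ⟨c + d, by simp [add_smul, Finset.sum_add_distrib]⟩

theorem mem_nPlus {β : Module.Dual ℂ 𝔱} (hβ : D.IsPositive β) {x : 𝔤}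
    (hx : x ∈ rootSpace 𝔱 β) : x ∈ D.nPlus :=
  (le_iSup₂_of_le (f := fun β (_ : D.IsPositive β) => rootSpace 𝔱 β) β hβ le_rfl) hx

theorem mem_nMinus {β : Module.Dual ℂ 𝔱} (hβ : D.IsPositive β) {x : 𝔤}
    (hx : x ∈ rootSpace 𝔱 (-β : Module.Dual ℂ 𝔱)) : x ∈ D.nMinus :=
  (le_iSup₂_of_le (f := fun β (_ : D.IsPositive β) =>
    rootSpace 𝔱 (-β : Module.Dual ℂ 𝔱)) β hβ le_rfl) hx

theorem nPlus_induction {p : 𝔤 → Prop} {x : 𝔤} (hx : x ∈ D.nPlus)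
    (h : ∀ β, D.IsPositive β → ∀ x ∈ rootSpace 𝔱 β, p x) (h0 : p 0)
    (hadd : ∀ x y, p x → p y → p (x + y)) : p x := by
  refine LieSubmodule.iSup_induction (motive := p) _ hx (fun β x hx => ?_) h0 hadd
  refine LieSubmodule.iSup_induction (motive := p) _ hx (fun hβ x hx => h β hβ x hx) h0 hadd

theorem nMinus_induction {p : 𝔤 → Prop} {x : 𝔤} (hx : x ∈ D.nMinus)
    (h : ∀ β, D.IsPositive β → ∀ x ∈ rootSpace 𝔱 (-β : Module.Dual ℂ 𝔱), p x) (h0 : p 0)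
    (hadd : ∀ x y, p x → p y → p (x + y)) : p x := by
  refine LieSubmodule.iSup_induction (motive := p) _ hx (fun β x hx => ?_) h0 hadd
  refine LieSubmodule.iSup_induction (motive := p) _ hx (fun hβ x hx => h β hβ x hx) h0 hadd

/-- `𝔫` as a subalgebra of `𝔤`. -/
def nPlusAlg : LieSubalgebra ℂ 𝔤 :=
  { D.nPlus.toSubmodule with
    lie_mem' := by
      intro x y hx hy
      refine D.nPlus_induction (p := fun x => ⁅x, y⁆ ∈ D.nPlus) hx (fun β hβ x hx => ?_) (by simp)
        (fun a b ha hb => by rw [add_lie]; exact add_mem ha hb)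
      refine D.nPlus_induction (p := fun y => ⁅x, y⁆ ∈ D.nPlus) hy (fun γ hγ y hy => ?_) (by simp)
        (fun a b ha hb => by rw [lie_add]; exact add_mem ha hb)
      have h1 := lie_mem_rootSpace rfl hx hy
      by_cases h : rootSpace 𝔱 (β + γ : Module.Dual ℂ 𝔱) = ⊥
      · rw [h] at h1
        rw [(LieSubmodule.mem_bot _).1 h1]
        exact zero_mem _
      · exact D.mem_nPlus (D.isPositive_add hβ hγ h) h1 }

/-- `𝔫₋` as a subalgebra of `𝔤`. -/
def nMinusAlg [HasCentralRadical ℂ 𝔤] : LieSubalgebra ℂ 𝔤 :=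
  { D.nMinus.toSubmodule with
    lie_mem' := by
      intro x y hx hy
      refine D.nMinus_induction (p := fun x => ⁅x, y⁆ ∈ D.nMinus) hx (fun β hβ x hx => ?_) (by simp)
        (fun a b ha hb => by rw [add_lie]; exact add_mem ha hb)
      refine D.nMinus_induction (p := fun y => ⁅x, y⁆ ∈ D.nMinus) hy (fun γ hγ y hy => ?_)
        (by simp) (fun a b ha hb => by rw [lie_add]; exact add_mem ha hb)
      have h1 := lie_mem_rootSpace (neg_add β γ).symm hx hy
      by_cases h : rootSpace 𝔱 (-(β + γ) : Module.Dual ℂ 𝔱) = ⊥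
      · rw [h] at h1
        rw [(LieSubmodule.mem_bot _).1 h1]
        exact zero_mem _
      · exact D.mem_nMinus (D.isPositive_add hβ hγ
          (rootSpace_ne_bot_of_neg (D.isPositive_add_ne_zero hβ hγ) h)) h1 }

theorem sup_eq_top [HasCentralRadical ℂ 𝔤] :
    D.nMinus.toSubmodule ⊔ (𝔱.toSubmodule ⊔ D.nPlus.toSubmodule) = ⊤ := by
  rw [eq_top_iff, ← LieSubmodule.top_toSubmodule (R := ℂ) (L := 𝔱) (M := 𝔤),
    ← iSup_genWeightSpace_eq_top' ℂ 𝔱 𝔤, LieSubmodule.iSup_toSubmodule]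
  refine iSup_le fun χ => ?_
  by_cases hχ : (χ : 𝔱 → ℂ) = 0
  · intro x hx
    rw [hχ] at hx
    have hx' : x ∈ rootSpace 𝔱 (0 : 𝔱 → ℂ) := hx
    rw [rootSpace_zero_eq] at hx'
    exact Submodule.mem_sup_right (Submodule.mem_sup_left hx')
  · set β : Module.Dual ℂ 𝔱 := Weight.toLinear ℂ 𝔱 𝔤 χ with hβ
    have hβχ : (⇑β : 𝔱 → ℂ) = χ := rfl
    have hβ0 : β ≠ 0 := fun h0 => hχ (by rw [← hβχ, h0]; rfl)
    have hroot : IsRoot 𝔱 β := ⟨hβ0, χ.genWeightSpace_ne_bot⟩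
    obtain ⟨c, hc | hc⟩ := D.root_eq β hroot
    · exact fun x hx => Submodule.mem_sup_right (Submodule.mem_sup_right
        (D.mem_nPlus ⟨hroot, c, hc⟩ hx))
    · intro x hx
      refine Submodule.mem_sup_left (D.mem_nMinus (β := -β)
        ⟨⟨neg_ne_zero.2 hβ0, rootSpace_ne_bot_of_neg (neg_ne_zero.2 hβ0) ?_⟩, c, ?_⟩ ?_)
      · rw [neg_neg]; exact hroot.2
      · rw [hc, neg_neg]
      · rw [neg_neg]; exact hx

/-- The sum `𝔫₋ + 𝔱 + 𝔫` is direct. -/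
theorem disjoint_nPlus : Disjoint 𝔱.toSubmodule D.nPlus.toSubmodule ∧
    Disjoint D.nMinus.toSubmodule (𝔱.toSubmodule ⊔ D.nPlus.toSubmodule) := by
  have hind := iSupIndep_genWeightSpace ℂ 𝔱 𝔤
  let Am : Set (𝔱 → ℂ) := {χ | ∃ β : Module.Dual ℂ 𝔱, D.IsPositive β ∧ χ = ⇑(-β)}
  let Ap : Set (𝔱 → ℂ) := {χ | ∃ β : Module.Dual ℂ 𝔱, D.IsPositive β ∧ χ = ⇑β}
  let W (A : Set (𝔱 → ℂ)) : LieSubmodule ℂ 𝔱 𝔤 := ⨆ χ ∈ A, rootSpace 𝔱 χ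
  have hp : D.nPlus ≤ W Ap := iSup₂_le fun β hβ =>
    le_iSup₂_of_le (f := fun χ (_ : χ ∈ Ap) => rootSpace 𝔱 χ) ⇑β ⟨β, hβ, rfl⟩ le_rfl
  have hm : D.nMinus ≤ W Am := iSup₂_le fun β hβ =>
    le_iSup₂_of_le (f := fun χ (_ : χ ∈ Am) => rootSpace 𝔱 χ) ⇑(-β) ⟨β, hβ, rfl⟩ le_rfl
  have h0 : 𝔱.toLieSubmodule ≤ W {0} := by
    rw [← rootSpace_zero_eq ℂ 𝔤 𝔱]
    exact le_iSup₂_of_le (f := fun χ (_ : χ ∈ ({0} : Set (𝔱 → ℂ))) => rootSpace 𝔱 χ) 0 rfl le_rfl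
  have hmono : ∀ {A B : Set (𝔱 → ℂ)}, A ⊆ B → W A ≤ W B := fun h => biSup_mono h
  have d1 : Disjoint ({0} : Set (𝔱 → ℂ)) Ap := by
    rw [Set.disjoint_singleton_left]
    rintro ⟨β, hβ, h⟩
    exact hβ.1.1 (DFunLike.coe_injective h.symm)
  have d2 : Disjoint Am ({0} ∪ Ap) := by
    rw [Set.disjoint_left]
    rintro χ ⟨β, hβ, rfl⟩ (h | ⟨γ, hγ, h⟩)
    · exact hβ.1.1 (neg_eq_zero.1 (DFunLike.coe_injective h))
    · have : -β = γ := DFunLike.coe_injective h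
      exact D.isPositive_add_ne_zero hβ hγ (by rw [← this, add_neg_cancel])
  refine ⟨?_, ?_⟩
  · have := (hind.disjoint_biSup_biSup d1).mono h0 hp
    exact LieSubmodule.disjoint_toSubmodule.2 this
  · have := (hind.disjoint_biSup_biSup d2).mono hm
      (sup_le (h0.trans (hmono Set.subset_union_left)) (hp.trans (hmono Set.subset_union_right)))
    rw [← LieSubmodule.disjoint_toSubmodule, LieSubmodule.sup_toSubmodule] at this
    exact this

end SimpleRoots

end Roots

/-! ### The triangular decomposition of `U(𝔤)` -/

section TriangularU

open LieAlgebra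

variable {𝔤 : Type*} [LieRing 𝔤] [LieAlgebra ℂ 𝔤]

/-- For three subalgebras `𝔞`, `𝔟`, `𝔠` of `𝔤`, the multiplication map
`U(𝔞) ⊗ U(𝔟) ⊗ U(𝔠) → U(𝔤)`. -/
def U.mul₃ (𝔞 𝔟 𝔠 : LieSubalgebra ℂ 𝔤) : U 𝔞 ⊗[ℂ] (U 𝔟 ⊗[ℂ] U 𝔠) →ₗ[ℂ] U 𝔤 :=
  LinearMap.mul' ℂ (U 𝔤) ∘ₗ TensorProduct.map (U.map 𝔞.incl).toLinearMap
    (LinearMap.mul' ℂ (U 𝔤) ∘ₗ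
      TensorProduct.map (U.map 𝔟.incl).toLinearMap (U.map 𝔠.incl).toLinearMap)

theorem U.mul₃_tmul {𝔞 𝔟 𝔠 : LieSubalgebra ℂ 𝔤} (a : U 𝔞) (b : U 𝔟) (c : U 𝔠) :
    U.mul₃ 𝔞 𝔟 𝔠 (a ⊗ₜ (b ⊗ₜ c)) =
      U.map 𝔞.incl a * (U.map 𝔟.incl b * U.map 𝔠.incl c) := rfl

theorem U.map_ι {L L' : Type*} [LieRing L] [LieAlgebra ℂ L] [LieRing L'] [LieAlgebra ℂ L']
    (f : L →ₗ⁅ℂ⁆ L') (x : L) : U.map f (ι x) = ι (f x) := by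
  rw [U.map, ι, UniversalEnvelopingAlgebra.lift_ι_apply]
  rfl

theorem injective_of_linearIndependent_basis {κ A B : Type*} [AddCommGroup A] [Module ℂ A]
    [AddCommGroup B] [Module ℂ B] (b : Module.Basis κ ℂ A) (f : A →ₗ[ℂ] B)
    (h : LinearIndependent ℂ fun k => f (b k)) : Function.Injective f := by
  rw [injective_iff_map_eq_zero]
  intro x hx
  have h1 : Finsupp.linearCombination ℂ (fun k => f (b k)) (b.repr x) = 0 := by
    rw [← hx]
    conv_rhs => rw [← b.linearCombination_repr x]
    rw [Finsupp.apply_linearCombination]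
    rfl
  have h2 := (linearIndependent_iff.1 h) _ h1
  simpa using h2

theorem count_map_of_ne {A B : Type*} [DecidableEq B] (f : A → B) (m : Multiset A) (c : B)
    (hc : ∀ a, f a ≠ c) : Multiset.count c (m.map f) = 0 := by
  rw [Multiset.count_eq_zero, Multiset.mem_map]
  rintro ⟨a, -, ha⟩
  exact hc a ha

/-- The triangular decomposition of the enveloping algebra of a Lie algebra of matrices. -/
theorem U.mul₃_bijective {n : ℕ} (j : 𝔤 →ₗ⁅ℂ⁆ Matrix (Fin n) (Fin n) ℂ)
    (hj : Function.Injective j) {𝔞 𝔟 𝔠 : LieSubalgebra ℂ 𝔤}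
    (hd : Disjoint 𝔟.toSubmodule 𝔠.toSubmodule)
    (hd' : Disjoint 𝔞.toSubmodule (𝔟.toSubmodule ⊔ 𝔠.toSubmodule))
    (htop : 𝔞.toSubmodule ⊔ (𝔟.toSubmodule ⊔ 𝔠.toSubmodule) = ⊤) :
    Function.Bijective (U.mul₃ 𝔞 𝔟 𝔠) := by
  classical
  let ba := Module.Basis.ofVectorSpace ℂ 𝔞
  let bb := Module.Basis.ofVectorSpace ℂ 𝔟
  let bc := Module.Basis.ofVectorSpace ℂ 𝔠
  have hspan : ∀ {κ : Type _} {𝔥 : LieSubalgebra ℂ 𝔤} (b : Module.Basis κ ℂ 𝔥),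
      Submodule.span ℂ (Set.range (𝔥.incl ∘ b)) = 𝔥.toSubmodule := fun {κ 𝔥} b => by
    have h1 : Submodule.map (𝔥.incl : 𝔥 →ₗ[ℂ] 𝔤) (Submodule.span ℂ (Set.range b)) =
        𝔥.toSubmodule := by
      rw [b.span_eq]
      ext x
      simp
    rw [Submodule.map_span, ← Set.range_comp] at h1
    exact h1
  have hli : ∀ {κ : Type _} {𝔥 : LieSubalgebra ℂ 𝔤} (b : Module.Basis κ ℂ 𝔥),
      LinearIndependent ℂ (𝔥.incl ∘ b) := fun {κ 𝔥} b =>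
    b.linearIndependent.map' (𝔥.incl : 𝔥 →ₗ[ℂ] 𝔤)
      (LinearMap.ker_eq_bot.2 Subtype.val_injective)
  let e := Sum.elim (𝔞.incl ∘ ba) (Sum.elim (𝔟.incl ∘ bb) (𝔠.incl ∘ bc))
  have he : LinearIndependent ℂ e := by
    refine (hli ba).sum_type ((hli bb).sum_type (hli bc) ?_) ?_
    · rwa [hspan, hspan]
    · rw [Set.Sum.elim_range, Submodule.span_union, hspan, hspan, hspan]
      exact hd'
  have hetop : Submodule.span ℂ (Set.range e) = ⊤ := by
    rw [Set.Sum.elim_range, Submodule.span_union, Set.Sum.elim_range, Submodule.span_union, hspan,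
      hspan, hspan, htop]
  -- the ordered monomials form a basis of the enveloping algebra of each subalgebra
  have hbasis : ∀ {κ : Type _} {𝔥 : LieSubalgebra ℂ 𝔤} (b : Module.Basis κ ℂ 𝔥),
      ∃ B : Module.Basis (Multiset κ) ℂ (U 𝔥), ∀ m, B m = word b m.toList := fun {κ 𝔥} b => by
    refine ⟨Module.Basis.mk (v := fun m : Multiset κ => word b m.toList)
      (linearIndependent_word (j.comp 𝔥.incl) (hj.comp Subtype.val_injective)
        b.linearIndependent _ fun m m' h => by simpa using h) ?_, fun m => by
          rw [Module.Basis.mk_apply]⟩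
    rw [top_le_iff]
    refine eq_top_of_words b.span_eq _ fun l => ⟨(l : Multiset κ).toList, ?_, ?_⟩
    · rw [← Multiset.coe_eq_coe, Multiset.coe_toList]
    · exact Submodule.subset_span ⟨l, rfl⟩
  obtain ⟨Ba, hBa⟩ := hbasis ba
  obtain ⟨Bb, hBb⟩ := hbasis bb
  obtain ⟨Bc, hBc⟩ := hbasis bc
  have hword : ∀ l l' l'', U.mul₃ 𝔞 𝔟 𝔠 (word ba l ⊗ₜ (word bb l' ⊗ₜ word bc l'')) =
      word e (l.map Sum.inl ++ (l'.map (Sum.inr ∘ Sum.inl) ++ l''.map (Sum.inr ∘ Sum.inr))) :=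
    fun l l' l'' => by
      rw [U.mul₃_tmul, map_word, map_word, map_word, word_append, word_append, word_map, word_map,
        word_map]
      rfl
  constructor
  · refine injective_of_linearIndependent_basis (Ba.tensorProduct (Bb.tensorProduct Bc)) _ ?_
    have h1 : (fun k : Multiset _ × Multiset _ × Multiset _ =>
        U.mul₃ 𝔞 𝔟 𝔠 ((Ba.tensorProduct (Bb.tensorProduct Bc)) k)) = fun k =>
          word e (k.1.toList.map Sum.inl ++ (k.2.1.toList.map (Sum.inr ∘ Sum.inl) ++
            k.2.2.toList.map (Sum.inr ∘ Sum.inr))) := by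
      ext ⟨x, y, z⟩
      rw [Module.Basis.tensorProduct_apply, Module.Basis.tensorProduct_apply, hBa, hBb, hBc, hword]
    rw [h1]
    refine linearIndependent_word j hj he _ ?_
    rintro ⟨x, y, z⟩ ⟨x', y', z'⟩ h
    simp only [← Multiset.coe_add, ← Multiset.map_coe, Multiset.coe_toList] at h
    have hcount := fun s => congrArg (Multiset.count s) h
    simp only [Multiset.count_add] at hcount
    have inj2 : Function.Injective (Sum.inr ∘ Sum.inl :
        Module.Basis.ofVectorSpaceIndex ℂ 𝔟 → Module.Basis.ofVectorSpaceIndex ℂ 𝔞 ⊕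
          (Module.Basis.ofVectorSpaceIndex ℂ 𝔟 ⊕ Module.Basis.ofVectorSpaceIndex ℂ 𝔠)) :=
      Sum.inr_injective.comp Sum.inl_injective
    have inj3 : Function.Injective (Sum.inr ∘ Sum.inr :
        Module.Basis.ofVectorSpaceIndex ℂ 𝔠 → Module.Basis.ofVectorSpaceIndex ℂ 𝔞 ⊕
          (Module.Basis.ofVectorSpaceIndex ℂ 𝔟 ⊕ Module.Basis.ofVectorSpaceIndex ℂ 𝔠)) :=
      Sum.inr_injective.comp Sum.inr_injective
    refine Prod.ext (Multiset.ext.2 fun i => ?_) (Prod.ext (Multiset.ext.2 fun i => ?_)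
      (Multiset.ext.2 fun i => ?_))
    · have := hcount (Sum.inl i)
      simpa [Multiset.count_map_eq_count' _ _ Sum.inl_injective, count_map_of_ne] using this
    · have := hcount ((Sum.inr ∘ Sum.inl) i)
      rw [Multiset.count_map_eq_count' _ _ inj2, Multiset.count_map_eq_count' _ _ inj2] at this
      simpa [count_map_of_ne] using this
    · have := hcount ((Sum.inr ∘ Sum.inr) i)
      rw [Multiset.count_map_eq_count' _ _ inj3, Multiset.count_map_eq_count' _ _ inj3] at this
      simpa [count_map_of_ne] using this
  · rw [← LinearMap.range_eq_top]
    refine eq_top_of_words hetop _ fun l => ?_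
    suffices ∃ l₁ l₂ l₃, l.Perm (List.map Sum.inl l₁ ++ (List.map (Sum.inr ∘ Sum.inl) l₂ ++
        List.map (Sum.inr ∘ Sum.inr) l₃)) by
      obtain ⟨l₁, l₂, l₃, h⟩ := this
      exact ⟨_, h, _, hword l₁ l₂ l₃⟩
    induction l with
    | nil => exact ⟨[], [], [], by simp⟩
    | cons s l ih =>
      obtain ⟨l₁, l₂, l₃, h⟩ := ih
      rcases s with i | i | i
      · exact ⟨i :: l₁, l₂, l₃, by simpa using h⟩
      · refine ⟨l₁, i :: l₂, l₃, (h.cons _).trans ?_⟩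
        simpa using List.perm_middle.symm
      · refine ⟨l₁, l₂, i :: l₃, (h.cons _).trans ?_⟩
        rw [← List.append_assoc, List.map_cons, ← List.append_assoc]
        exact List.perm_middle.symm

/-- The augmentation `U(L) → ℂ`, which annihilates `L`. -/
def U.aug (L : Type*) [LieRing L] [LieAlgebra ℂ L] : U L →ₐ[ℂ] ℂ :=
  UniversalEnvelopingAlgebra.lift ℂ 0

@[simp] theorem U.aug_ι {L : Type*} [LieRing L] [LieAlgebra ℂ L] (x : L) :
    U.aug L (ι x) = 0 := by
  rw [U.aug, ι, UniversalEnvelopingAlgebra.lift_ι_apply]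
  rfl

/-- The action of `U(𝔤)` on a `𝔤`-module. -/
def U.act (𝔤 V : Type*) [LieRing 𝔤] [LieAlgebra ℂ 𝔤] [AddCommGroup V] [Module ℂ V]
    [LieRingModule 𝔤 V] [LieModule ℂ 𝔤 V] : U 𝔤 →ₐ[ℂ] Module.End ℂ V :=
  UniversalEnvelopingAlgebra.lift ℂ (LieModule.toEnd ℂ 𝔤 V)

@[simp] theorem U.act_ι {V : Type*} [AddCommGroup V] [Module ℂ V]
    [LieRingModule 𝔤 V] [LieModule ℂ 𝔤 V] (x : 𝔤) (v : V) : U.act 𝔤 V (ι x) v = ⁅x, v⁆ := by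
  rw [U.act, ι, UniversalEnvelopingAlgebra.lift_ι_apply]
  rfl

end TriangularU

/-! ### The structure of `Z` as a module over `U(𝔱)` -/

section StructureZ

open LieAlgebra

variable {𝔤 : Type*} [LieRing 𝔤] [LieAlgebra ℂ 𝔤] [FiniteDimensional ℂ 𝔤] [HasCentralRadical ℂ 𝔤]
variable {𝔱 : LieSubalgebra ℂ 𝔤} [𝔱.IsCartanSubalgebra] [IsLieAbelian 𝔱]
variable {r : ℕ} (D : SimpleRoots 𝔱 r)
variable (V : Type*) [AddCommGroup V] [Module ℂ V] [LieRingModule 𝔤 V] [LieModule ℂ 𝔤 V]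

namespace SimpleRoots

theorem mul₃_bijective {n : ℕ} (j : 𝔤 →ₗ⁅ℂ⁆ Matrix (Fin n) (Fin n) ℂ)
    (hj : Function.Injective j) : Function.Bijective (U.mul₃ D.nMinusAlg 𝔱 D.nPlusAlg) :=
  U.mul₃_bijective j hj D.disjoint_nPlus.1 D.disjoint_nPlus.2 D.sup_eq_top

/-- A linear retraction of `M` onto `U(𝔱) ⊗ V` which kills `𝔫₋ M + M 𝔫`. In terms of the triangular
decomposition it is `a b c ⊗ v ↦ ε(a) b ⊗ c v`, where `ε` is the augmentation of `U(𝔫₋)`. -/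
theorem exists_retraction {n : ℕ} (j : 𝔤 →ₗ⁅ℂ⁆ Matrix (Fin n) (Fin n) ℂ)
    (hj : Function.Injective j) :
    ∃ P : M 𝔤 V →ₗ[ℂ] U 𝔱 ⊗[ℂ] V, (∀ m ∈ D.J V, P m = 0) ∧
      ∀ (b : U 𝔱) (v : V), P (U.map 𝔱.incl b ⊗ₜ v) = b ⊗ₜ v := by
  let μ := LinearEquiv.ofBijective _ (D.mul₃_bijective j hj)
  -- the map `(a ⊗ (b ⊗ c), v) ↦ ε(a) b ⊗ c v`
  let p : U D.nMinusAlg ⊗[ℂ] (U 𝔱 ⊗[ℂ] U D.nPlusAlg) →ₗ[ℂ] V →ₗ[ℂ] U 𝔱 ⊗[ℂ] V :=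
    TensorProduct.lift (LinearMap.toSpanSingleton ℂ _ (TensorProduct.lift
      (LinearMap.mk₂ ℂ (fun (b : U 𝔱) (c : U D.nPlusAlg) =>
          (TensorProduct.mk ℂ (U 𝔱) V b) ∘ₗ (U.act 𝔤 V (U.map D.nPlusAlg.incl c)))
        (fun b b' c => by ext v; simp)
        (fun t b c => by ext v; simp [TensorProduct.smul_tmul'])
        (fun b c c' => by ext v; simp [TensorProduct.tmul_add])
        (fun t b c => by ext v; simp))) ∘ₗ (U.aug D.nMinusAlg).toLinearMap)
  have hp : ∀ a b c v, p (a ⊗ₜ (b ⊗ₜ c)) v =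
      U.aug _ a • (b ⊗ₜ U.act 𝔤 V (U.map D.nPlusAlg.incl c) v) := fun a b c v => by
    simp [p]
  let P : M 𝔤 V →ₗ[ℂ] U 𝔱 ⊗[ℂ] V := TensorProduct.lift (p ∘ₗ μ.symm.toLinearMap)
  have hP : ∀ a b c v, P ((U.map D.nMinusAlg.incl a *
      (U.map 𝔱.incl b * U.map D.nPlusAlg.incl c)) ⊗ₜ v) =
        U.aug _ a • (b ⊗ₜ U.act 𝔤 V (U.map D.nPlusAlg.incl c) v) := fun a b c v => by
    have h1 : μ.symm (U.map D.nMinusAlg.incl a *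
        (U.map 𝔱.incl b * U.map D.nPlusAlg.incl c)) = a ⊗ₜ (b ⊗ₜ c) := by
      rw [LinearEquiv.symm_apply_eq]
      rfl
    simp only [P, TensorProduct.lift.tmul, LinearMap.comp_apply, LinearEquiv.coe_coe]
    rw [h1, hp]
  have hind : ∀ {q : M 𝔤 V → Prop}, (∀ x y, q x → q y → q (x + y)) → q 0 →
      (∀ a b c v, q ((U.map D.nMinusAlg.incl a *
        (U.map 𝔱.incl b * U.map D.nPlusAlg.incl c)) ⊗ₜ v)) → ∀ m, q m := fun hadd h0 ht m => by
    induction m using TensorProduct.induction_on with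
    | zero => exact h0
    | add x y hx hy => exact hadd _ _ hx hy
    | tmul u v =>
      obtain ⟨w, rfl⟩ := μ.surjective u
      induction w using TensorProduct.induction_on with
      | zero => rw [map_zero, TensorProduct.zero_tmul]; exact h0
      | add x y hx hy => rw [map_add, TensorProduct.add_tmul]; exact hadd _ _ hx hy
      | tmul a w =>
        induction w using TensorProduct.induction_on with
        | zero => rw [TensorProduct.tmul_zero, map_zero, TensorProduct.zero_tmul]; exact h0
        | add x y hx hy =>
          rw [TensorProduct.tmul_add, map_add, TensorProduct.add_tmul]; exact hadd _ _ hx hy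
        | tmul b c => exact ht a b c v
  refine ⟨P, fun m hm => ?_, fun b v => ?_⟩
  · rw [mem_J] at hm
    induction hm using Submodule.span_induction with
    | zero => exact map_zero P
    | add x y _ _ hx hy => rw [map_add, hx, hy, add_zero]
    | smul c x _ hx => rw [map_smul, hx, smul_zero]
    | mem x hx =>
      rcases hx with ⟨X, hX, m', rfl⟩ | ⟨X, hX, m', rfl⟩
      · refine hind (q := fun m' => P (lAct V X m') = 0) (fun x y hx hy => ?_) (by simp)
          (fun a b c v => ?_) m'
        · rw [map_add, map_add, hx, hy, add_zero]
        · have h1 : ι X = U.map D.nMinusAlg.incl (ι ⟨X, hX⟩) :=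
            (U.map_ι D.nMinusAlg.incl ⟨X, hX⟩).symm
          rw [lAct_tmul, h1, ← mul_assoc, ← map_mul, hP, map_mul, U.aug_ι, zero_mul, zero_smul]
      · refine hind (q := fun m' => P (rAct V X m') = 0) (fun x y hx hy => ?_) (by simp)
          (fun a b c v => ?_) m'
        · rw [map_add, map_add, hx, hy, add_zero]
        · have h1 : ι X = U.map D.nPlusAlg.incl (ι ⟨X, hX⟩) :=
            (U.map_ι D.nPlusAlg.incl ⟨X, hX⟩).symm
          rw [rAct_tmul, map_sub, mul_assoc, mul_assoc]
          nth_rewrite 1 [h1]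
          rw [← map_mul, hP, hP, map_mul, map_mul, ← h1, Module.End.mul_apply, U.act_ι, sub_self]
  · have := hP 1 b 1 v
    simpa using this

/-- The map `U(𝔱) ⊗ V → Z`, `b ⊗ v ↦ b v`. -/
def ofTensor : U 𝔱 ⊗[ℂ] V →ₗ[U 𝔱] D.Z V :=
  (D.J V).mkQ ∘ₗ
    { (TensorProduct.map (U.map 𝔱.incl).toLinearMap LinearMap.id : U 𝔱 ⊗[ℂ] V →ₗ[ℂ] M 𝔤 V) with
      map_smul' := fun a x => by
        simp only [AddHom.toFun_eq_coe, LinearMap.coe_toAddHom, RingHom.id_apply]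
        induction x using TensorProduct.induction_on with
        | zero => simp
        | add x y hx hy => rw [smul_add, map_add, hx, hy, map_add, smul_add]
        | tmul b v =>
          rw [TensorProduct.smul_tmul', TensorProduct.map_tmul, TensorProduct.map_tmul,
            TensorProduct.smul_tmul', U.smul_eq]
          simp }

variable {V}

theorem mkQ_tmul_mul_nPlus (u : U 𝔤) (c : U D.nPlusAlg) (v : V) :
    (D.J V).mkQ ((u * U.map D.nPlusAlg.incl c) ⊗ₜ v) =
      (D.J V).mkQ (u ⊗ₜ U.act 𝔤 V (U.map D.nPlusAlg.incl c) v) := by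
  let A : Subalgebra ℂ (U D.nPlusAlg) :=
    { carrier := {c | ∀ (u : U 𝔤) (v : V), (D.J V).mkQ ((u * U.map D.nPlusAlg.incl c) ⊗ₜ v) =
        (D.J V).mkQ (u ⊗ₜ U.act 𝔤 V (U.map D.nPlusAlg.incl c) v)}
      mul_mem' := fun {a b} ha hb u v => by
        rw [map_mul, map_mul, ← mul_assoc, hb, ha, Module.End.mul_apply]
      add_mem' := fun {a b} ha hb u v => by
        rw [map_add, map_add, mul_add, TensorProduct.add_tmul, map_add, ha, hb, ← map_add,
          ← TensorProduct.tmul_add]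
        rfl
      algebraMap_mem' := fun t u v => by
        simp [Algebra.algebraMap_eq_smul_one, TensorProduct.smul_tmul] }
  refine U.mem_of_subalgebra A (fun X u v => ?_) c u v
  rw [U.map_ι, U.act_ι, ← sub_eq_zero, ← map_sub]
  refine (Submodule.Quotient.mk_eq_zero _).2 (Submodule.subset_span (Or.inr ⟨X, X.2, u ⊗ₜ v, ?_⟩))
  rfl

theorem mkQ_nMinus_mul_tmul (a : U D.nMinusAlg) (u : U 𝔤) (v : V) :
    (D.J V).mkQ ((U.map D.nMinusAlg.incl a * u) ⊗ₜ v) =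
      (D.J V).mkQ (U.aug _ a • (u ⊗ₜ v)) := by
  let A : Subalgebra ℂ (U D.nMinusAlg) :=
    { carrier := {a | ∀ (u : U 𝔤) (v : V), (D.J V).mkQ ((U.map D.nMinusAlg.incl a * u) ⊗ₜ v) =
        (D.J V).mkQ (U.aug _ a • (u ⊗ₜ v))}
      mul_mem' := fun {a b} ha hb u v => by
        rw [map_mul, map_mul, mul_assoc, ha, TensorProduct.smul_tmul', ← mul_smul_comm, hb,
          TensorProduct.smul_tmul', TensorProduct.smul_tmul', smul_smul, mul_comm]
      add_mem' := fun {a b} ha hb u v => by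
        rw [map_add, map_add, add_mul, TensorProduct.add_tmul, map_add, ha, hb, ← map_add,
          ← add_smul]
      algebraMap_mem' := fun t u v => by
        simp [Algebra.algebraMap_eq_smul_one, TensorProduct.smul_tmul'] }
  refine U.mem_of_subalgebra A (fun X u v => ?_) a u v
  rw [U.map_ι, U.aug_ι, zero_smul, map_zero]
  exact (Submodule.Quotient.mk_eq_zero _).2 (Submodule.subset_span (Or.inl ⟨X, X.2, u ⊗ₜ v, rfl⟩))

theorem ofTensor_tmul (b : U 𝔱) (v : V) : D.ofTensor V (b ⊗ₜ v) = b • D.ofV V v := by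
  rw [ofV, ← map_smul, TensorProduct.smul_tmul', U.smul_eq, mul_one]
  rfl

/-- `Z` is freely generated by `V` over `U(𝔱)`. -/
theorem ofTensor_bijective {n : ℕ} (j : 𝔤 →ₗ⁅ℂ⁆ Matrix (Fin n) (Fin n) ℂ)
    (hj : Function.Injective j) : Function.Bijective (D.ofTensor V) := by
  constructor
  · obtain ⟨P, hP, hP'⟩ := D.exists_retraction V j hj
    have h1 : ∀ x : U 𝔱 ⊗[ℂ] V, P (TensorProduct.map (U.map 𝔱.incl).toLinearMap LinearMap.id x) =
        x := fun x => by
      induction x using TensorProduct.induction_on with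
      | zero => simp
      | add x y hx hy => rw [map_add, map_add, hx, hy]
      | tmul b v => exact hP' b v
    rw [injective_iff_map_eq_zero]
    intro x hx
    rw [← h1 x]
    exact hP _ ((Submodule.Quotient.mk_eq_zero _).1 hx)
  · rw [← LinearMap.range_eq_top, eq_top_iff]
    rintro z -
    obtain ⟨m, rfl⟩ := (D.J V).mkQ_surjective z
    induction m using TensorProduct.induction_on with
    | zero => rw [map_zero]; exact zero_mem _
    | add x y hx hy => rw [map_add]; exact add_mem hx hy
    | tmul u v =>
      obtain ⟨w, rfl⟩ := (D.mul₃_bijective j hj).2 u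
      induction w using TensorProduct.induction_on with
      | zero => rw [map_zero, TensorProduct.zero_tmul, map_zero]; exact zero_mem _
      | add x y hx hy => rw [map_add, TensorProduct.add_tmul, map_add]; exact add_mem hx hy
      | tmul a w =>
        induction w using TensorProduct.induction_on with
        | zero =>
          rw [TensorProduct.tmul_zero, map_zero, TensorProduct.zero_tmul, map_zero]
          exact zero_mem _
        | add x y hx hy =>
          rw [TensorProduct.tmul_add, map_add, TensorProduct.add_tmul, map_add]
          exact add_mem hx hy
        | tmul b c =>
          rw [U.mul₃_tmul, mkQ_nMinus_mul_tmul, TensorProduct.smul_tmul', ← smul_mul_assoc,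
            mkQ_tmul_mul_nPlus, ← map_smul]
          exact ⟨(U.aug _ a • b) ⊗ₜ U.act 𝔤 V (U.map D.nPlusAlg.incl c) v, rfl⟩

theorem adZ_ofV (h : 𝔱) (v : V) : D.adZ V h (D.ofV V v) = D.ofV V ⁅(h : 𝔤), v⁆ := by
  have h1 : ad V (h : 𝔤) (1 ⊗ₜ v) = 1 ⊗ₜ ⁅(h : 𝔤), v⁆ := by
    rw [ad, LinearMap.sub_apply, lAct_tmul, rAct_tmul, mul_one, one_mul, sub_sub_cancel]
  exact congrArg (D.J V).mkQ h1

/-- `Z⁰` is generated over `U(𝔱)` by `V⁰`. -/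
theorem Z0_eq_span {n : ℕ} (j : 𝔤 →ₗ⁅ℂ⁆ Matrix (Fin n) (Fin n) ℂ) (hj : Function.Injective j) :
    D.Z0 V = Submodule.span (U 𝔱)
      (D.ofV V '' (LieModule.weightSpace V (0 : 𝔱 → ℂ) : Set V)) := by
  apply le_antisymm
  · classical
    intro z hz
    obtain ⟨x, rfl⟩ := (D.ofTensor_bijective j hj).2 z
    -- expand along a basis of `U(𝔱)`; the coefficients in `V` are then killed by `𝔱`
    let b := Module.Basis.ofVectorSpace ℂ (U 𝔱)
    let c := TensorProduct.equivFinsuppOfBasisLeft (N := V) b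
    have h1 : ∀ h : 𝔱, (LieModule.toEnd ℂ 𝔤 V h).lTensor (U 𝔱) x = 0 := fun h => by
      apply (D.ofTensor_bijective j hj).1
      rw [map_zero]
      have h2 : ∀ y : U 𝔱 ⊗[ℂ] V, D.ofTensor V ((LieModule.toEnd ℂ 𝔤 V h).lTensor (U 𝔱) y) =
          D.adZ V h (D.ofTensor V y) := fun y => by
        induction y using TensorProduct.induction_on with
        | zero => simp
        | add x y hx hy => simp only [map_add, hx, hy]
        | tmul b v =>
          rw [LinearMap.lTensor_tmul, ofTensor_tmul, ofTensor_tmul, map_smul, adZ_ofV]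
          rfl
      rw [h2]
      exact (Submodule.mem_iInf _).1 hz h
    have h3 : ∀ (f : V →ₗ[ℂ] V) (y : U 𝔱 ⊗[ℂ] V) k, c (f.lTensor (U 𝔱) y) k = f (c y k) :=
      fun f y k => by
        induction y using TensorProduct.induction_on with
        | zero => simp
        | add x y hx hy => simp only [map_add, Finsupp.add_apply, hx, hy]
        | tmul b v => simp [c]
    have h4 : ∀ k, c x k ∈ LieModule.weightSpace V (0 : 𝔱 → ℂ) := fun k => by
      rw [LieModule.mem_weightSpace]
      intro h
      have := h3 (LieModule.toEnd ℂ 𝔤 V h) x k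
      rw [h1, map_zero] at this
      simpa using this.symm
    have h5 : x = (c x).sum fun k v => b k ⊗ₜ v := by
      conv_lhs => rw [← c.symm_apply_apply x]
      exact TensorProduct.equivFinsuppOfBasisLeft_symm_apply b (c x)
    rw [h5, Finsupp.sum, map_sum]
    refine sum_mem fun k _ => ?_
    rw [ofTensor_tmul]
    exact Submodule.smul_mem _ _ (Submodule.subset_span ⟨_, h4 k, rfl⟩)
  · rw [Submodule.span_le]
    rintro _ ⟨v, hv, rfl⟩
    refine (Submodule.mem_iInf _).2 fun h => ?_
    rw [LinearMap.mem_ker, adZ_ofV]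
    have : ⁅(h : 𝔤), v⁆ = 0 := by
      simpa using (LieModule.mem_weightSpace _ _).1 hv h
    rw [this, ofV, TensorProduct.tmul_zero, map_zero]

theorem linearIndependent_ofV {n : ℕ} (j : 𝔤 →ₗ⁅ℂ⁆ Matrix (Fin n) (Fin n) ℂ)
    (hj : Function.Injective j) {κ : Type*} {v : κ → V} (hv : LinearIndependent ℂ v) :
    LinearIndependent (U 𝔱) fun k => D.ofV V (v k) := by
  let B := Algebra.TensorProduct.basis (U 𝔱) (Module.Basis.extend hv.linearIndepOn_id)
  have h1 := B.linearIndependent.map' (D.ofTensor V)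
    (LinearMap.ker_eq_bot.2 (D.ofTensor_bijective j hj).1)
  have h2 := h1.comp (fun k => ⟨v k, Module.Basis.subset_extend hv.linearIndepOn_id ⟨k, rfl⟩⟩)
    (fun k k' h => hv.injective (Subtype.ext_iff.1 h))
  have h3 : (fun k => D.ofV V (v k)) = ((D.ofTensor V ∘ B) ∘ fun k =>
      ⟨v k, Module.Basis.subset_extend hv.linearIndepOn_id ⟨k, rfl⟩⟩) := by
    ext k
    simp [B, Algebra.TensorProduct.basis_apply, ofTensor_tmul]
  rw [h3]
  exact h2

theorem denominators_ne_zero {a : U 𝔱} (ha : a ∈ denominators 𝔱) : a ≠ 0 := by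
  have : denominators 𝔱 ≤ nonZeroDivisors (U 𝔱) := by
    refine Submonoid.closure_le.2 ?_
    rintro _ ⟨β, h, k, -, hβ, rfl⟩
    rw [SetLike.mem_coe, mem_nonZeroDivisors_iff_ne_zero]
    intro h0
    -- evaluate at a multiple of `β` at which `h + k` does not vanish
    have h1 := congrArg (evalAt (((1 - k : ℂ) / 2) • β)) h0
    rw [map_zero, map_add, map_intCast, ι, evalAt, UniversalEnvelopingAlgebra.lift_ι_apply] at h1
    change ((1 - k : ℂ) / 2) * β h + k = 0 at h1
    rw [hβ.1] at h1
    ring_nf at h1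
    exact one_ne_zero h1
  exact nonZeroDivisors.ne_zero (this ha)

/-- `Z` is torsion-free over `U(𝔱)`. -/
theorem smul_eq_zero_Z {n : ℕ} (j : 𝔤 →ₗ⁅ℂ⁆ Matrix (Fin n) (Fin n) ℂ)
    (hj : Function.Injective j) {a : U 𝔱} (ha : a ≠ 0) {z : D.Z V} (h : a • z = 0) : z = 0 := by
  let e := LinearEquiv.ofBijective _ (D.ofTensor_bijective (V := V) j hj)
  have B := (Algebra.TensorProduct.basis (U 𝔱) (Module.Basis.ofVectorSpace ℂ V)).map e
  have h1 : a • B.repr z = 0 := by rw [← map_smul, h, map_zero]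
  have h2 : B.repr z = 0 := by
    ext k
    have := congrArg (fun f => f k) h1
    simpa [ha] using this
  simpa using h2

/-- `Z → Z̄` is injective, so that `ξ_i(z) = z` may be tested in `Z̄` without loss. -/
theorem toZbar_injective {n : ℕ} (j : 𝔤 →ₗ⁅ℂ⁆ Matrix (Fin n) (Fin n) ℂ)
    (hj : Function.Injective j) : Function.Injective (D.toZbar V) := by
  rw [injective_iff_map_eq_zero]
  intro z hz
  obtain ⟨c, hc⟩ := (IsLocalizedModule.eq_zero_iff (denominators 𝔱)
    (LocalizedModule.mkLinearMap (denominators 𝔱) (D.Z V))).1 hz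
  exact D.smul_eq_zero_Z j hj (denominators_ne_zero c.2) hc

end SimpleRoots

end StructureZ

/-! ### Zero weight vectors of locally finite `𝔰𝔩₂`-modules -/

section Sl2

open LieModule

variable {𝔤 : Type*} [LieRing 𝔤] [LieAlgebra ℂ 𝔤]
variable {V : Type*} [AddCommGroup V] [Module ℂ V] [LieRingModule 𝔤 V] [LieModule ℂ 𝔤 V]
variable {h e f : 𝔤}

theorem pow_toEnd_succ (x : 𝔤) (k : ℕ) (v : V) :
    (toEnd ℂ 𝔤 V x ^ (k + 1)) v = ⁅x, (toEnd ℂ 𝔤 V x ^ k) v⁆ := by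
  rw [pow_succ', Module.End.mul_apply, toEnd_apply_apply]

theorem pow_toEnd_succ' (x : 𝔤) (k : ℕ) (v : V) :
    (toEnd ℂ 𝔤 V x ^ (k + 1)) v = (toEnd ℂ 𝔤 V x ^ k) ⁅x, v⁆ := by
  rw [pow_succ, Module.End.mul_apply, toEnd_apply_apply]

/-- A primitive vector on which `f` is nilpotent has a natural number `n` as its weight, and is
killed by `f ^ (n + 1)`. -/
theorem exists_nat_of_primitive {t : IsSl2Triple h e f} {m : V} {μ : ℂ}
    (P : t.HasPrimitiveVectorWith m μ) (hf : ∃ k, (toEnd ℂ 𝔤 V f ^ k) m = 0) :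
    ∃ n : ℕ, μ = n ∧ (toEnd ℂ 𝔤 V f ^ (n + 1)) m = 0 := by
  obtain ⟨n, h1, h2⟩ := Nat.exists_not_and_succ_of_not_zero_of_exists
    (p := fun k => (toEnd ℂ 𝔤 V f ^ k) m = 0) (by simpa using P.ne_zero) hf
  refine ⟨n, ?_, h2⟩
  have h3 := P.lie_e_pow_succ_toEnd_f n
  rw [h2, lie_zero, eq_comm, smul_eq_zero, or_iff_left h1, mul_eq_zero, sub_eq_zero] at h3
  exact h3.resolve_left (Nat.cast_add_one_ne_zero n)

/-- The eigenvalues of `f e` on vectors of weight zero. -/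
def casimirValue (j : ℕ) : ℂ := j * (j + 1)

theorem casimirValue_injective : Function.Injective casimirValue := fun a b hab => by
  have h1 : a * (a + 1) = b * (b + 1) := by
    unfold casimirValue at hab
    exact_mod_cast hab
  rcases lt_trichotomy a b with h | h | h
  · nlinarith
  · exact h
  · nlinarith

theorem lie_f_pow_succ_e (t : IsSl2Triple h e f) {v : V} (hv : ⁅h, v⁆ = 0) (k : ℕ) :
    ⁅f, (toEnd ℂ 𝔤 V e ^ (k + 1)) v⁆ =
      (toEnd ℂ 𝔤 V e ^ k) (⁅f, ⁅e, v⁆⁆ - casimirValue k • v) := by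
  induction k with
  | zero => simp [casimirValue]
  | succ k ih =>
    have h1 : ⁅h, (toEnd ℂ 𝔤 V e ^ (k + 1)) v⁆ =
        (2 * ((k + 1 : ℕ) : ℂ)) • (toEnd ℂ 𝔤 V e ^ (k + 1)) v := by
      have := t.lie_h_pow_toEnd_e (μ := (0 : ℂ)) (m := v) (by simpa using hv) (k + 1)
      rwa [zero_add] at this
    rw [pow_toEnd_succ e (k + 1), leibniz_lie f, ih, ← lie_skew f e, t.lie_e_f, neg_lie, h1,
      ← pow_toEnd_succ]
    simp only [map_sub, map_smul, casimirValue]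
    push_cast
    module

/-- On vectors of weight zero, `f e` is diagonalizable with eigenvalues `j (j + 1)`. -/
theorem mem_iSup_eigenspace (t : IsSl2Triple h e f) {V₀ : Submodule ℂ V}
    (hV₀ : ∀ v ∈ V₀, ⁅h, v⁆ = 0) (T : V₀ →ₗ[ℂ] V₀) (hT : ∀ v, (T v : V) = ⁅f, ⁅e, (v : V)⁆⁆)
    (k : ℕ) (v : V₀) (hv : (toEnd ℂ 𝔤 V e ^ k) (v : V) = 0) :
    v ∈ ⨆ l : Fin k, Module.End.eigenspace T (casimirValue l) := by
  induction k generalizing v with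
  | zero =>
    have : v = 0 := Subtype.ext (by simpa using hv)
    rw [this]; exact zero_mem _
  | succ k ih =>
    have hle : (⨆ l : Fin k, Module.End.eigenspace T (casimirValue l)) ≤
        ⨆ l : Fin (k + 1), Module.End.eigenspace T (casimirValue l) :=
      iSup_le fun l => le_iSup
        (fun l : Fin (k + 1) => Module.End.eigenspace T (casimirValue l)) l.castSucc
    have h1 := ih (T v - casimirValue k • v) (by
      have := lie_f_pow_succ_e t (hV₀ v v.2) k
      rw [hv, lie_zero] at this
      rw [Submodule.coe_sub, hT, Submodule.coe_smul, ← this])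
    -- `T - k (k + 1)` is surjective on the sum of the eigenspaces for smaller eigenvalues
    have h2 : ∀ w ∈ ⨆ l : Fin k, Module.End.eigenspace T (casimirValue l),
        ∃ u ∈ ⨆ l : Fin k, Module.End.eigenspace T (casimirValue l),
          T u - casimirValue k • u = w := fun w hw => by
      induction hw using Submodule.iSup_induction' with
      | mem l w hw =>
        have hne : casimirValue l - casimirValue k ≠ 0 := sub_ne_zero.2 fun h0 =>
          l.2.ne (casimirValue_injective h0)
        refine ⟨(casimirValue l - casimirValue k)⁻¹ • w, Submodule.smul_mem _ _
          (Submodule.mem_iSup_of_mem l hw), ?_⟩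
        rw [map_smul, Module.End.mem_eigenspace_iff.1 hw, smul_comm, ← sub_smul,
          smul_smul, mul_inv_cancel₀ hne, one_smul]
      | zero => exact ⟨0, zero_mem _, by simp⟩
      | add x y _ _ hx hy =>
        obtain ⟨a, ha, rfl⟩ := hx
        obtain ⟨b, hb, rfl⟩ := hy
        exact ⟨a + b, add_mem ha hb, by rw [map_add, smul_add]; abel⟩
    obtain ⟨u, hu, hu'⟩ := h2 _ h1
    have h3 : v - u ∈ Module.End.eigenspace T (casimirValue k) := by
      rw [Module.End.mem_eigenspace_iff, map_sub, smul_sub, sub_eq_sub_iff_sub_eq_sub, hu']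
    have h4 : v = (v - u) + u := by abel
    rw [h4]
    exact add_mem (Submodule.mem_iSup_of_mem (Fin.last k) (by simpa using h3)) (hle hu)

/-- A zero weight vector `v` with `f e v = j (j + 1) v` is a non-zero multiple of `f ^ j u`, where
`u = e ^ j v` is a primitive vector of weight `2j`. -/
theorem primitive_of_casimir (t : IsSl2Triple h e f)
    (hE : ∀ v : V, ∃ k, (toEnd ℂ 𝔤 V e ^ k) v = 0) {v : V} (hv0 : v ≠ 0)
    (hv : ⁅h, v⁆ = 0) {j : ℕ} (hj : ⁅f, ⁅e, v⁆⁆ = casimirValue j • v) :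
    t.HasPrimitiveVectorWith ((toEnd ℂ 𝔤 V e ^ j) v) ((2 * j : ℕ) : ℂ) ∧
      ∃ c : ℂ, c ≠ 0 ∧ (toEnd ℂ 𝔤 V f ^ j) ((toEnd ℂ 𝔤 V e ^ j) v) = c • v := by
  have hstep : ∀ k, ⁅f, (toEnd ℂ 𝔤 V e ^ (k + 1)) v⁆ =
      (casimirValue j - casimirValue k) • (toEnd ℂ 𝔤 V e ^ k) v := fun k => by
    rw [lie_f_pow_succ_e t hv, hj, ← sub_smul, map_smul]
  have hweight : ∀ k : ℕ, ⁅h, (toEnd ℂ 𝔤 V e ^ k) v⁆ =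
      ((2 * k : ℕ) : ℂ) • (toEnd ℂ 𝔤 V e ^ k) v := fun k => by
    have := t.lie_h_pow_toEnd_e (μ := (0 : ℂ)) (m := v) (by simpa using hv) k
    rw [this]; push_cast; rw [zero_add]
  have hne : ∀ k ≤ j, ∃ c : ℂ, c ≠ 0 ∧
      (toEnd ℂ 𝔤 V f ^ k) ((toEnd ℂ 𝔤 V e ^ k) v) = c • v := fun k hk => by
    induction k with
    | zero => exact ⟨1, one_ne_zero, by simp⟩
    | succ k ih =>
      obtain ⟨c, hc, hck⟩ := ih (by omega)
      refine ⟨(casimirValue j - casimirValue k) * c, mul_ne_zero (sub_ne_zero.2 fun h0 => ?_) hc, ?_⟩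
      · have := casimirValue_injective h0
        omega
      · rw [pow_toEnd_succ' f, hstep, map_smul, hck, smul_smul]
  obtain ⟨c, hc, hcj⟩ := hne j le_rfl
  refine ⟨⟨fun h0 => ?_, hweight j, ?_⟩, c, hc, hcj⟩
  · rw [h0, map_zero, eq_comm, smul_eq_zero] at hcj
    exact hcj.elim hc hv0
  · by_contra hne'
    have P : t.symm.HasPrimitiveVectorWith ⁅e, (toEnd ℂ 𝔤 V e ^ j) v⁆
        (-((2 * (j + 1) : ℕ) : ℂ)) :=
      { ne_zero := hne'
        lie_h := by rw [← pow_toEnd_succ, neg_lie, hweight, neg_smul]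
        lie_e := by rw [← pow_toEnd_succ, hstep, sub_self, zero_smul] }
    obtain ⟨n, hn, -⟩ := exists_nat_of_primitive P (hE _)
    have h1 : ((2 * (j + 1) + n : ℕ) : ℂ) = 0 := by
      push_cast at hn ⊢
      rw [← hn]; ring
    have h2 := Nat.cast_eq_zero.1 h1
    omega

end Sl2

/-! ### Isotypic components -/

section Isotypic

open LieModule

variable {𝔤 : Type*} [LieRing 𝔤] [LieAlgebra ℂ 𝔤]
variable {𝔱 : LieSubalgebra ℂ 𝔤} [IsLieAbelian 𝔱]
variable {r : ℕ} (D : SimpleRoots 𝔱 r)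
variable {V : Type*} [AddCommGroup V] [Module ℂ V] [LieRingModule 𝔤 V] [LieModule ℂ 𝔤 V]

namespace SimpleRoots

theorem sl2Triple (i : Fin r) : IsSl2Triple (D.H i : 𝔤) (D.E i) (D.F i) where
  h_ne_zero h0 := by
    have : D.H i = 0 := Subtype.ext h0
    simpa [this] using D.α_H i
  lie_e_f := D.lie_E_F i
  lie_h_e_nsmul := by rw [D.lie_E, D.α_H, two_smul, two_nsmul]
  lie_h_f_nsmul := by rw [D.lie_F, D.α_H, two_smul, two_nsmul]

theorem E_mem_sl2 (i : Fin r) : D.E i ∈ D.sl2 i := LieSubalgebra.subset_lieSpan (by simp)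
theorem F_mem_sl2 (i : Fin r) : D.F i ∈ D.sl2 i := LieSubalgebra.subset_lieSpan (by simp)
theorem H_mem_sl2 (i : Fin r) : (D.H i : 𝔤) ∈ D.sl2 i := LieSubalgebra.subset_lieSpan (by simp)

/-- `𝔤_i` is spanned by `E_i`, `F_i`, `H_i`. -/
theorem exists_of_mem_sl2 {i : Fin r} {X : 𝔤} (hX : X ∈ D.sl2 i) :
    ∃ a b c : ℂ, X = a • D.E i + b • (D.H i : 𝔤) + c • D.F i := by
  have h1 : D.sl2 i ≤ (D.sl2Triple i).toLieSubalgebra ℂ := by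
    rw [sl2, LieSubalgebra.lieSpan_le]
    intro x hx
    refine Submodule.subset_span ?_
    simpa using hx
  obtain ⟨a, c, b, h2⟩ := IsSl2Triple.mem_toLieSubalgebra_iff.1 (h1 hX)
  exact ⟨a, b, c, by rw [h2, (D.sl2Triple i).lie_e_f]; abel⟩

/-- The `𝔤_i`-submodule spanned by the vectors `F_i ^ k u`, for a primitive vector `u`. -/
def string (i : Fin r) {u : V} {μ : ℂ} (P : (D.sl2Triple i).HasPrimitiveVectorWith u μ) :
    LieSubmodule ℂ (D.sl2 i) V where
  __ := Submodule.span ℂ (Set.range fun k => (toEnd ℂ 𝔤 V (D.F i) ^ k) u)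
  lie_mem {X v} hv := by
    obtain ⟨a, b, c, hX⟩ := D.exists_of_mem_sl2 X.2
    change ⁅(X : 𝔤), v⁆ ∈ Submodule.span ℂ _
    change v ∈ Submodule.span ℂ _ at hv
    induction hv using Submodule.span_induction with
    | zero => simp
    | add x y _ _ hx hy => rw [lie_add]; exact add_mem hx hy
    | smul c x _ hx => rw [lie_smul]; exact Submodule.smul_mem _ _ hx
    | mem x hx =>
      obtain ⟨k, rfl⟩ := hx
      have hmem : ∀ k, (toEnd ℂ 𝔤 V (D.F i) ^ k) u ∈
          Submodule.span ℂ (Set.range fun k => (toEnd ℂ 𝔤 V (D.F i) ^ k) u) :=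
        fun k => Submodule.subset_span ⟨k, rfl⟩
      simp only [hX, add_lie, smul_lie]
      refine add_mem (add_mem (Submodule.smul_mem _ _ ?_) (Submodule.smul_mem _ _ ?_))
        (Submodule.smul_mem _ _ ?_)
      · cases k with
        | zero => simp [P.lie_e]
        | succ k => rw [P.lie_e_pow_succ_toEnd_f]; exact Submodule.smul_mem _ _ (hmem k)
      · rw [P.lie_h_pow_toEnd_f]; exact Submodule.smul_mem _ _ (hmem k)
      · rw [← pow_toEnd_succ]; exact hmem (k + 1)

section String

variable {i : Fin r} {u : V} {n : ℕ} (P : (D.sl2Triple i).HasPrimitiveVectorWith u (n : ℂ))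
include P

theorem pow_F_mem_string (k : ℕ) : (toEnd ℂ 𝔤 V (D.F i) ^ k) u ∈ D.string i P :=
  Submodule.subset_span (s := Set.range fun k => (toEnd ℂ 𝔤 V (D.F i) ^ k) u) ⟨k, rfl⟩

theorem string_le (W : LieSubmodule ℂ (D.sl2 i) V) (hu : u ∈ W) : D.string i P ≤ W := by
  have h1 : ∀ k, (toEnd ℂ 𝔤 V (D.F i) ^ k) u ∈ W := fun k => by
    induction k with
    | zero => simpa using hu
    | succ k ih =>
      rw [pow_toEnd_succ]
      exact W.lie_mem (x := (⟨D.F i, D.F_mem_sl2 i⟩ : D.sl2 i)) ih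
  have h2 : Submodule.span ℂ (Set.range fun k => (toEnd ℂ 𝔤 V (D.F i) ^ k) u) ≤ W.toSubmodule :=
    Submodule.span_le.2 (by rintro _ ⟨k, rfl⟩; exact h1 k)
  exact h2

theorem linearIndependent_string :
    LinearIndependent ℂ fun k : Fin (n + 1) => (toEnd ℂ 𝔤 V (D.F i) ^ (k : ℕ)) u := by
  refine Module.End.eigenvectors_linearIndependent' (toEnd ℂ 𝔤 V (D.H i : 𝔤))
    (fun k : Fin (n + 1) => (n - 2 * (k : ℕ) : ℂ)) (fun k m hkm => ?_) _ fun k => ⟨?_, ?_⟩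
  · have : ((k : ℕ) : ℂ) = (m : ℕ) := by linear_combination (-1 / 2 : ℂ) * hkm
    exact Fin.ext (Nat.cast_injective this)
  · rw [Module.End.mem_genEigenspace_one, toEnd_apply_apply, P.lie_h_pow_toEnd_f]
  · exact P.pow_toEnd_f_ne_zero_of_eq_nat rfl (Nat.lt_succ_iff.1 k.2)

variable (hn : (toEnd ℂ 𝔤 V (D.F i) ^ (n + 1)) u = 0)
include hn

theorem string_eq_span : (D.string i P).toSubmodule =
    Submodule.span ℂ (Set.range fun k : Fin (n + 1) => (toEnd ℂ 𝔤 V (D.F i) ^ (k : ℕ)) u) := by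
  apply le_antisymm
  · refine Submodule.span_le.2 ?_
    rintro _ ⟨k, rfl⟩
    rcases Nat.lt_or_ge k (n + 1) with h | h
    · exact Submodule.subset_span ⟨⟨k, h⟩, rfl⟩
    · obtain ⟨d, rfl⟩ := Nat.exists_eq_add_of_le' h
      rw [SetLike.mem_coe]
      beta_reduce
      rw [pow_add, Module.End.mul_apply, hn, map_zero]
      exact zero_mem _
  · refine Submodule.span_le.2 ?_
    rintro _ ⟨k, rfl⟩
    exact D.pow_F_mem_string P k

theorem finrank_string : Module.finrank ℂ (D.string i P) = n + 1 := by
  have := finrank_span_eq_card (D.linearIndependent_string P)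
  rw [Fintype.card_fin] at this
  rw [← this]
  change Module.finrank ℂ (D.string i P).toSubmodule = _
  rw [D.string_eq_span P hn]

theorem isIrreducible_string (hE : ∀ v : V, ∃ k, (toEnd ℂ 𝔤 V (D.E i) ^ k) v = 0) :
    LieModule.IsIrreducible ℂ (D.sl2 i) (D.string i P) := by
  have hu : u ∈ D.string i P := by simpa using D.pow_F_mem_string P 0
  have hnt : Nontrivial (D.string i P) := ⟨⟨u, hu⟩, 0, fun h0 =>
    P.ne_zero (congrArg Subtype.val h0)⟩
  refine LieModule.IsIrreducible.mk fun N hN => ?_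
  obtain ⟨⟨y, hyS⟩, hyN, hy0⟩ := (Submodule.ne_bot_iff N.toSubmodule).1
    (by rwa [ne_eq, LieSubmodule.toSubmodule_eq_bot])
  have hE' : ∀ k, ∃ hk : (toEnd ℂ 𝔤 V (D.E i) ^ k) y ∈ D.string i P, ⟨_, hk⟩ ∈ N := fun k => by
    induction k with
    | zero => exact ⟨by simpa using hyS, by simpa using hyN⟩
    | succ k ih =>
      obtain ⟨hk, hkN⟩ := ih
      rw [pow_toEnd_succ]
      exact ⟨(D.string i P).lie_mem (x := (⟨D.E i, D.E_mem_sl2 i⟩ : D.sl2 i)) hk,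
        N.lie_mem (x := (⟨D.E i, D.E_mem_sl2 i⟩ : D.sl2 i)) hkN⟩
  -- a non-zero vector of `N` killed by `E_i` is a multiple of `u`
  obtain ⟨m, h1, h2⟩ := Nat.exists_not_and_succ_of_not_zero_of_exists
    (p := fun k => (toEnd ℂ 𝔤 V (D.E i) ^ k) y = 0)
    (by simpa using fun h0 => hy0 (Subtype.ext h0)) (hE y)
  obtain ⟨hmS, hmN⟩ := hE' m
  set w := (toEnd ℂ 𝔤 V (D.E i) ^ m) y with hw
  have hwE : ⁅D.E i, w⁆ = 0 := by rw [hw, ← pow_toEnd_succ]; exact h2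
  have h3 : w ∈ (D.string i P).toSubmodule := hmS
  rw [D.string_eq_span P hn, Submodule.mem_span_range_iff_exists_fun] at h3
  obtain ⟨c, hc⟩ := h3
  rw [Fin.sum_univ_succ] at hc
  have h4 : ∑ k : Fin n, (c k.succ * ((k + 1) * (n - k))) •
      (toEnd ℂ 𝔤 V (D.F i) ^ (k : ℕ)) u = 0 := by
    rw [← hwE, ← hc, lie_add, lie_sum, lie_smul]
    simp only [Fin.val_zero, pow_zero, Module.End.one_apply, P.lie_e, smul_zero, zero_add, lie_smul,
      Fin.val_succ, P.lie_e_pow_succ_toEnd_f, smul_smul]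
  have h5 := Fintype.linearIndependent_iff.1 ((D.linearIndependent_string P).comp Fin.castSucc
    (Fin.castSucc_injective n)) _ h4
  have h6 : ∀ k : Fin n, c k.succ = 0 := fun k => by
    rcases mul_eq_zero.1 (h5 k) with h | h
    · exact h
    · exfalso
      rcases mul_eq_zero.1 h with h | h
      · exact Nat.cast_add_one_ne_zero _ h
      · exact k.2.ne' (by exact_mod_cast sub_eq_zero.1 h)
  simp only [h6, zero_smul, Finset.sum_const_zero, add_zero, Fin.val_zero, pow_zero,
    Module.End.one_apply] at hc
  have hc0 : c 0 ≠ 0 := fun h0 => h1 (by rw [← hc, h0, zero_smul])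
  have huN : (⟨u, hu⟩ : D.string i P) ∈ N := by
    have : (⟨u, hu⟩ : D.string i P) = (c 0)⁻¹ • ⟨w, hmS⟩ := Subtype.ext (by
      change u = (c 0)⁻¹ • w
      rw [← hc, smul_smul, inv_mul_cancel₀ hc0, one_smul])
    rw [this]
    exact N.smul_mem _ hmN
  rw [eq_top_iff]
  rintro ⟨x, hx⟩ -
  have := D.string_le P (N.map (D.string i P).incl) ⟨⟨u, hu⟩, huN, rfl⟩ hx
  obtain ⟨x', hx', rfl⟩ := this
  exact hx'

/-- The Casimir operator acts on the irreducible module of dimension `n + 1` by `n (n + 2)`. -/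
theorem casimir_string {w : V} (hw : w ∈ D.string i P) :
    (4 : ℂ) • ⁅D.F i, ⁅D.E i, w⁆⁆ + ⁅(D.H i : 𝔤), ⁅(D.H i : 𝔤), w⁆⁆ + (2 : ℂ) • ⁅(D.H i : 𝔤), w⁆ =
      (n * (n + 2) : ℂ) • w := by
  change w ∈ Submodule.span ℂ _ at hw
  induction hw using Submodule.span_induction with
  | zero => simp
  | add x y _ _ hx hy => simp only [lie_add, smul_add, ← hx, ← hy]; abel
  | smul c x _ hx =>
    rw [smul_comm, ← hx]
    simp only [lie_smul, smul_add, smul_comm c]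
  | mem x hx =>
    obtain ⟨k, rfl⟩ := hx
    cases k with
    | zero =>
      simp only [pow_zero, Module.End.one_apply, P.lie_e, P.lie_h, lie_zero, lie_smul, smul_zero]
      module
    | succ k =>
      simp only [P.lie_e_pow_succ_toEnd_f, P.lie_h_pow_toEnd_f, lie_smul, ← pow_toEnd_succ]
      push_cast
      module

end String

variable {i : Fin r} (hE : ∀ v : V, ∃ k, (toEnd ℂ 𝔤 V (D.E i) ^ k) v = 0)
  (hF : ∀ v : V, ∃ k, (toEnd ℂ 𝔤 V (D.F i) ^ k) v = 0)
include hE hF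

theorem casimir_isotypic {j : ℕ} {w : V} (hw : w ∈ D.isotypic V i j) :
    (4 : ℂ) • ⁅D.F i, ⁅D.E i, w⁆⁆ + ⁅(D.H i : 𝔤), ⁅(D.H i : 𝔤), w⁆⁆ + (2 : ℂ) • ⁅(D.H i : 𝔤), w⁆ =
      (4 * casimirValue j) • w := by
  rw [isotypic, sSup_eq_iSup'] at hw
  refine LieSubmodule.iSup_induction (motive := fun w =>
    (4 : ℂ) • ⁅D.F i, ⁅D.E i, w⁆⁆ + ⁅(D.H i : 𝔤), ⁅(D.H i : 𝔤), w⁆⁆ + (2 : ℂ) • ⁅(D.H i : 𝔤), w⁆ =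
      (4 * casimirValue j) • w) _ hw ?_ (by simp)
    (fun x y hx hy => by simp only [lie_add, smul_add, ← hx, ← hy]; abel)
  rintro ⟨W, hirr, hdim⟩ w hw
  have hfin : Module.Finite ℂ W := Module.finite_of_finrank_pos (by omega)
  have hnt : Nontrivial W := Module.nontrivial_of_finrank_pos (R := ℂ) (by omega)
  let t' : IsSl2Triple (⟨_, D.H_mem_sl2 i⟩ : D.sl2 i) ⟨_, D.E_mem_sl2 i⟩ ⟨_, D.F_mem_sl2 i⟩ :=
    { h_ne_zero := fun h0 => (D.sl2Triple i).h_ne_zero (congrArg Subtype.val h0)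
      lie_e_f := Subtype.ext (D.sl2Triple i).lie_e_f
      lie_h_e_nsmul := Subtype.ext (D.sl2Triple i).lie_h_e_nsmul
      lie_h_f_nsmul := Subtype.ext (D.sl2Triple i).lie_h_f_nsmul }
  obtain ⟨μ, ⟨u, hu⟩, -, P'⟩ := IsSl2Triple.exists_hasPrimitiveVectorWith (R := ℂ) (M := W) t'
  have P : (D.sl2Triple i).HasPrimitiveVectorWith u μ :=
    { ne_zero := fun h0 => P'.ne_zero (Subtype.ext h0)
      lie_h := congrArg Subtype.val P'.lie_h
      lie_e := congrArg Subtype.val P'.lie_e }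
  obtain ⟨n, rfl, hn⟩ := exists_nat_of_primitive P (hF u)
  have hle := D.string_le P W hu
  have heq : D.string i P = W := by
    have h1 := hirr.eq_bot_or_eq_top ((D.string i P).comap W.incl)
    rcases h1 with h1 | h1
    · exfalso
      have h2 : (⟨u, hu⟩ : W) ∈ (D.string i P).comap W.incl := by
        have := D.pow_F_mem_string P 0
        simpa using this
      rw [h1] at h2
      exact P'.ne_zero ((LieSubmodule.mem_bot _).1 h2)
    · refine le_antisymm hle fun x hx => ?_
      have : (⟨x, hx⟩ : W) ∈ (D.string i P).comap W.incl := by rw [h1]; trivial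
      simpa using this
  have hnj : n = 2 * j := by
    have := D.finrank_string P hn
    rw [heq, hdim] at this
    omega
  have h3 := D.casimir_string P hn (w := w) (by rw [heq]; exact hw)
  rw [h3, hnj, casimirValue]
  push_cast
  congr 1
  ring

/-- The zero weight vectors of the `(2j + 1)`-dimensional isotypic component are the eigenvectors
of `F_i E_i` with eigenvalue `j (j + 1)`. -/
theorem mem_isotypic_iff {j : ℕ} {v : V} (hv : ⁅(D.H i : 𝔤), v⁆ = 0) :
    v ∈ D.isotypic V i j ↔ ⁅D.F i, ⁅D.E i, v⁆⁆ = casimirValue j • v := by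
  constructor
  · intro h
    have := D.casimir_isotypic hE hF h
    rw [hv, lie_zero, smul_zero, add_zero, add_zero, mul_smul] at this
    exact smul_right_injective V (show (4 : ℂ) ≠ 0 by norm_num) this
  · intro h
    by_cases hv0 : v = 0
    · rw [hv0]; exact zero_mem _
    obtain ⟨P, c, hc, hcv⟩ := primitive_of_casimir (D.sl2Triple i) hE hv0 hv h
    obtain ⟨n, hn, hn'⟩ := exists_nat_of_primitive P (hF _)
    have hn2 : 2 * j = n := Nat.cast_injective hn
    rw [← hn2] at hn'
    have h1 : D.string i P ≤ D.isotypic V i j := by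
      refine le_sSup ⟨D.isIrreducible_string P hn' hE, D.finrank_string P hn'⟩
    have h2 := h1 (D.pow_F_mem_string P j)
    rw [hcv] at h2
    have h3 := (D.isotypic V i j).smul_mem c⁻¹ h2
    rwa [smul_smul, inv_mul_cancel₀ hc, one_smul] at h3

end SimpleRoots

end Isotypic

/-! ### One-parameter subgroups and the differential -/

section Differential

variable {n : ℕ} {G : Subgroup (GL (Fin n) ℂ)}
  {𝔤 : LieSubalgebra ℂ (Matrix (Fin n) (Fin n) ℂ)} (h𝔤 : IsLieAlgebraOf 𝔤 G)

/-- The element `exp (s X)` of `G`. -/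
def expG (X : 𝔤) (s : ℂ) : G :=
  ⟨((h𝔤 X).1 X.2 s).choose, ((h𝔤 X).1 X.2 s).choose_spec.1⟩

theorem coe_expG (X : 𝔤) (s : ℂ) :
    ((expG h𝔤 X s : GL (Fin n) ℂ) : Matrix (Fin n) (Fin n) ℂ) =
      NormedSpace.exp (s • (X : Matrix (Fin n) (Fin n) ℂ)) :=
  ((h𝔤 X).1 X.2 s).choose_spec.2.symm ▸ rfl

theorem eq_of_coe {g g' : G} (h : ((g : GL (Fin n) ℂ) : Matrix (Fin n) (Fin n) ℂ) =
    (g' : GL (Fin n) ℂ)) :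
    g = g' :=
  Subtype.ext (Units.ext h)

theorem expG_zero (X : 𝔤) : expG h𝔤 X 0 = 1 := eq_of_coe (by simp [coe_expG])

theorem expG_add (X : 𝔤) (s t : ℂ) : expG h𝔤 X (s + t) = expG h𝔤 X s * expG h𝔤 X t :=
  eq_of_coe (by
    rw [coe_expG, Subgroup.coe_mul, Units.val_mul, coe_expG, coe_expG, add_smul]
    exact Matrix.exp_add_of_commute _ _
      (((Commute.refl _).smul_left _).smul_right _))

theorem expG_neg (X : 𝔤) (s : ℂ) : expG h𝔤 X (-s) = (expG h𝔤 X s)⁻¹ := by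
  rw [eq_inv_iff_mul_eq_one, ← expG_add, neg_add_cancel, expG_zero]

theorem expG_neg_left (X : 𝔤) (s : ℂ) : expG h𝔤 (-X) s = (expG h𝔤 X s)⁻¹ := by
  rw [← expG_neg]
  exact eq_of_coe (by simp [coe_expG])

theorem expG_Ad (X : 𝔤) (g : G) (s : ℂ) :
    expG h𝔤 (Ad h𝔤 g X) s = g * expG h𝔤 X s * g⁻¹ := eq_of_coe (by
  rw [coe_expG, Subgroup.coe_mul, Subgroup.coe_mul, Units.val_mul, Units.val_mul, coe_expG,
    Subgroup.coe_inv, ← Matrix.exp_units_conj]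
  congr 1
  simp [Ad])

variable {V : Type*} [AddCommGroup V] [Module ℂ V] [LieRingModule 𝔤 V] [LieModule ℂ 𝔤 V]
variable {ρ : Representation ℂ G V} (hdiff : IsDifferential 𝔤 ρ)
include hdiff

/-- The action of `𝔤` on `V` is equivariant relative to `G`. -/
theorem rho_lie (g : G) (X : 𝔤) (v : V) : ρ g ⁅X, v⁆ = ⁅Ad h𝔤 g X, ρ g v⁆ := by
  rw [← sub_eq_zero, ← Module.forall_dual_apply_eq_zero_iff ℂ]
  intro φ
  rw [map_sub, sub_eq_zero]
  have h1 := hdiff X (expG h𝔤 X) (coe_expG h𝔤 X) v (φ ∘ₗ ρ g)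
  have h2 := hdiff (Ad h𝔤 g X) _ (coe_expG h𝔤 (Ad h𝔤 g X)) (ρ g v) φ
  refine h1.unique (h2.congr_of_eventuallyEq (Filter.Eventually.of_forall fun s => ?_))
  simp only [LinearMap.comp_apply]
  rw [expG_Ad, map_mul, map_mul, Module.End.mul_apply, Module.End.mul_apply,
    ← Module.End.mul_apply (ρ g⁻¹), ← map_mul, inv_mul_cancel, map_one, Module.End.one_apply]

/-- If a curve `∑ p_k(s) w_k` satisfies the differential equation `w' = X w`, then `exp X` maps
its value at `0` to its value at `1`. -/
theorem rho_exp_of_hasDerivAt (X : 𝔤) (N : ℕ) (w : ℕ → V) (p p' : ℕ → ℂ → ℂ)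
    (hp : ∀ k s, HasDerivAt (p k) (p' k s) s)
    (hw : ∀ s, ∑ k ∈ Finset.range N, p' k s • w k = ⁅X, ∑ k ∈ Finset.range N, p k s • w k⁆) :
    ρ (expG h𝔤 X 1) (∑ k ∈ Finset.range N, p k 0 • w k) =
      ∑ k ∈ Finset.range N, p k 1 • w k := by
  suffices h : ∑ k ∈ Finset.range N, p k 0 • w k =
      ρ (expG h𝔤 X 1)⁻¹ (∑ k ∈ Finset.range N, p k 1 • w k) by
    rw [h, ← Module.End.mul_apply, ← map_mul, mul_inv_cancel, map_one, Module.End.one_apply]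
  rw [← sub_eq_zero, ← Module.forall_dual_apply_eq_zero_iff ℂ]
  intro φ
  rw [map_sub, sub_eq_zero]
  have h1 : ∀ v s, HasDerivAt (fun t => φ (ρ (expG h𝔤 X t)⁻¹ v))
      (φ (ρ (expG h𝔤 X s)⁻¹ (-⁅X, v⁆))) s := fun v s => by
    have h2 := hdiff (-X) _ (coe_expG h𝔤 (-X)) v (φ ∘ₗ ρ (expG h𝔤 X s)⁻¹)
    rw [← sub_self s] at h2
    have h3 := HasDerivAt.comp_sub_const s s h2
    rw [neg_lie] at h3
    refine h3.congr_of_eventuallyEq (Filter.Eventually.of_forall fun t => ?_)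
    simp only [LinearMap.comp_apply]
    rw [expG_neg_left, ← Module.End.mul_apply, ← map_mul, ← mul_inv_rev, ← expG_add,
      sub_add_cancel]
  have h2 : ∀ s, HasDerivAt
      (fun t => ∑ k ∈ Finset.range N, p k t * φ (ρ (expG h𝔤 X t)⁻¹ (w k))) 0 s := fun s => by
    have h3 := HasDerivAt.fun_sum (u := Finset.range N)
      fun k _ => (hp k s).mul (h1 (w k) s)
    refine h3.congr_deriv ?_
    have h4 := congrArg (fun v => φ (ρ (expG h𝔤 X s)⁻¹ v)) (hw s)
    simp only [lie_sum, lie_smul, map_sum, map_smul, smul_eq_mul] at h4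
    simp only [map_neg, mul_neg, Finset.sum_add_distrib, Finset.sum_neg_distrib]
    rw [h4, add_neg_cancel]
  have h3 := is_const_of_deriv_eq_zero (fun s => (h2 s).differentiableAt) (fun s => (h2 s).deriv)
    0 1
  rw [expG_zero] at h3
  simpa [map_sum] using h3

end Differential

section AdjointRepresentation

variable {n : ℕ} {G : Subgroup (GL (Fin n) ℂ)}
  {𝔤 : LieSubalgebra ℂ (Matrix (Fin n) (Fin n) ℂ)} (h𝔤 : IsLieAlgebraOf 𝔤 G)

/-- The adjoint representation of `G` on `𝔤`. -/
def AdRep : Representation ℂ G 𝔤 where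
  toFun g := (Ad h𝔤 g : 𝔤 →ₗ[ℂ] 𝔤)
  map_one' := by
    ext1 X
    apply Subtype.ext
    simp [Ad]
  map_mul' g g' := by
    ext1 X
    apply Subtype.ext
    simp [Ad, mul_assoc]

theorem AdRep_apply (g : G) (X : 𝔤) : AdRep h𝔤 g X = Ad h𝔤 g X := rfl

open scoped Matrix.Norms.Operator in
/-- The adjoint action of `𝔤` is the differential of the adjoint action of `G`. -/
theorem isDifferential_AdRep : IsDifferential 𝔤 (AdRep h𝔤) := by
  intro X g hg Y φ
  obtain ⟨ψ, hψ⟩ := LinearMap.exists_extend (p := 𝔤.toSubmodule) (V' := ℂ) φ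
  have hψ' : ∀ Z : 𝔤, φ Z = LinearMap.toContinuousLinearMap ψ (Z : Matrix (Fin n) (Fin n) ℂ) :=
    fun Z => by rw [← hψ]; rfl
  have h1 := hasDerivAt_exp_smul_const (𝕂 := ℂ) (X : Matrix (Fin n) (Fin n) ℂ) 0
  have h2 := hasDerivAt_exp_smul_const (𝕂 := ℂ) (-(X : Matrix (Fin n) (Fin n) ℂ)) 0
  have h3 := (LinearMap.toContinuousLinearMap ψ).hasFDerivAt.comp_hasDerivAt (0 : ℂ)
    ((h1.mul_const (Y : Matrix (Fin n) (Fin n) ℂ)).mul h2)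
  have hf : (fun s => φ (AdRep h𝔤 (g s) Y)) = (LinearMap.toContinuousLinearMap ψ) ∘
      (fun s : ℂ => NormedSpace.exp (s • (X : Matrix (Fin n) (Fin n) ℂ)) *
        (Y : Matrix (Fin n) (Fin n) ℂ) *
          NormedSpace.exp (s • -(X : Matrix (Fin n) (Fin n) ℂ))) := by
    funext s
    rw [hψ', Function.comp_apply, smul_neg, Matrix.exp_neg, ← hg, ← Matrix.coe_units_inv]
    rfl
  rw [hf]
  refine h3.congr_deriv ?_
  rw [hψ']
  simp only [zero_smul, NormedSpace.exp_zero, one_mul, mul_one, mul_neg,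
    LieSubalgebra.coe_bracket, LieRing.of_associative_ring_bracket, sub_eq_add_neg]
  rfl

end AdjointRepresentation

/-! ### Local finiteness -/

section LocallyFinite

open LieModule

/-- An operator that shifts the eigenvalues of a second one is nilpotent in finite dimension. -/
theorem isNilpotent_of_lie {W : Type*} [AddCommGroup W] [Module ℂ W] [FiniteDimensional ℂ W]
    {c : ℂ} (hc : c ≠ 0) (h e : Module.End ℂ W) (he : ⁅h, e⁆ = c • e) : IsNilpotent e := by
  by_contra hn
  have hn' : ∀ k, e ^ k ≠ 0 := fun k hk => hn ⟨k, hk⟩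
  have h1 : ∀ k : ℕ, ⁅h, e ^ k⁆ = (k * c) • e ^ k := fun k => by
    induction k with
    | zero => simp [LieRing.of_associative_ring_bracket]
    | succ k ih =>
      have h2 : ⁅h, e ^ (k + 1)⁆ = ⁅h, e ^ k⁆ * e + e ^ k * ⁅h, e⁆ := by
        simp only [LieRing.of_associative_ring_bracket, pow_succ]
        noncomm_ring
      rw [h2, ih, he, smul_mul_assoc, mul_smul_comm, ← pow_succ, ← add_smul]
      push_cast
      ring_nf
  have h2 := Module.End.eigenvectors_linearIndependent'
    (LieAlgebra.ad ℂ (Module.End ℂ W) h) (fun k : ℕ => (k * c : ℂ))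
    (fun a b hab => Nat.cast_injective (mul_right_cancel₀ hc hab)) (fun k => e ^ k)
    fun k => ⟨by rw [Module.End.mem_genEigenspace_one]; exact h1 k, hn' k⟩
  exact not_finite_iff_infinite.2 inferInstance h2.finite

variable {n : ℕ} {G : Subgroup (GL (Fin n) ℂ)}
  {𝔤 : LieSubalgebra ℂ (Matrix (Fin n) (Fin n) ℂ)} (h𝔤 : IsLieAlgebraOf 𝔤 G)
variable {V : Type*} [AddCommGroup V] [Module ℂ V] [LieRingModule 𝔤 V] [LieModule ℂ 𝔤 V]
variable {ρ : Representation ℂ G V} (hdiff : IsDifferential 𝔤 ρ)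
  (hρ : IsLocallyFiniteModule ρ)

include h𝔤 hdiff in
/-- Subrepresentations of `G` are stable under the Lie algebra. -/
theorem lie_mem_of_subrepresentation (W : Subrepresentation ρ) (X : 𝔤) {v : V}
    (hv : v ∈ W.toSubmodule) : ⁅X, v⁆ ∈ W.toSubmodule := by
  by_contra hX
  obtain ⟨φ, h1, h2⟩ := Submodule.exists_le_ker_of_notMem hX
  have h3 := hdiff X _ (coe_expG h𝔤 X) v φ
  have h4 : (fun s => φ (ρ (expG h𝔤 X s) v)) = fun _ => 0 := by
    funext s
    exact h2 (W.apply_mem_toSubmodule _ hv)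
  rw [h4] at h3
  exact h1 (h3.unique (hasDerivAt_const _ _))

include h𝔤 hdiff hρ in
/-- An eigenvector `X` of `ad H` with nonzero eigenvalue acts locally nilpotently on `V`, since `V` is a
sum of finite-dimensional submodules. -/
theorem exists_pow_toEnd_eq_zero {X H : 𝔤} {c : ℂ} (hc : c ≠ 0) (hX : ⁅H, X⁆ = c • X) (v : V) :
    ∃ k, (toEnd ℂ 𝔤 V X ^ k) v = 0 := by
  obtain ⟨𝒲, h1, -, h2⟩ := hρ.decomposes
  have hv : v ∈ ⨆ W : 𝒲, W.1.toSubmodule := by rw [h2]; trivial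
  induction hv using Submodule.iSup_induction' with
  | mem W w hw =>
    have := (h1 W.1 W.2).2
    let W' : LieSubmodule ℂ 𝔤 V :=
      { W.1.toSubmodule with
        lie_mem := fun {x m} hm => lie_mem_of_subrepresentation h𝔤 hdiff W.1 x hm }
    have : FiniteDimensional ℂ W' := (h1 W.1 W.2).2
    obtain ⟨k, hk⟩ := isNilpotent_of_lie hc (toEnd ℂ 𝔤 W' H) (toEnd ℂ 𝔤 W' X) (by
      rw [← LieHom.map_lie, hX, map_smul])
    refine ⟨k, ?_⟩
    have h3 : ∀ k, (((toEnd ℂ 𝔤 W' X ^ k) (⟨w, hw⟩ : W') : W') : V) = (toEnd ℂ 𝔤 V X ^ k) w :=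
      fun k => by
        induction k with
        | zero => rfl
        | succ k ih => rw [pow_toEnd_succ, pow_toEnd_succ, ← ih]; rfl
    rw [← h3, hk]; rfl
  | zero => exact ⟨0, by simp⟩
  | add x y _ _ hx hy =>
    obtain ⟨a, ha⟩ := hx
    obtain ⟨b, hb⟩ := hy
    refine ⟨a + b, ?_⟩
    rw [map_add, pow_add, Module.End.mul_apply, Module.End.mul_apply, hb, map_zero, add_zero,
      ← Module.End.mul_apply, ← pow_add, add_comm, pow_add, Module.End.mul_apply, ha, map_zero]

theorem isNilpotent_ad {X H : 𝔤} {c : ℂ} (hc : c ≠ 0) (hX : ⁅H, X⁆ = c • X) :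
    IsNilpotent (LieAlgebra.ad ℂ 𝔤 X) :=
  isNilpotent_of_lie hc (LieAlgebra.ad ℂ 𝔤 H) _ (by rw [← LieHom.map_lie, hX, map_smul])

end LocallyFinite

/-! ### The action of the representatives of the simple reflections on zero weight vectors -/

section BinaryForms

open LieModule Polynomial

/-- The polynomial `a - 2bt - ct²` which corresponds to the element `aE + bH + cF` of `𝔰𝔩₂`. -/
def quad (y : Fin 3 → ℂ) : ℂ[X] := C (y 0) - C (2 * y 1) * X - C (y 2) * X ^ 2

/-- The Lie bracket of `𝔰𝔩₂` in the coordinates relative to `E`, `H`, `F`. -/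
def br (x : Fin 3 → ℂ) : (Fin 3 → ℂ) →ₗ[ℂ] (Fin 3 → ℂ) where
  toFun y := ![2 * x 1 * y 0 - 2 * x 0 * y 1, x 0 * y 2 - x 2 * y 0, 2 * x 2 * y 1 - 2 * x 1 * y 2]
  map_add' y z := by
    ext k; fin_cases k <;> simp <;> ring
  map_smul' c y := by
    ext k; fin_cases k <;> simp <;> ring

/-- The Lie bracket of `𝔰𝔩₂` as the bracket of vector fields `p d/dt` on the line. -/
theorem quad_br (x y : Fin 3 → ℂ) :
    quad (br x y) = quad x * derivative (quad y) - derivative (quad x) * quad y := by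
  simp only [quad, br, LinearMap.coe_mk, AddHom.coe_mk, Matrix.cons_val_zero, Matrix.cons_val_one,
    Matrix.cons_val, derivative_mul, derivative_C, derivative_X, derivative_X_pow,
    map_sub, map_mul]
  simp only [map_ofNat, Nat.cast_ofNat]
  ring

theorem natDegree_quad_pow (y : Fin 3 → ℂ) (j : ℕ) : (quad y ^ j).natDegree ≤ 2 * j := by
  have h : (quad y).natDegree ≤ 2 := by unfold quad; compute_degree
  exact natDegree_pow_le.trans (by nlinarith)

/-- The flow of the linear vector field `y ↦ [x, y]`. -/
theorem exists_flow (x y : Fin 3 → ℂ) : ∃ Y : ℂ → Fin 3 → ℂ, Y 0 = y ∧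
    ∀ s k, HasDerivAt (fun s => Y s k) (br x (Y s) k) s := by
  let A : (Fin 3 → ℂ) →L[ℂ] (Fin 3 → ℂ) := LinearMap.toContinuousLinearMap (br x)
  refine ⟨fun s => NormedSpace.exp (s • A) y, ?_, fun s k => ?_⟩
  · change NormedSpace.exp ((0 : ℂ) • A) y = y
    rw [zero_smul ℂ A, NormedSpace.exp_zero]
    rfl
  have h1 := (hasDerivAt_exp_smul_const' (𝕂 := ℂ) A s).clm_apply (hasDerivAt_const s y)
  have h2 := hasDerivAt_pi.1 h1 k
  simpa [A] using h2

theorem hasDerivAt_coeff_mul {P R : ℂ → ℂ[X]} {P' R' : ℂ[X]} {s : ℂ}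
    (hP : ∀ k, HasDerivAt (fun s => (P s).coeff k) (P'.coeff k) s)
    (hR : ∀ k, HasDerivAt (fun s => (R s).coeff k) (R'.coeff k) s) (k : ℕ) :
    HasDerivAt (fun s => (P s * R s).coeff k) ((P' * R s + P s * R').coeff k) s := by
  simp only [coeff_mul, coeff_add, ← Finset.sum_add_distrib]
  exact HasDerivAt.fun_sum fun x _ => (hP x.1).mul (hR x.2)

theorem hasDerivAt_coeff_pow {P : ℂ → ℂ[X]} {P' : ℂ[X]} {s : ℂ}
    (hP : ∀ k, HasDerivAt (fun s => (P s).coeff k) (P'.coeff k) s) (j k : ℕ) :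
    HasDerivAt (fun s => (P s ^ j).coeff k) (((j : ℂ[X]) * P s ^ (j - 1) * P').coeff k) s := by
  induction j generalizing k with
  | zero => simpa using hasDerivAt_const s _
  | succ j ih =>
    simp only [pow_succ]
    have h := hasDerivAt_coeff_mul ih hP k
    refine h.congr_deriv ?_
    congr 1
    rcases j with _ | j
    · simp
    · simp only [Nat.add_sub_cancel, pow_succ]
      push_cast
      ring

theorem hasDerivAt_coeff_quad {Y : ℂ → Fin 3 → ℂ} {y' : Fin 3 → ℂ} {s : ℂ}
    (hY : ∀ k, HasDerivAt (fun s => Y s k) (y' k) s) (k : ℕ) :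
    HasDerivAt (fun s => (quad (Y s)).coeff k) ((quad y').coeff k) s := by
  simp only [quad, coeff_sub, coeff_C_mul, coeff_C]
  refine HasDerivAt.sub (HasDerivAt.sub ?_ (((hY 1).const_mul 2).mul_const _))
    ((hY 2).mul_const _)
  split_ifs
  exacts [hY 0, hasDerivAt_const s _]

variable {𝔤 : Type*} [LieRing 𝔤] [LieAlgebra ℂ 𝔤]
variable {V : Type*} [AddCommGroup V] [Module ℂ V] [LieRingModule 𝔤 V] [LieModule ℂ 𝔤 V]
variable {h e f : 𝔤} {j : ℕ} {u : V}

/-- The vectors of the standard basis of the irreducible module with highest weight `2j`,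
normalized so as to correspond to the monomials `t ^ k`. -/
def stdVec (f : 𝔤) (j : ℕ) (u : V) (k : ℕ) : V :=
  (((2 * j - k).factorial : ℂ) / (2 * j).factorial) • (toEnd ℂ 𝔤 V f ^ k) u

/-- The map from polynomials of degree at most `2j` to the module with highest weight `2j`. -/
def ofPoly (f : 𝔤) (j : ℕ) (u : V) : ℂ[X] →ₗ[ℂ] V where
  toFun p := ∑ k ∈ Finset.range (2 * j + 1), p.coeff k • stdVec f j u k
  map_add' p q := by simp [add_smul, Finset.sum_add_distrib]
  map_smul' c p := by simp [mul_smul, Finset.smul_sum]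

theorem ofPoly_X_pow {k : ℕ} (hk : k ≤ 2 * j) : ofPoly f j u (X ^ k) = stdVec f j u k := by
  change ∑ l ∈ Finset.range (2 * j + 1), _ = _
  rw [Finset.sum_eq_single k]
  · simp
  · intro l _ hl; simp [coeff_X_pow, hl]
  · intro hk'; exact absurd (Finset.mem_range.2 (by omega)) hk'

theorem ofPoly_X_pow_of_lt {k : ℕ} (hk : 2 * j < k) : ofPoly f j u (X ^ k) = 0 := by
  change ∑ l ∈ Finset.range (2 * j + 1), _ = _
  refine Finset.sum_eq_zero fun l hl => ?_
  have := Finset.mem_range.1 hl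
  rw [coeff_X_pow, if_neg (by omega), zero_smul]

variable (t : IsSl2Triple h e f) (P : t.HasPrimitiveVectorWith u ((2 * j : ℕ) : ℂ))
  (hf : (toEnd ℂ 𝔤 V f ^ (2 * j + 1)) u = 0)

include P in
theorem lie_h_stdVec (k : ℕ) :
    ⁅h, stdVec f j u k⁆ = (2 * j - 2 * k : ℂ) • stdVec f j u k := by
  rw [stdVec, lie_smul, P.lie_h_pow_toEnd_f, smul_comm]
  push_cast
  rfl

include P in
theorem lie_e_stdVec {k : ℕ} (hk : k + 1 ≤ 2 * j) :
    ⁅e, stdVec f j u (k + 1)⁆ = (k + 1 : ℂ) • stdVec f j u k := by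
  have h1 : 2 * j - k = (2 * j - (k + 1)) + 1 := by omega
  have h2 : ((2 * j - (k + 1) : ℕ) : ℂ) = 2 * j - (k + 1) := by
    rw [Nat.cast_sub hk]; push_cast; rfl
  rw [stdVec, stdVec, lie_smul, P.lie_e_pow_succ_toEnd_f, smul_smul, smul_smul, h1,
    Nat.factorial_succ]
  congr 1
  push_cast [h2]
  ring

include hf in
theorem lie_f_ofPoly {k : ℕ} (hk : k ≤ 2 * j) :
    ⁅f, stdVec f j u k⁆ = (2 * j - k : ℂ) • ofPoly f j u (X ^ (k + 1)) := by
  rcases hk.lt_or_eq with hk | rfl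
  · have h1 : 2 * j - k = (2 * j - (k + 1)) + 1 := by omega
    have h2 : ((2 * j - (k + 1) : ℕ) : ℂ) = 2 * j - (k + 1) := by
      rw [Nat.cast_sub hk]; push_cast; rfl
    rw [ofPoly_X_pow hk, stdVec, stdVec, lie_smul, ← pow_toEnd_succ, smul_smul, h1,
      Nat.factorial_succ]
    congr 1
    push_cast [h2]
    ring
  · rw [stdVec, lie_smul, ← pow_toEnd_succ, hf, smul_zero, ofPoly_X_pow_of_lt (by omega),
      smul_zero]

include P hf in
/-- The action of `𝔰𝔩₂` on polynomials of degree at most `2j` by differential operators. -/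
theorem lie_ofPoly (x : Fin 3 → ℂ) (p : ℂ[X]) (hp : p.natDegree ≤ 2 * j) :
    ⁅x 0 • e + x 1 • h + x 2 • f, ofPoly f j u p⁆ =
      ofPoly f j u (quad x * derivative p - (j : ℂ[X]) * derivative (quad x) * p) := by
  have hmon : ∀ k ≤ 2 * j, ⁅x 0 • e + x 1 • h + x 2 • f, ofPoly f j u (X ^ k)⁆ =
      ofPoly f j u (quad x * derivative (X ^ k) - (j : ℂ[X]) * derivative (quad x) * X ^ k) := fun k hk => by
    have h1 : quad x * derivative (X ^ k) - (j : ℂ[X]) * derivative (quad x) * X ^ k =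
        (x 0 * k) • X ^ (k - 1) + ((2 * j - 2 * k) * x 1) • X ^ k +
          ((2 * j - k) * x 2) • X ^ (k + 1) := by
      simp only [quad, derivative_mul, derivative_C, derivative_X, derivative_X_pow,
        smul_eq_C_mul, map_sub, map_mul, map_natCast]
      rcases k with _ | k
      · simp only [map_ofNat, Nat.cast_ofNat, Nat.cast_zero]; ring
      · simp only [Nat.add_sub_cancel, map_ofNat, Nat.cast_ofNat]; ring
    rw [h1]
    simp only [map_add, map_smul, add_lie, smul_lie]
    rw [ofPoly_X_pow hk, lie_h_stdVec t P, lie_f_ofPoly hf hk]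
    have h2 : ⁅e, stdVec f j u k⁆ = (k : ℂ) • ofPoly f j u (X ^ (k - 1)) := by
      rcases k with _ | k
      · simp [stdVec, P.lie_e]
      · rw [lie_e_stdVec t P hk, Nat.add_sub_cancel, ofPoly_X_pow (by omega)]
        push_cast; rfl
    rw [h2]
    module
  rw [p.as_sum_range' (2 * j + 1) (by omega)]
  simp only [← C_mul_X_pow_eq_monomial, ← smul_eq_C_mul, map_sum, map_smul, lie_sum, lie_smul,
    Finset.mul_sum, mul_smul_comm, ← Finset.sum_sub_distrib, ← smul_sub]
  refine Finset.sum_congr rfl fun k hk => ?_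
  rw [hmon k (by have := Finset.mem_range.1 hk; omega)]

end BinaryForms

section Reflections

open LieModule Polynomial

variable {n r : ℕ} {G : Subgroup (GL (Fin n) ℂ)}
  {𝔤 : LieSubalgebra ℂ (Matrix (Fin n) (Fin n) ℂ)} (h𝔤 : IsLieAlgebraOf 𝔤 G)
  {𝔱 : LieSubalgebra ℂ 𝔤} [IsLieAbelian 𝔱] (D : SimpleRoots 𝔱 r)
variable {V : Type*} [AddCommGroup V] [Module ℂ V] [LieRingModule 𝔤 V] [LieModule ℂ 𝔤 V]
variable {ρ : Representation ℂ G V} (hdiff : IsDifferential 𝔤 ρ)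

namespace SimpleRoots

/-- The element of `𝔤_i` with the given coordinates relative to `E_i`, `H_i`, `F_i`. -/
def ofCoord (i : Fin r) (y : Fin 3 → ℂ) : 𝔤 :=
  y 0 • D.E i + y 1 • (D.H i : 𝔤) + y 2 • D.F i

theorem lie_ofCoord (i : Fin r) (x y : Fin 3 → ℂ) :
    ⁅D.ofCoord i x, D.ofCoord i y⁆ = D.ofCoord i (br x y) := by
  have hE := (D.sl2Triple i).lie_h_e_smul ℂ
  have hF := (D.sl2Triple i).lie_lie_smul_f ℂ
  have hH := D.lie_E_F i
  have hE' : ⁅D.E i, (D.H i : 𝔤)⁆ = -((2 : ℂ) • D.E i) := by rw [← lie_skew, hE]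
  have hF' : ⁅D.F i, (D.H i : 𝔤)⁆ = (2 : ℂ) • D.F i := by rw [← lie_skew, hF, neg_neg]
  have hH' : ⁅D.F i, D.E i⁆ = -(D.H i : 𝔤) := by rw [← lie_skew, hH]
  simp only [ofCoord, br, add_lie, lie_add, smul_lie, lie_smul, lie_self, hE, hF, hH, hE', hF', hH',
    LinearMap.coe_mk, AddHom.coe_mk, Matrix.cons_val_zero, Matrix.cons_val_one, Matrix.cons_val]
  module

theorem ofCoord_injective (i : Fin r) : Function.Injective (D.ofCoord i) := fun x y hxy => by
  have h0 : ∀ z : Fin 3 → ℂ, D.ofCoord i z = 0 → z = 0 := fun z hz => by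
    have hli : LinearIndependent ℂ ![D.E i, (D.H i : 𝔤), D.F i] := by
      refine Module.End.eigenvectors_linearIndependent' (LieAlgebra.ad ℂ 𝔤 (D.H i : 𝔤))
        ![2, 0, -2] ?_ _ fun k => ⟨?_, ?_⟩
      · intro a b hab
        fin_cases a <;> fin_cases b <;> simp at hab ⊢ <;> norm_num at hab
      · rw [Module.End.mem_genEigenspace_one]
        fin_cases k
        · exact (D.sl2Triple i).lie_h_e_smul ℂ
        · simp
        · simpa using (D.sl2Triple i).lie_lie_smul_f ℂ
      · fin_cases k
        exacts [(D.sl2Triple i).e_ne_zero, (D.sl2Triple i).h_ne_zero, (D.sl2Triple i).f_ne_zero]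
    refine funext (Fintype.linearIndependent_iff.1 hli z ?_)
    rw [Fin.sum_univ_three]
    exact hz
  rw [← sub_eq_zero]
  refine h0 _ ?_
  rw [← sub_eq_zero] at hxy
  rw [← hxy]
  simp only [ofCoord, Pi.sub_apply]
  module

/-- The equivariant map `q : 𝔤_i → V`, `aE + bH + cF ↦ (a - 2bt - ct²) ^ j`, attached to a
primitive vector `u` of weight `2j`. -/
def powForm (i : Fin r) (j : ℕ) (u : V) (y : Fin 3 → ℂ) : V := ofPoly (D.F i) j u (quad y ^ j)

variable {i : Fin r} {j : ℕ} {u : V}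
  (P : (D.sl2Triple i).HasPrimitiveVectorWith u ((2 * j : ℕ) : ℂ))
  (hF : (toEnd ℂ 𝔤 V (D.F i) ^ (2 * j + 1)) u = 0)

include P hF hdiff in
/-- Equivariance of `powForm` under one-parameter subgroups: both `powForm` and the coordinates in `𝔤_i`
follow the flow of the vector field `y ↦ [x, y]`. -/
theorem rho_expG_powForm (x y : Fin 3 → ℂ) : ∃ y',
    ρ (expG h𝔤 (D.ofCoord i x) 1) (D.powForm i j u y) = D.powForm i j u y' ∧
      Ad h𝔤 (expG h𝔤 (D.ofCoord i x) 1) (D.ofCoord i y) = D.ofCoord i y' := by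
  obtain ⟨Y, rfl, hY⟩ := exists_flow x y
  refine ⟨Y 1, ?_, ?_⟩
  · refine rho_exp_of_hasDerivAt h𝔤 hdiff (D.ofCoord i x) (2 * j + 1) (stdVec (D.F i) j u)
      (fun k s => (quad (Y s) ^ j).coeff k)
      (fun k s => ((j : ℂ[X]) * quad (Y s) ^ (j - 1) * quad (br x (Y s))).coeff k)
      (fun k s => hasDerivAt_coeff_pow (hasDerivAt_coeff_quad (hY s)) j k) fun s => ?_
    refine Eq.trans ?_ (lie_ofPoly (D.sl2Triple i) P hF x _ (natDegree_quad_pow (Y s) j)).symm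
    change ofPoly (D.F i) j u _ = _
    congr 1
    rw [quad_br, derivative_pow]
    rcases j with _ | j
    · simp
    · simp only [Nat.add_sub_cancel, map_natCast, pow_succ]
      ring
  · have h1 := rho_exp_of_hasDerivAt h𝔤 (isDifferential_AdRep h𝔤) (D.ofCoord i x) 3
      (fun k => if k = 0 then D.E i else if k = 1 then (D.H i : 𝔤) else D.F i)
      (fun k s => Y s (Fin.ofNat 3 k)) (fun k s => br x (Y s) (Fin.ofNat 3 k))
      (fun k s => hY s _) fun s => by
        have h2 := D.lie_ofCoord i x (Y s)
        simp only [Finset.sum_range_succ, Finset.sum_range_zero, zero_add]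
        exact h2.symm
    simp only [Finset.sum_range_succ, Finset.sum_range_zero, zero_add] at h1
    exact h1

include P hF hdiff in
/-- The map `powForm` is equivariant relative to the connected subgroup with Lie algebra `𝔤_i`. -/
theorem rho_powForm {g : GL (Fin n) ℂ}
    (hg : g ∈ connectedSubgroup
      ((fun X : 𝔤 => (X : Matrix (Fin n) (Fin n) ℂ)) '' (D.sl2 i : Set 𝔤))) :
    ∃ hG : g ∈ G, ∀ y, ∃ y', ρ ⟨g, hG⟩ (D.powForm i j u y) = D.powForm i j u y' ∧
      Ad h𝔤 ⟨g, hG⟩ (D.ofCoord i y) = D.ofCoord i y' := by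
  have hgen : ∀ X ∈ D.sl2 i, ∀ y, ∃ y',
      ρ (expG h𝔤 X 1) (D.powForm i j u y) = D.powForm i j u y' ∧
        Ad h𝔤 (expG h𝔤 X 1) (D.ofCoord i y) = D.ofCoord i y' := fun X hX y => by
    obtain ⟨a, b, c, rfl⟩ := D.exists_of_mem_sl2 hX
    exact D.rho_expG_powForm h𝔤 hdiff P hF ![a, b, c] y
  refine (?_ : _ ∧ ∃ hG : g⁻¹ ∈ G, ∀ y, ∃ y',
    ρ ⟨g⁻¹, hG⟩ (D.powForm i j u y) = D.powForm i j u y' ∧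
      Ad h𝔤 ⟨g⁻¹, hG⟩ (D.ofCoord i y) = D.ofCoord i y').1
  have hmul : ∀ (a b : G) (y : Fin 3 → ℂ),
      (∀ y, ∃ y', ρ a (D.powForm i j u y) = D.powForm i j u y' ∧
        Ad h𝔤 a (D.ofCoord i y) = D.ofCoord i y') →
      (∀ y, ∃ y', ρ b (D.powForm i j u y) = D.powForm i j u y' ∧
        Ad h𝔤 b (D.ofCoord i y) = D.ofCoord i y') →
      ∃ y', ρ (a * b) (D.powForm i j u y) = D.powForm i j u y' ∧
        Ad h𝔤 (a * b) (D.ofCoord i y) = D.ofCoord i y' := fun a b y ha hb => by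
    obtain ⟨y', h1, h2⟩ := hb y
    obtain ⟨y'', h3, h4⟩ := ha y'
    refine ⟨y'', ?_, ?_⟩
    · rw [map_mul, Module.End.mul_apply, h1, h3]
    · rw [← AdRep_apply, map_mul, Module.End.mul_apply, AdRep_apply, AdRep_apply, h2, h4]
  induction hg using Subgroup.closure_induction with
  | mem g hg =>
    obtain ⟨_, ⟨X, hX, rfl⟩, hgX⟩ := hg
    have h1 : g = expG h𝔤 X 1 := Units.ext (by rw [hgX, coe_expG, one_smul])
    have h2 : g⁻¹ = expG h𝔤 (-X) 1 := by rw [expG_neg_left, h1]; rfl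
    rw [h2, h1]
    exact ⟨⟨Subtype.property _, hgen X hX⟩, ⟨Subtype.property _, hgen _ (neg_mem hX)⟩⟩
  | one =>
    have h1 : ∀ y, ∃ y', ρ (1 : G) (D.powForm i j u y) = D.powForm i j u y' ∧
        Ad h𝔤 (1 : G) (D.ofCoord i y) = D.ofCoord i y' := fun y =>
      ⟨y, by rw [map_one, Module.End.one_apply],
        by rw [← AdRep_apply, map_one, Module.End.one_apply]⟩
    rw [inv_one]
    exact ⟨⟨G.one_mem, h1⟩, ⟨G.one_mem, h1⟩⟩
  | mul a b _ _ ha hb =>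
    obtain ⟨⟨ha, ha'⟩, ⟨hai, hai'⟩⟩ := ha
    obtain ⟨⟨hb, hb'⟩, ⟨hbi, hbi'⟩⟩ := hb
    rw [mul_inv_rev]
    exact ⟨⟨G.mul_mem ha hb, fun y => hmul ⟨a, ha⟩ ⟨b, hb⟩ y ha' hb'⟩,
      ⟨G.mul_mem hbi hai, fun y => hmul ⟨_, hbi⟩ ⟨_, hai⟩ y hbi' hai'⟩⟩
  | inv a _ ha =>
    rw [inv_inv]
    exact ha.symm

end SimpleRoots

open SimpleRoots in
/-- A representative of `s_i` in the connected subgroup with Lie algebra `𝔤_i` acts by `(-1) ^ j`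
on the zero weight space of the `(2j + 1)`-dimensional irreducible `𝔤_i`-modules. -/
theorem rho_reflection {i : Fin r} {g : G}
    (hE : ∀ v : V, ∃ k, (toEnd ℂ 𝔤 V (D.E i) ^ k) v = 0)
    (hF : ∀ v : V, ∃ k, (toEnd ℂ 𝔤 V (D.F i) ^ k) v = 0)
    (hdiff : IsDifferential 𝔤 ρ)
    (hg : (g : GL (Fin n) ℂ) ∈ connectedSubgroup
      ((fun X : 𝔤 => (X : Matrix (Fin n) (Fin n) ℂ)) '' (D.sl2 i : Set 𝔤)))
    (hg' : ∀ h : 𝔱, Ad h𝔤 g (h : 𝔤) = (D.s i h : 𝔤))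
    {v : V} (hv : ⁅(D.H i : 𝔤), v⁆ = 0) {j : ℕ} (hj : ⁅D.F i, ⁅D.E i, v⁆⁆ = casimirValue j • v) :
    ρ g v = (-1 : ℂ) ^ j • v := by
  by_cases hv0 : v = 0
  · simp [hv0]
  obtain ⟨P, c, hc, hcv⟩ := primitive_of_casimir (D.sl2Triple i) hE hv0 hv hj
  obtain ⟨m, hm, hm'⟩ := exists_nat_of_primitive P (hF _)
  rw [← Nat.cast_injective hm] at hm'
  obtain ⟨hG, h1⟩ := D.rho_powForm h𝔤 hdiff P hm' hg
  obtain ⟨y', h2, h3⟩ := h1 ![0, 1, 0]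
  have h4 : y' = -![0, 1, 0] := by
    apply D.ofCoord_injective i
    rw [← h3]
    have := hg' (D.H i)
    simp [ofCoord, s, D.α_H] at this ⊢
    rw [this]
    module
  set u := (toEnd ℂ 𝔤 V (D.E i) ^ j) v with hu
  have h5 : ∀ z : ℂ, D.powForm i j u ![0, z, 0] = ((-2 * z) ^ j * (j.factorial /
      (2 * j).factorial) * c) • v := fun z => by
    have h6 : quad ![0, z, 0] ^ j = ((-2 * z) ^ j : ℂ) • X ^ j := by
      have h7 : quad ![0, z, 0] = C (-2 * z) * X := by simp [quad]
      rw [h7, mul_pow, ← C_pow, smul_eq_C_mul]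
    have h7 : 2 * j - j = j := by omega
    rw [powForm, h6, map_smul, ofPoly_X_pow (by omega), stdVec, hcv, h7, smul_smul, smul_smul]
  have h8 : -![0, 1, 0] = (![0, -1, 0] : Fin 3 → ℂ) := by simp
  rw [h4, h8, h5, h5, map_smul] at h2
  have h9 : ((-2 * 1 : ℂ) ^ j * (j.factorial / (2 * j).factorial) * c) ≠ 0 := by
    have ha : (j.factorial : ℂ) ≠ 0 := Nat.cast_ne_zero.2 j.factorial_ne_zero
    have hb : ((2 * j).factorial : ℂ) ≠ 0 := Nat.cast_ne_zero.2 (2 * j).factorial_ne_zero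
    exact mul_ne_zero (mul_ne_zero (pow_ne_zero _ (by norm_num)) (div_ne_zero ha hb)) hc
  refine smul_right_injective V h9 (h2.trans ?_)
  change _ = _ • _ • v
  rw [smul_smul]
  congr 1
  rw [show (-2 * -1 : ℂ) = (-1) * (-2 * 1) by ring, mul_pow]
  ring

end Reflections

/-! ### Summation identities -/

section Sums

variable {R : Type*} [CommRing R]

/-- The Chu–Vandermonde identity for rising factorials. -/
theorem sum_choose_mul_rising (a b : R) (j : ℕ) :
    ∑ p ∈ Finset.HasAntidiagonal.antidiagonal j, (j.choose p.1 : R) *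
      ((∏ l ∈ Finset.range p.1, (a + l)) * ∏ l ∈ Finset.range p.2, (b + l)) =
      ∏ l ∈ Finset.range j, (a + b + l) := by
  induction j with
  | zero => simp
  | succ j ih =>
    rw [Finset.sum_antidiagonal_choose_succ_mul (fun x y =>
      (∏ l ∈ Finset.range x, (a + l)) * ∏ l ∈ Finset.range y, (b + l)), Finset.prod_range_succ,
      ← ih, ← Finset.sum_add_distrib, Finset.sum_mul]
    refine Finset.sum_congr rfl fun p hp => ?_
    have h1 : (j : R) = p.1 + p.2 := by rw [← Finset.HasAntidiagonal.mem_antidiagonal.1 hp]; push_cast; rfl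
    have h2 : j.choose p.2 = j.choose p.1 := by
      rw [← Finset.HasAntidiagonal.mem_antidiagonal.1 hp, Nat.choose_symm_add]
    rw [Finset.prod_range_succ, Finset.prod_range_succ, h1, h2]
    ring

variable {W : Type*} [AddCommGroup W] [Module R W] {c : ℕ → R} {x : R}
  (hc : ∀ k : ℕ, c k = (k + 1) * (x - k) * c (k + 1))
include hc

/-- The telescoping sum by which `ξ_i` vanishes on `E_i M`; `x` and `c k` stand for `H_i` and the
coefficients of the series, and the terms with `g (k - 1)` and `g (k - 2)` for small `k` have
coefficient zero. -/
theorem sum_raising (g : ℕ → W) (n : ℕ) :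
    ∑ k ∈ Finset.range (n + 1), c k • (g k - (k * (x - 2 * k)) • g (k - 1) -
      ((k : R) ^ 2 * (k - 1) * (x - k + 1)) • g (k - 2)) =
      c n • g n + ((n + 1) * n * c n) • g (n - 1) := by
  induction n with
  | zero => simp
  | succ n ih =>
    rw [Finset.sum_range_succ, ih, hc n, Nat.add_sub_cancel, show n + 1 - 2 = n - 1 by omega]
    push_cast
    module

/-- The telescoping sum by which `ξ_i` vanishes on `M F_i`. -/
theorem sum_lowering (g : ℕ → W) (n : ℕ) :
    ∑ k ∈ Finset.range (n + 1), c k • ((k * (x - k + 1)) • g (k - 1) - g k) = -(c n • g n) := by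
  induction n with
  | zero => simp
  | succ n ih =>
    rw [Finset.sum_range_succ, ih, hc n, Nat.add_sub_cancel]
    push_cast
    module

/-- The telescoping sum which describes `ξ_i` on `h M` for `h ∈ 𝔱`, with `y = h` and `z = α_i(h)`. -/
theorem sum_weight (y z : R) (g : ℕ → W) (n : ℕ) :
    ∑ k ∈ Finset.range (n + 1), c k • ((y - k * z) • g k +
      (k * z * (k * (x - k + 1))) • g (k - 1)) =
      (y + z) • (∑ k ∈ Finset.range (n + 1), c k • g k) - ((n + 1) * z * c n) • g n := by
  induction n with
  | zero => simp; module
  | succ n ih =>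
    rw [Finset.sum_range_succ, ih, Finset.sum_range_succ _ (n + 1), hc n, Nat.add_sub_cancel]
    push_cast
    module

end Sums

/-! ### The Zhelobenko operators -/

section Zhelobenko

open LieModule

variable {𝔤 : Type*} [LieRing 𝔤] [LieAlgebra ℂ 𝔤] {𝔱 : LieSubalgebra ℂ 𝔤} [IsLieAbelian 𝔱]
variable {r : ℕ} (D : SimpleRoots 𝔱 r)
variable {V : Type*} [AddCommGroup V] [Module ℂ V] [LieRingModule 𝔤 V] [LieModule ℂ 𝔤 V]

theorem lAct_eq_ad_add_rAct (X : 𝔤) (m : M 𝔤 V) : lAct V X m = ad V X m + rAct V X m := by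
  simp [ad]

theorem ad_lAct (X Y : 𝔤) (m : M 𝔤 V) :
    ad V X (lAct V Y m) = lAct V Y (ad V X m) + lAct V ⁅X, Y⁆ m := by
  simp only [ad, LinearMap.sub_apply, lAct_lAct V X Y m, map_sub, lAct_rAct]
  abel

theorem ad_rAct (X Y : 𝔤) (m : M 𝔤 V) :
    ad V X (rAct V Y m) = rAct V Y (ad V X m) + rAct V ⁅X, Y⁆ m := by
  rw [ad, LinearMap.sub_apply, LinearMap.sub_apply, map_sub, lAct_rAct, rAct_rAct V X Y m]
  abel

theorem lAct_smul_left (c : ℂ) (X : 𝔤) (m : M 𝔤 V) : lAct V (c • X) m = c • lAct V X m := by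
  have : lAct V (c • X) = c • lAct V X := by
    apply TensorProduct.ext'
    intro u v
    simp [lAct_tmul, ι, TensorProduct.smul_tmul']
  rw [this]; rfl

theorem lAct_add_left (X Y : 𝔤) (m : M 𝔤 V) : lAct V (X + Y) m = lAct V X m + lAct V Y m := by
  have : lAct V (X + Y) = lAct V X + lAct V Y := by
    apply TensorProduct.ext'
    intro u v
    simp [lAct_tmul, ι, add_mul, TensorProduct.add_tmul]
  rw [this]; rfl

theorem rAct_smul_left (c : ℂ) (X : 𝔤) (m : M 𝔤 V) : rAct V (c • X) m = c • rAct V X m := by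
  have : rAct V (c • X) = c • rAct V X := by
    apply TensorProduct.ext'
    intro u v
    simp [rAct_tmul, ι, TensorProduct.smul_tmul', smul_sub]
  rw [this]; rfl

theorem rAct_add_left (X Y : 𝔤) (m : M 𝔤 V) : rAct V (X + Y) m = rAct V X m + rAct V Y m := by
  have : rAct V (X + Y) = rAct V X + rAct V Y := by
    apply TensorProduct.ext'
    intro u v
    simp only [rAct_tmul, ι, map_add, mul_add, TensorProduct.add_tmul, add_lie,
      TensorProduct.tmul_add, LinearMap.add_apply]
    abel
  rw [this]; rfl

theorem pow_apply_apply {W : Type*} [AddCommGroup W] [Module ℂ W] (f : W →ₗ[ℂ] W) (k : ℕ)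
    (w : W) : (f ^ k) (f w) = (f ^ (k + 1)) w := by
  rw [pow_succ, Module.End.mul_apply]

theorem pow_lAct_rAct (X Y : 𝔤) (k : ℕ) (m : M 𝔤 V) :
    (lAct V X ^ k) (rAct V Y m) = rAct V Y ((lAct V X ^ k) m) := by
  induction k with
  | zero => rfl
  | succ k ih => rw [pow_succ', Module.End.mul_apply, ih, lAct_rAct]; rfl

theorem pow_ad_rAct (X : 𝔤) (k : ℕ) (m : M 𝔤 V) :
    (ad V X ^ k) (rAct V X m) = rAct V X ((ad V X ^ k) m) := by
  induction k with
  | zero => rfl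
  | succ k ih =>
    rw [pow_succ', Module.End.mul_apply, ih, ad_rAct, lie_self, Module.End.mul_apply]
    have : rAct V (0 : 𝔤) ((ad V X ^ k) m) = 0 := by
      have := rAct_smul_left (V := V) 0 X ((ad V X ^ k) m)
      rwa [zero_smul, zero_smul] at this
    rw [this, add_zero]

namespace SimpleRoots

variable (i : Fin r)

/-- The composite `M → Z → Z̄`. -/
def toBar : M 𝔤 V →ₗ[U 𝔱] D.Zbar V := D.toZbar V ∘ₗ (D.J V).mkQ

/-- The image of an element of `U(𝔱)` in the ring of fractions. -/
abbrev frac : U 𝔱 →+* Localization (denominators 𝔱) := algebraMap _ _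

theorem frac_smul_toBar (a : U 𝔱) (m : M 𝔤 V) : frac a • D.toBar m = D.toBar (a • m) := by
  rw [map_smul, algebraMap_smul]

theorem toBar_smul (c : ℂ) (m : M 𝔤 V) :
    D.toBar (c • m) = frac (algebraMap ℂ (U 𝔱) c) • D.toBar m := by
  rw [frac_smul_toBar, algebraMap_smul]

theorem toBar_lAct_cartan (h : 𝔱) (m : M 𝔤 V) :
    D.toBar (lAct V (h : 𝔤) m) = frac (ι h) • D.toBar m := by
  rw [frac_smul_toBar, ι_smul]

theorem toBar_eq_zero {m : M 𝔤 V} (hm : m ∈ D.J V) : D.toBar m = 0 := by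
  rw [toBar, LinearMap.comp_apply, Submodule.mkQ_apply, (Submodule.Quotient.mk_eq_zero _).2 hm,
    map_zero]

theorem toBar_lAct {X : 𝔤} (hX : X ∈ D.nMinus) (m : M 𝔤 V) : D.toBar (lAct V X m) = 0 :=
  D.toBar_eq_zero (Submodule.subset_span (Or.inl ⟨X, hX, m, rfl⟩))

theorem toBar_rAct {X : 𝔤} (hX : X ∈ D.nPlus) (m : M 𝔤 V) : D.toBar (rAct V X m) = 0 :=
  D.toBar_eq_zero (Submodule.subset_span (Or.inr ⟨X, hX, m, rfl⟩))

/-- The coefficient `(k! H_i (H_i - 1) ⋯ (H_i - k + 1))⁻¹`. -/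
def coef (k : ℕ) : Localization (denominators 𝔱) :=
  Localization.mk (algebraMap ℂ (U 𝔱) (k.factorial : ℂ)⁻¹) (D.den i k)

theorem factorial_mul_den_mul_coef (k : ℕ) :
    (k.factorial : Localization (denominators 𝔱)) * frac (D.den i k : U 𝔱) * D.coef i k = 1 := by
  have h1 : (k.factorial : Localization (denominators 𝔱)) =
      Localization.mk (algebraMap ℂ (U 𝔱) k.factorial) 1 := by
    rw [Localization.mk_one_eq_algebraMap, map_natCast, map_natCast]
  rw [coef, h1, ← Localization.mk_one_eq_algebraMap, Localization.mk_mul, Localization.mk_mul,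
    mul_one, one_mul, mul_right_comm, ← map_mul,
    mul_inv_cancel₀ (Nat.cast_ne_zero.2 k.factorial_ne_zero), map_one, one_mul,
    Localization.mk_self]

theorem den_succ (k : ℕ) :
    frac (D.den i (k + 1) : U 𝔱) = frac (D.den i k : U 𝔱) * (frac (ι (D.H i)) - k) := by
  change frac (∏ l ∈ Finset.range (k + 1), (ι (D.H i) - (l : U 𝔱))) = _
  rw [Finset.prod_range_succ, map_mul, map_sub, map_natCast]
  rfl

/-- The recursion `c_k = (k + 1) (H_i - k) c_{k+1}` of the coefficients, on which all telescoping rests. -/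
theorem coef_eq (k : ℕ) :
    D.coef i k = (k + 1) * (frac (ι (D.H i)) - k) * D.coef i (k + 1) := by
  have h1 := D.factorial_mul_den_mul_coef i (k + 1)
  have h2 := D.factorial_mul_den_mul_coef i k
  rw [den_succ, Nat.factorial_succ] at h1
  push_cast at h1
  linear_combination (-D.coef i k) * h1 +
    ((k + 1) * (frac (ι (D.H i)) - k) * D.coef i (k + 1)) * h2

theorem toBar_pow_lAct_cartan (h : 𝔱) (k : ℕ) (m : M 𝔤 V) :
    D.toBar ((lAct V (D.E i) ^ k) (lAct V (h : 𝔤) m)) =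
      (frac (ι h) - k * frac (algebraMap ℂ (U 𝔱) (D.α i h))) •
        D.toBar ((lAct V (D.E i) ^ k) m) := by
  induction k generalizing m with
  | zero => simp [toBar_lAct_cartan]
  | succ k ih =>
    rw [pow_succ, Module.End.mul_apply, Module.End.mul_apply, lAct_lAct, ← lie_skew, D.lie_E,
      ← neg_smul, lAct_smul_left, map_add, map_add, ih, map_smul, toBar_smul, map_neg,
      map_neg]
    push_cast
    rw [← add_smul]
    congr 1
    ring

theorem toBar_pow_lAct_H (k : ℕ) (m : M 𝔤 V) :
    D.toBar ((lAct V (D.E i) ^ k) (lAct V (D.H i : 𝔤) m)) =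
      (frac (ι (D.H i)) - 2 * k) • D.toBar ((lAct V (D.E i) ^ k) m) := by
  rw [toBar_pow_lAct_cartan, D.α_H, map_ofNat, map_ofNat, mul_comm]

variable [FiniteDimensional ℂ 𝔤] [𝔱.IsCartanSubalgebra] [LieAlgebra.HasCentralRadical ℂ 𝔤]

theorem toBar_pow_lAct_F (k : ℕ) (m : M 𝔤 V) :
    D.toBar ((lAct V (D.E i) ^ k) (lAct V (D.F i) m)) =
      (k * (frac (ι (D.H i)) - k + 1)) • D.toBar ((lAct V (D.E i) ^ (k - 1)) m) := by
  induction k generalizing m with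
  | zero => simp [D.toBar_lAct (D.F_mem_nMinus i)]
  | succ k ih =>
    rw [pow_succ, Module.End.mul_apply, lAct_lAct, D.lie_E_F, map_add, map_add, ih,
      toBar_pow_lAct_H, Nat.add_sub_cancel]
    rcases k with _ | k
    · simp
    · rw [Nat.add_sub_cancel, pow_apply_apply]
      push_cast
      rw [← add_smul]
      congr 1
      ring

/-- The class in `Z̄` of `∑_k (k! H_i ⋯ (H_i - k + 1))⁻¹ E_i^k (ad F_i)^k m`. -/
def xi (m : M 𝔤 V) : D.Zbar V :=
  ∑ᶠ k : ℕ, D.coef i k • D.toBar ((lAct V (D.E i) ^ k) ((ad V (D.F i) ^ k) m))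

theorem pow_ad_eq_zero {X : 𝔤} {m : M 𝔤 V} {k N : ℕ} (hm : (ad V X ^ k) m = 0) (h : k ≤ N) :
    (ad V X ^ N) m = 0 := by
  obtain ⟨d, rfl⟩ := Nat.exists_eq_add_of_le' h
  rw [pow_add, Module.End.mul_apply, hm, map_zero]

theorem xi_eq_sum {m : M 𝔤 V} {N : ℕ} (hm : (ad V (D.F i) ^ N) m = 0) :
    D.xi i m = ∑ k ∈ Finset.range N,
      D.coef i k • D.toBar ((lAct V (D.E i) ^ k) ((ad V (D.F i) ^ k) m)) := by
  refine finsum_eq_sum_of_support_subset _ fun k hk => ?_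
  rw [Finset.coe_range, Set.mem_Iio]
  by_contra hlt
  exact hk (by beta_reduce; rw [pow_ad_eq_zero hm (not_lt.1 hlt), map_zero, map_zero, smul_zero])

theorem projBar_η {σ : M 𝔤 V →ₗ[ℂ] M 𝔤 V} {m : M 𝔤 V}
    (hm : ∃ N, (ad V (D.F i) ^ N) (σ m) = 0) : D.projBar V (D.η V i σ m) = D.xi i (σ m) := by
  obtain ⟨N, hN⟩ := hm
  have h1 : D.η V i σ m = ∑ k ∈ Finset.range N, LocalizedModule.mk
      ((k.factorial : ℂ)⁻¹ • (lAct V (D.E i) ^ k) ((ad V (D.F i) ^ k) (σ m))) (D.den i k) := by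
    refine finsum_eq_sum_of_support_subset _ fun k hk => ?_
    rw [Finset.coe_range, Set.mem_Iio]
    by_contra hlt
    exact hk (by beta_reduce; rw [pow_ad_eq_zero hN (not_lt.1 hlt), map_zero, smul_zero,
      LocalizedModule.zero_mk])
  rw [h1, map_sum, D.xi_eq_sum i hN]
  refine Finset.sum_congr rfl fun k _ => ?_
  rw [projBar, IsLocalizedModule.map_LocalizedModules, coef, toBar, LinearMap.comp_apply, toZbar,
    LocalizedModule.mkLinearMap_apply, LocalizedModule.mk_smul_mk, mul_one,
    algebraMap_smul, LinearMap.map_smul_of_tower]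

section LocallyNilpotent

variable (hA : ∀ m : M 𝔤 V, ∃ N, (ad V (D.F i) ^ N) m = 0)
include hA

theorem xi_add (x y : M 𝔤 V) : D.xi i (x + y) = D.xi i x + D.xi i y := by
  obtain ⟨a, ha⟩ := hA x
  obtain ⟨b, hb⟩ := hA y
  have ha' := pow_ad_eq_zero ha (le_max_left a b)
  have hb' := pow_ad_eq_zero hb (le_max_right a b)
  rw [D.xi_eq_sum i ha', D.xi_eq_sum i hb', D.xi_eq_sum i (N := max a b) (by
    rw [map_add, ha', hb', add_zero]), ← Finset.sum_add_distrib]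
  simp only [map_add, smul_add]

theorem xi_smul (c : ℂ) (m : M 𝔤 V) :
    D.xi i (c • m) = frac (algebraMap ℂ (U 𝔱) c) • D.xi i m := by
  obtain ⟨a, ha⟩ := hA m
  rw [D.xi_eq_sum i ha, D.xi_eq_sum i (N := a) (by rw [map_smul, ha, smul_zero]),
    Finset.smul_sum]
  refine Finset.sum_congr rfl fun k _ => ?_
  rw [map_smul, map_smul, toBar_smul, smul_comm]

omit [FiniteDimensional ℂ 𝔤] [𝔱.IsCartanSubalgebra] [LieAlgebra.HasCentralRadical ℂ 𝔤] hA in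
theorem pow_ad_mem {X : 𝔤} {N : Submodule ℂ (M 𝔤 V)} (hN : ∀ m ∈ N, ad V X m ∈ N) {m : M 𝔤 V}
    (hm : m ∈ N) (k : ℕ) : (ad V X ^ k) m ∈ N := by
  induction k with
  | zero => exact hm
  | succ k ih => rw [pow_succ', Module.End.mul_apply]; exact hN _ ih

omit hA in
/-- `ξ_i` vanishes on a subspace of `𝔫₋M + M𝔫` stable under `ad F_i` and under left
multiplication by `E_i`. -/
theorem xi_eq_zero_of_stable {N : Submodule ℂ (M 𝔤 V)} (hF : ∀ m ∈ N, ad V (D.F i) m ∈ N)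
    (hE : ∀ m ∈ N, lAct V (D.E i) m ∈ N) (hJ : ∀ m ∈ N, m ∈ D.J V) {m : M 𝔤 V} (hm : m ∈ N) :
    D.xi i m = 0 := by
  have h1 : ∀ k, ∀ m ∈ N, (lAct V (D.E i) ^ k) m ∈ N := fun k m hm => by
    induction k with
    | zero => exact hm
    | succ k ih => rw [pow_succ', Module.End.mul_apply]; exact hE _ ih
  refine finsum_eq_zero_of_forall_eq_zero fun k => ?_
  rw [D.toBar_eq_zero (hJ _ (h1 k _ (pow_ad_mem hF hm k))), smul_zero]

omit hA in
/-- Every term of the series vanishes on `X M` for `X` in `𝔫₋` off the direction of `F_i`. -/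
theorem xi_lAct_nMinusOff {X : 𝔤} (hX : X ∈ D.nMinusOff i) (m : M 𝔤 V) :
    D.xi i (lAct V X m) = 0 := by
  refine D.xi_eq_zero_of_stable i
    (N := Submodule.span ℂ {m | ∃ X ∈ D.nMinusOff i, ∃ m', m = lAct V X m'}) ?_ ?_ ?_
    (Submodule.subset_span ⟨X, hX, m, rfl⟩)
  · intro m hm
    refine (Submodule.span_le (p := (Submodule.span ℂ _).comap (ad V (D.F i)))).2 ?_ hm
    rintro _ ⟨X, hX, m, rfl⟩
    rw [SetLike.mem_coe, Submodule.mem_comap, ad_lAct]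
    exact add_mem (Submodule.subset_span ⟨X, hX, _, rfl⟩)
      (Submodule.subset_span ⟨_, D.lie_F_mem_nMinusOff i hX, _, rfl⟩)
  · intro m hm
    refine (Submodule.span_le (p := (Submodule.span ℂ _).comap (lAct V (D.E i)))).2 ?_ hm
    rintro _ ⟨X, hX, m, rfl⟩
    rw [SetLike.mem_coe, Submodule.mem_comap, lAct_lAct]
    exact add_mem (Submodule.subset_span ⟨X, hX, _, rfl⟩)
      (Submodule.subset_span ⟨_, D.lie_E_mem_nMinusOff i hX, _, rfl⟩)
  · intro m hm
    rw [mem_J]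
    refine Submodule.span_mono ?_ hm
    rintro _ ⟨X, hX, m, rfl⟩
    exact Or.inl ⟨X, D.nMinusOff_le i hX, m, rfl⟩

omit hA in
theorem xi_rAct_nPlusOff {X : 𝔤} (hX : X ∈ D.nPlusOff i) (m : M 𝔤 V) :
    D.xi i (rAct V X m) = 0 := by
  refine D.xi_eq_zero_of_stable i
    (N := Submodule.span ℂ {m | ∃ X ∈ D.nPlusOff i, ∃ m', m = rAct V X m'}) ?_ ?_ ?_
    (Submodule.subset_span ⟨X, hX, m, rfl⟩)
  · intro m hm
    refine (Submodule.span_le (p := (Submodule.span ℂ _).comap (ad V (D.F i)))).2 ?_ hm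
    rintro _ ⟨X, hX, m, rfl⟩
    rw [SetLike.mem_coe, Submodule.mem_comap, ad_rAct]
    exact add_mem (Submodule.subset_span ⟨X, hX, _, rfl⟩)
      (Submodule.subset_span ⟨_, D.lie_F_mem_nPlusOff i hX, _, rfl⟩)
  · intro m hm
    refine (Submodule.span_le (p := (Submodule.span ℂ _).comap (lAct V (D.E i)))).2 ?_ hm
    rintro _ ⟨X, hX, m, rfl⟩
    rw [SetLike.mem_coe, Submodule.mem_comap, lAct_rAct]
    exact Submodule.subset_span ⟨X, hX, _, rfl⟩
  · intro m hm
    rw [mem_J]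
    refine Submodule.span_mono ?_ hm
    rintro _ ⟨X, hX, m, rfl⟩
    exact Or.inr ⟨X, D.nPlusOff_le i hX, m, rfl⟩

omit [FiniteDimensional ℂ 𝔤] [𝔱.IsCartanSubalgebra] [LieAlgebra.HasCentralRadical ℂ 𝔤] hA in
theorem lie_F_cartan (h : 𝔱) : ⁅D.F i, (h : 𝔤)⁆ = D.α i h • D.F i := by
  rw [← lie_skew, D.lie_F, neg_neg]

omit [FiniteDimensional ℂ 𝔤] [𝔱.IsCartanSubalgebra] [LieAlgebra.HasCentralRadical ℂ 𝔤] hA in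
theorem pow_ad_lAct_F (k : ℕ) (m : M 𝔤 V) :
    (ad V (D.F i) ^ k) (lAct V (D.F i) m) = lAct V (D.F i) ((ad V (D.F i) ^ k) m) := by
  induction k with
  | zero => rfl
  | succ k ih =>
    rw [pow_succ', Module.End.mul_apply, ih, ad_lAct, lie_self, Module.End.mul_apply]
    have : lAct V (0 : 𝔤) ((ad V (D.F i) ^ k) m) = 0 := by
      have := lAct_smul_left (V := V) 0 (D.F i) ((ad V (D.F i) ^ k) m)
      rwa [zero_smul, zero_smul] at this
    rw [this, add_zero]

omit [FiniteDimensional ℂ 𝔤] [𝔱.IsCartanSubalgebra] [LieAlgebra.HasCentralRadical ℂ 𝔤] hA in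
theorem pow_ad_lAct_cartan (h : 𝔱) (k : ℕ) (m : M 𝔤 V) :
    (ad V (D.F i) ^ k) (lAct V (h : 𝔤) m) = lAct V (h : 𝔤) ((ad V (D.F i) ^ k) m) +
      (k * D.α i h : ℂ) • lAct V (D.F i) ((ad V (D.F i) ^ (k - 1)) m) := by
  induction k with
  | zero => simp
  | succ k ih =>
    have h1 : (k * D.α i h : ℂ) • ad V (D.F i) (lAct V (D.F i) ((ad V (D.F i) ^ (k - 1)) m)) =
        (k * D.α i h : ℂ) • lAct V (D.F i) ((ad V (D.F i) ^ k) m) := by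
      rcases k with _ | k
      · simp
      · have := D.pow_ad_lAct_F i 1 ((ad V (D.F i) ^ k) m)
        rw [pow_one] at this
        rw [Nat.add_sub_cancel, this, pow_succ' _ k, Module.End.mul_apply]
    rw [pow_succ', Module.End.mul_apply, ih, map_add, map_smul, h1, ad_lAct, lie_F_cartan,
      lAct_smul_left, Module.End.mul_apply, Nat.add_sub_cancel]
    push_cast
    module

omit [FiniteDimensional ℂ 𝔤] [𝔱.IsCartanSubalgebra] [LieAlgebra.HasCentralRadical ℂ 𝔤] hA in
theorem pow_ad_lAct_E (k : ℕ) (m : M 𝔤 V) :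
    (ad V (D.F i) ^ k) (lAct V (D.E i) m) = lAct V (D.E i) ((ad V (D.F i) ^ k) m) -
      (k : ℤ) • lAct V (D.H i : 𝔤) ((ad V (D.F i) ^ (k - 1)) m) -
      (k * (k - 1) : ℤ) • lAct V (D.F i) ((ad V (D.F i) ^ (k - 2)) m) := by
  induction k generalizing m with
  | zero => simp
  | succ k ih =>
    have hFE : ⁅D.F i, D.E i⁆ = (-1 : ℂ) • (D.H i : 𝔤) := by
      rw [← lie_skew, D.lie_E_F, neg_one_smul]
    rw [pow_succ, Module.End.mul_apply, ad_lAct, map_add, ih, hFE, lAct_smul_left, map_smul,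
      pow_ad_lAct_cartan, D.α_H, Nat.add_sub_cancel, show k + 1 - 2 = k - 1 by omega,
      Module.End.mul_apply]
    have h1 : (k : ℤ) • lAct V (D.H i : 𝔤) ((ad V (D.F i) ^ (k - 1)) (ad V (D.F i) m)) =
        (k : ℤ) • lAct V (D.H i : 𝔤) ((ad V (D.F i) ^ k) m) := by
      rcases k with _ | k
      · simp
      · rw [Nat.add_sub_cancel, pow_apply_apply]
    have h2 : (k * (k - 1) : ℤ) • lAct V (D.F i) ((ad V (D.F i) ^ (k - 2)) (ad V (D.F i) m)) =
        (k * (k - 1) : ℤ) • lAct V (D.F i) ((ad V (D.F i) ^ (k - 1)) m) := by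
      rcases k with _ | _ | k
      · simp
      · simp
      · rw [show k + 1 + 1 - 2 = k by omega, Nat.add_sub_cancel, pow_apply_apply]
    rw [h1, h2]
    push_cast
    module

theorem xi_lAct_E (m : M 𝔤 V) : D.xi i (lAct V (D.E i) m) = 0 := by
  obtain ⟨N, hN⟩ := hA m
  obtain ⟨N', hN'⟩ := hA (lAct V (D.E i) m)
  have h0 := pow_ad_eq_zero hN (show N ≤ max N N' + 1 by omega)
  rw [D.xi_eq_sum i (pow_ad_eq_zero hN' (show N' ≤ (max N N' + 1) + 1 by omega))]
  have h1 : ∀ k : ℕ, D.toBar ((lAct V (D.E i) ^ k) ((ad V (D.F i) ^ k) (lAct V (D.E i) m))) =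
      D.toBar ((lAct V (D.E i) ^ (k + 1)) ((ad V (D.F i) ^ k) m)) -
        (k * (frac (ι (D.H i)) - 2 * k)) •
          D.toBar ((lAct V (D.E i) ^ (k - 1 + 1)) ((ad V (D.F i) ^ (k - 1)) m)) -
        ((k : Localization (denominators 𝔱)) ^ 2 * (k - 1) * (frac (ι (D.H i)) - k + 1)) •
          D.toBar ((lAct V (D.E i) ^ (k - 2 + 1)) ((ad V (D.F i) ^ (k - 2)) m)) := fun k => by
    rw [pow_ad_lAct_E, map_sub, map_sub, map_sub, map_sub, map_zsmul, map_zsmul, map_zsmul,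
      map_zsmul, toBar_pow_lAct_H, toBar_pow_lAct_F, pow_apply_apply,
      ← Int.cast_smul_eq_zsmul (Localization (denominators 𝔱)),
      ← Int.cast_smul_eq_zsmul (Localization (denominators 𝔱))]
    rcases k with _ | _ | k
    · simp
    · simp
    · rw [show k + 1 + 1 - 2 + 1 = k + 1 + 1 - 1 by omega, show k + 1 + 1 - 1 + 1 = k + 1 + 1 by omega]
      push_cast
      rw [smul_smul, smul_smul]
      congr 2
      ring
  simp only [h1]
  rw [sum_raising (D.coef_eq i)
    (fun k => D.toBar ((lAct V (D.E i) ^ (k + 1)) ((ad V (D.F i) ^ k) m)))]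
  have h2 := pow_ad_eq_zero hN (show N ≤ max N N' + 1 - 1 by omega)
  simp only [h0, h2, map_zero, smul_zero, add_zero]

theorem xi_rAct_F (m : M 𝔤 V) : D.xi i (rAct V (D.F i) m) = 0 := by
  obtain ⟨N, hN⟩ := hA m
  rw [D.xi_eq_sum i (N := N + 1) (by
    rw [pow_ad_rAct, pow_ad_eq_zero hN (Nat.le_succ N), map_zero])]
  have h1 : ∀ k : ℕ, D.toBar ((lAct V (D.E i) ^ k) ((ad V (D.F i) ^ k) (rAct V (D.F i) m))) =
      (k * (frac (ι (D.H i)) - k + 1)) •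
        D.toBar ((lAct V (D.E i) ^ (k - 1)) ((ad V (D.F i) ^ (k - 1 + 1)) m)) -
        D.toBar ((lAct V (D.E i) ^ k) ((ad V (D.F i) ^ (k + 1)) m)) := fun k => by
    have h2 := lAct_eq_ad_add_rAct (D.F i) ((ad V (D.F i) ^ k) m)
    rw [pow_ad_rAct, ← sub_eq_iff_eq_add'.2 h2, map_sub, map_sub, toBar_pow_lAct_F, pow_succ' _ k,
      Module.End.mul_apply (ad V (D.F i))]
    rcases k with _ | k
    · simp
    · rfl
  simp only [h1]
  rw [sum_lowering (D.coef_eq i)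
    (fun k => D.toBar ((lAct V (D.E i) ^ k) ((ad V (D.F i) ^ (k + 1)) m)))]
  simp [pow_ad_eq_zero hN (Nat.le_succ N)]

/-- The series intertwines `h` with `h + α_i(h)`. Composed with the action of the representative of
`s_i`, this is the shifted action. -/
theorem xi_lAct_cartan (h : 𝔱) (m : M 𝔤 V) : D.xi i (lAct V (h : 𝔤) m) =
    (frac (ι h) + frac (algebraMap ℂ (U 𝔱) (D.α i h))) • D.xi i m := by
  obtain ⟨N, hN⟩ := hA m
  obtain ⟨N', hN'⟩ := hA (lAct V (h : 𝔤) m)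
  have h0 := pow_ad_eq_zero hN (show N ≤ max N N' by omega)
  rw [D.xi_eq_sum i (pow_ad_eq_zero hN' (show N' ≤ max N N' + 1 by omega)),
    D.xi_eq_sum i (pow_ad_eq_zero hN (show N ≤ max N N' + 1 by omega))]
  have h1 : ∀ k : ℕ, D.toBar ((lAct V (D.E i) ^ k) ((ad V (D.F i) ^ k) (lAct V (h : 𝔤) m))) =
      (frac (ι h) - k * frac (algebraMap ℂ (U 𝔱) (D.α i h))) •
        D.toBar ((lAct V (D.E i) ^ k) ((ad V (D.F i) ^ k) m)) +
      (k * frac (algebraMap ℂ (U 𝔱) (D.α i h)) * (k * (frac (ι (D.H i)) - k + 1))) •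
        D.toBar ((lAct V (D.E i) ^ (k - 1)) ((ad V (D.F i) ^ (k - 1)) m)) := fun k => by
    rw [pow_ad_lAct_cartan, map_add, map_add, toBar_pow_lAct_cartan, map_smul, toBar_smul,
      toBar_pow_lAct_F, map_mul, map_natCast, map_mul, map_natCast, smul_smul]
  simp only [h1]
  rw [sum_weight (D.coef_eq i) _ _
    (fun k => D.toBar ((lAct V (D.E i) ^ k) ((ad V (D.F i) ^ k) m)))]
  simp [h0]

end LocallyNilpotent

end SimpleRoots

end Zhelobenko

/-! ### The Zhelobenko operators on zero weight vectors -/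

section ZeroWeight

open LieModule

/-- The scalar by which `e ^ k f ^ k` acts on zero weight vectors. -/
theorem prod_casimirValue_sub {j k : ℕ} (hk : k ≤ j) :
    ∏ l ∈ Finset.range k, (casimirValue j - casimirValue l) =
      ((k.factorial * j.choose k * ∏ l ∈ Finset.range k, (j + 1 + l) : ℕ) : ℂ) := by
  rw [← Nat.descFactorial_eq_factorial_mul_choose, Nat.descFactorial_eq_prod_range,
    ← Finset.prod_mul_distrib]
  push_cast
  refine Finset.prod_congr rfl fun l hl => ?_
  rw [Nat.cast_sub (by have := Finset.mem_range.1 hl; omega), casimirValue, casimirValue]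
  ring

section

variable {𝔤 : Type*} [LieRing 𝔤] [LieAlgebra ℂ 𝔤]
variable {V : Type*} [AddCommGroup V] [Module ℂ V] [LieRingModule 𝔤 V] [LieModule ℂ 𝔤 V]
variable {h e f : 𝔤} (t : IsSl2Triple h e f) {v : V} (hv : ⁅h, v⁆ = 0) {j : ℕ}
  (hj : ⁅f, ⁅e, v⁆⁆ = casimirValue j • v)
include t hv hj

theorem lie_lie_of_casimir : ⁅e, ⁅f, v⁆⁆ = casimirValue j • v := by
  rw [leibniz_lie, t.lie_e_f, hv, zero_add, hj]

theorem pow_e_pow_f (k : ℕ) : (toEnd ℂ 𝔤 V e ^ k) ((toEnd ℂ 𝔤 V f ^ k) v) =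
    (∏ l ∈ Finset.range k, (casimirValue j - casimirValue l)) • v := by
  induction k with
  | zero => simp
  | succ k ih =>
    have h1 : ⁅-h, v⁆ = 0 := by rw [neg_lie, hv, neg_zero]
    rw [pow_toEnd_succ', lie_f_pow_succ_e t.symm h1, lie_lie_of_casimir t hv hj, ← sub_smul,
      map_smul, map_smul, ih, smul_smul, Finset.prod_range_succ, mul_comm]

theorem pow_f_succ_eq_zero (hf : ∀ v : V, ∃ k, (toEnd ℂ 𝔤 V f ^ k) v = 0) :
    (toEnd ℂ 𝔤 V f ^ (j + 1)) v = 0 := by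
  by_cases hv0 : v = 0
  · rw [hv0, map_zero]
  have h1 : ⁅-h, v⁆ = 0 := by rw [neg_lie, hv, neg_zero]
  have h2 := (primitive_of_casimir t.symm hf hv0 h1 (lie_lie_of_casimir t hv hj)).1.lie_e
  rwa [← pow_toEnd_succ] at h2

end

variable {𝔤 : Type*} [LieRing 𝔤] [LieAlgebra ℂ 𝔤] {𝔱 : LieSubalgebra ℂ 𝔤} [IsLieAbelian 𝔱]
variable {r : ℕ} (D : SimpleRoots 𝔱 r)
variable {V : Type*} [AddCommGroup V] [Module ℂ V] [LieRingModule 𝔤 V] [LieModule ℂ 𝔤 V]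

theorem pow_ad_one_tmul (X : 𝔤) (k : ℕ) (v : V) :
    (ad V X ^ k) ((1 : U 𝔤) ⊗ₜ[ℂ] v) = 1 ⊗ₜ (toEnd ℂ 𝔤 V X ^ k) v := by
  induction k with
  | zero => rfl
  | succ k ih =>
    rw [pow_succ', Module.End.mul_apply, ih, ad, LinearMap.sub_apply, lAct_tmul, rAct_tmul,
      pow_toEnd_succ]
    simp

namespace SimpleRoots

variable (i : Fin r)

variable [FiniteDimensional ℂ 𝔤] [𝔱.IsCartanSubalgebra] [LieAlgebra.HasCentralRadical ℂ 𝔤]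

theorem toBar_pow_lAct_one_tmul (k : ℕ) (v : V) :
    D.toBar ((lAct V (D.E i) ^ k) ((1 : U 𝔤) ⊗ₜ[ℂ] v)) =
      D.toBar (1 ⊗ₜ (toEnd ℂ 𝔤 V (D.E i) ^ k) v) := by
  induction k generalizing v with
  | zero => rfl
  | succ k ih =>
    have h1 : lAct V (D.E i) ((1 : U 𝔤) ⊗ₜ[ℂ] v) =
        rAct V (D.E i) ((1 : U 𝔤) ⊗ₜ[ℂ] v) + 1 ⊗ₜ ⁅D.E i, v⁆ := by
      rw [lAct_tmul, rAct_tmul, one_mul, mul_one, sub_add_cancel]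
    rw [pow_succ, Module.End.mul_apply, h1, map_add, pow_lAct_rAct, map_add,
      D.toBar_rAct (D.E_mem_nPlus i), zero_add, ih, pow_toEnd_succ']

/-- The common denominator `H_i (H_i - 1) ⋯ (H_i - k - m + 1)` turns the `k`-th coefficient of the series
into a rising factorial divided by `k!`. -/
theorem frac_den_mul_coef {k m : ℕ} :
    frac (D.den i (k + m) : U 𝔱) * D.coef i k * (k.factorial : Localization (denominators 𝔱)) =
      ∏ l ∈ Finset.range m, (frac (ι (D.H i)) - (k + m : ℕ) + 1 + l) := by
  have h1 : frac (D.den i (k + m) : U 𝔱) = frac (D.den i k : U 𝔱) *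
      ∏ l ∈ Finset.range m, (frac (ι (D.H i)) - (k + m : ℕ) + 1 + l) := by
    change frac (∏ l ∈ Finset.range (k + m), (ι (D.H i) - (l : U 𝔱))) =
      frac (∏ l ∈ Finset.range k, (ι (D.H i) - (l : U 𝔱))) * _
    rw [Finset.prod_range_add, map_mul]
    congr 1
    rw [map_prod, ← Finset.prod_range_reflect]
    refine Finset.prod_congr rfl fun l hl => ?_
    have h2 : k + (m - 1 - l) + (1 + l) = k + m := by
      have := Finset.mem_range.1 hl
      omega
    rw [map_sub, map_natCast, ← h2]
    push_cast
    ring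
  have h2 := D.factorial_mul_den_mul_coef i k
  rw [h1]
  linear_combination (∏ l ∈ Finset.range m, (frac (ι (D.H i)) - (k + m : ℕ) + 1 + l)) * h2

/-- The value of `ξ_i` on the zero weight vectors of the `(2j + 1)`-dimensional isotypic
component, up to the action of the representative of `s_i`. -/
theorem den_smul_xi_one_tmul (hF : ∀ v : V, ∃ k, (toEnd ℂ 𝔤 V (D.F i) ^ k) v = 0) {v : V}
    (hv : ⁅(D.H i : 𝔤), v⁆ = 0) {j : ℕ} (hj : ⁅D.F i, ⁅D.E i, v⁆⁆ = casimirValue j • v) :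
    frac (D.den i j : U 𝔱) • D.xi i ((1 : U 𝔤) ⊗ₜ[ℂ] v) =
      frac (D.Ψ i j) • D.toBar ((1 : U 𝔤) ⊗ₜ[ℂ] v) := by
  rw [D.xi_eq_sum i (N := j + 1) (by
    rw [pow_ad_one_tmul, pow_f_succ_eq_zero (D.sl2Triple i) hv hj hF, TensorProduct.tmul_zero])]
  have h1 : ∀ k ∈ Finset.range (j + 1),
      D.coef i k • D.toBar ((lAct V (D.E i) ^ k) ((ad V (D.F i) ^ k) (1 ⊗ₜ[ℂ] v))) =
      (D.coef i k * ((k.factorial * j.choose k * ∏ l ∈ Finset.range k, (j + 1 + l) : ℕ) :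
        Localization (denominators 𝔱))) • D.toBar ((1 : U 𝔤) ⊗ₜ[ℂ] v) := fun k hk => by
    rw [pow_ad_one_tmul, toBar_pow_lAct_one_tmul, pow_e_pow_f (D.sl2Triple i) hv hj,
      prod_casimirValue_sub (Nat.lt_succ_iff.1 (Finset.mem_range.1 hk)), TensorProduct.tmul_smul,
      toBar_smul, map_natCast, map_natCast, smul_smul]
  rw [Finset.sum_congr rfl h1, ← Finset.sum_smul, smul_smul]
  congr 1
  rw [Finset.mul_sum, ← Finset.Nat.sum_antidiagonal_eq_sum_range_succ_mk
    (fun p : ℕ × ℕ => frac (D.den i j : U 𝔱) * (D.coef i p.1 * ((p.1.factorial * j.choose p.1 *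
      ∏ l ∈ Finset.range p.1, (j + 1 + l) : ℕ) : Localization (denominators 𝔱))))]
  have h2 := sum_choose_mul_rising ((j : Localization (denominators 𝔱)) + 1)
    (frac (ι (D.H i)) - j + 1) j
  have h3 : frac (D.Ψ i j) = ∏ l ∈ Finset.range j,
      ((j : Localization (denominators 𝔱)) + 1 + (frac (ι (D.H i)) - j + 1) + l) := by
    rw [Ψ, map_prod]
    refine Finset.prod_congr rfl fun l _ => ?_
    rw [map_add, map_natCast]
    push_cast
    ring
  rw [h3, ← h2]
  refine Finset.sum_congr rfl fun p hp => ?_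
  have hp' := Finset.HasAntidiagonal.mem_antidiagonal.1 hp
  have h4 := D.frac_den_mul_coef i (k := p.1) (m := p.2)
  rw [hp'] at h4
  rw [← h4]
  push_cast
  ring

end SimpleRoots

end ZeroWeight

/-! ### Local nilpotency on `U(𝔤) ⊗ V` -/

section Nilpotency

open LieModule

/-- The Leibniz rule preserves local nilpotency. -/
theorem pow_eq_zero_of_leibniz {A B C : Type*} [AddCommGroup A] [AddCommGroup B] [AddCommGroup C]
    [Module ℂ A] [Module ℂ B] [Module ℂ C] (β : A →ₗ[ℂ] B →ₗ[ℂ] C) (a : Module.End ℂ A)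
    (b : Module.End ℂ B) (c : Module.End ℂ C) (h : ∀ x y, c (β x y) = β (a x) y + β x (b y))
    (k l : ℕ) {x : A} {y : B} (hx : (a ^ k) x = 0) (hy : (b ^ l) y = 0) :
    (c ^ (k + l)) (β x y) = 0 := by
  induction hN : k + l generalizing k l x y with
  | zero =>
    obtain ⟨rfl, rfl⟩ : k = 0 ∧ l = 0 := by omega
    simp only [pow_zero, Module.End.one_apply] at hx
    rw [hx, map_zero, LinearMap.zero_apply, map_zero]
  | succ N ih =>
    rw [pow_succ, Module.End.mul_apply, h, map_add]
    rcases k with _ | k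
    · simp only [pow_zero, Module.End.one_apply] at hx
      simp [hx]
    rcases l with _ | l
    · simp only [pow_zero, Module.End.one_apply] at hy
      simp [hy]
    rw [ih k (l + 1) (x := a x) (by rw [← Module.End.mul_apply, ← pow_succ, hx]) hy (by omega),
      ih (k + 1) l (y := b y) hx (by rw [← Module.End.mul_apply, ← pow_succ, hy]) (by omega),
      add_zero]

variable {𝔤 : Type*} [LieRing 𝔤] [LieAlgebra ℂ 𝔤]
variable {V : Type*} [AddCommGroup V] [Module ℂ V] [LieRingModule 𝔤 V] [LieModule ℂ 𝔤 V]

/-- The adjoint action of `X` on `U(𝔤)` is locally nilpotent if `ad X` is nilpotent. -/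
theorem exists_pow_lie_eq_zero {X : 𝔤} (hX : IsNilpotent (LieAlgebra.ad ℂ 𝔤 X)) (u : U 𝔤) :
    ∃ k, (LieAlgebra.ad ℂ (U 𝔤) (ι X) ^ k) u = 0 := by
  obtain ⟨n, hn⟩ := hX
  have hmul : ∀ x y : U 𝔤, LieAlgebra.ad ℂ (U 𝔤) (ι X) (LinearMap.mul ℂ (U 𝔤) x y) =
      LinearMap.mul ℂ (U 𝔤) (LieAlgebra.ad ℂ (U 𝔤) (ι X) x) y +
        LinearMap.mul ℂ (U 𝔤) x (LieAlgebra.ad ℂ (U 𝔤) (ι X) y) := fun x y => by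
    simp only [LieAlgebra.ad_apply, LinearMap.mul_apply', LieRing.of_associative_ring_bracket]
    noncomm_ring
  let A : Subalgebra ℂ (U 𝔤) :=
    { carrier := {u | ∃ k, (LieAlgebra.ad ℂ (U 𝔤) (ι X) ^ k) u = 0}
      mul_mem' := fun {x y} ⟨k, hk⟩ ⟨l, hl⟩ =>
        ⟨k + l, pow_eq_zero_of_leibniz (LinearMap.mul ℂ (U 𝔤)) _ _ _ hmul k l hk hl⟩
      add_mem' := fun {x y} ⟨k, hk⟩ ⟨l, hl⟩ => ⟨k + l, by
        rw [map_add, pow_add, Module.End.mul_apply, Module.End.mul_apply, hl, map_zero, add_zero,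
          ← Module.End.mul_apply, ← pow_add, add_comm, pow_add, Module.End.mul_apply, hk,
          map_zero]⟩
      algebraMap_mem' := fun c => ⟨1, by
        rw [pow_one, LieAlgebra.ad_apply, LieRing.of_associative_ring_bracket,
          Algebra.commutes, sub_self]⟩ }
  refine U.mem_of_subalgebra A (fun Y => ⟨n, ?_⟩) u
  have h1 : ∀ k, (LieAlgebra.ad ℂ (U 𝔤) (ι X) ^ k) (ι Y) =
      ι ((LieAlgebra.ad ℂ 𝔤 X ^ k) Y) := fun k => by
    induction k with
    | zero => rfl
    | succ k ih =>
      rw [pow_succ', Module.End.mul_apply, ih, LieAlgebra.ad_apply, ← LieHom.map_lie, pow_succ',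
        Module.End.mul_apply, LieAlgebra.ad_apply]
  rw [h1, hn, LinearMap.zero_apply, ι, map_zero]

theorem exists_pow_ad_eq_zero {X : 𝔤} (hX : IsNilpotent (LieAlgebra.ad ℂ 𝔤 X))
    (hV : ∀ v : V, ∃ k, (toEnd ℂ 𝔤 V X ^ k) v = 0) (m : M 𝔤 V) :
    ∃ k, (ad V X ^ k) m = 0 := by
  induction m using TensorProduct.induction_on with
  | zero => exact ⟨0, by simp⟩
  | add x y hx hy =>
    obtain ⟨k, hk⟩ := hx
    obtain ⟨l, hl⟩ := hy
    exact ⟨k + l, by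
      rw [map_add, pow_add, Module.End.mul_apply, Module.End.mul_apply, hl, map_zero, add_zero,
        ← Module.End.mul_apply, ← pow_add, add_comm, pow_add, Module.End.mul_apply, hk, map_zero]⟩
  | tmul u v =>
    obtain ⟨k, hk⟩ := exists_pow_lie_eq_zero hX u
    obtain ⟨l, hl⟩ := hV v
    refine ⟨k + l, pow_eq_zero_of_leibniz (TensorProduct.mk ℂ (U 𝔤) V) _ _ _ (fun x y => ?_)
      k l hk hl⟩
    rw [TensorProduct.mk_apply, ad, LinearMap.sub_apply, lAct_tmul, rAct_tmul,
      TensorProduct.mk_apply, TensorProduct.mk_apply, LieAlgebra.ad_apply, toEnd_apply_apply,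
      LieRing.of_associative_ring_bracket, TensorProduct.sub_tmul]
    abel

end Nilpotency

/-! ### The operators induced on `Z` -/

section Induced

open LieModule

variable {𝔤 : Type*} [LieRing 𝔤] [LieAlgebra ℂ 𝔤] {𝔱 : LieSubalgebra ℂ 𝔤} [IsLieAbelian 𝔱]
  [FiniteDimensional ℂ 𝔤] [𝔱.IsCartanSubalgebra] [LieAlgebra.HasCentralRadical ℂ 𝔤]
variable {r : ℕ} (D : SimpleRoots 𝔱 r)
variable {V : Type*} [AddCommGroup V] [Module ℂ V] [LieRingModule 𝔤 V] [LieModule ℂ 𝔤 V]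

namespace SimpleRoots

variable (i : Fin r) (hA : ∀ m : M 𝔤 V, ∃ N, (ad V (D.F i) ^ N) m = 0)
  (φ : 𝔤 →ₗ⁅ℂ⁆ 𝔤) (hφ : ∀ h : 𝔱, φ h = (D.s i h : 𝔤)) (σ : M 𝔤 V →ₗ[ℂ] M 𝔤 V)
  (hl : ∀ X m, σ (lAct V X m) = lAct V (φ X) (σ m))
  (hr : ∀ X m, σ (rAct V X m) = rAct V (φ X) (σ m))

omit [FiniteDimensional ℂ 𝔤] [𝔱.IsCartanSubalgebra] [LieAlgebra.HasCentralRadical ℂ 𝔤] in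
theorem s_dual (i : Fin r) (h : 𝔱) : D.α i (D.s i h) = -D.α i h := by
  simp [s, D.α_H]
  ring

omit [FiniteDimensional ℂ 𝔤] [𝔱.IsCartanSubalgebra] [LieAlgebra.HasCentralRadical ℂ 𝔤] in
theorem shifted_ι (h : 𝔱) :
    D.shifted i (ι h) = ι (D.s i h) - algebraMap ℂ (U 𝔱) (D.α i h) := by
  rw [shifted, ι, UniversalEnvelopingAlgebra.lift_ι_apply]
  rfl

include hA hφ hl hr in
/-- `ξ_i` is well defined on `Z`. The representative of `s_i` exchanges the lines of `E_i` and `F_i`, so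
the generators to be killed are `E_i M`, `M F_i` and those off the direction of `α_i`. -/
theorem xi_comp_eq_zero {m : M 𝔤 V} (hm : m ∈ D.J V) : D.xi i (σ m) = 0 := by
  rw [mem_J] at hm
  induction hm using Submodule.span_induction with
  | zero => rw [map_zero, D.xi_eq_sum i (N := 0) (map_zero _), Finset.sum_range_zero]
  | add x y _ _ hx hy => rw [map_add, D.xi_add i hA, hx, hy, add_zero]
  | smul c x _ hx => rw [map_smul, D.xi_smul i hA, hx, smul_zero]
  | mem x hx =>
    rcases hx with ⟨X, hX, m, rfl⟩ | ⟨X, hX, m, rfl⟩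
    · obtain ⟨Y, hY, Y', hY', rfl⟩ := Submodule.mem_sup.1 (D.nMinus_le i hX)
      obtain ⟨c, rfl⟩ := Submodule.mem_span_singleton.1 hY'
      have h1 : φ (D.F i) ∈ Submodule.span ℂ {D.E i} := by
        refine (D.rootSpace_simple i).2 _ ?_
        have h2 : -D.α i + (-(-D.α i) (D.H i)) • D.α i = D.α i := by
          rw [LinearMap.neg_apply, D.α_H]
          module
        have h3 := D.map_mem_rootSpace i φ hφ (D.F_mem i)
        rwa [h2] at h3
      obtain ⟨d, hd⟩ := Submodule.mem_span_singleton.1 h1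
      rw [hl, map_add, map_smul, ← hd, lAct_add_left, lAct_smul_left, lAct_smul_left,
        D.xi_add i hA, D.xi_smul i hA, D.xi_smul i hA, D.xi_lAct_E i hA,
        D.xi_lAct_nMinusOff i (D.map_mem_nMinusOff i φ hφ hY), smul_zero, smul_zero, add_zero]
    · obtain ⟨Y, hY, Y', hY', rfl⟩ := Submodule.mem_sup.1 (D.nPlus_le i hX)
      obtain ⟨c, rfl⟩ := Submodule.mem_span_singleton.1 hY'
      have h1 : φ (D.E i) ∈ Submodule.span ℂ {D.F i} := by
        refine (D.rootSpace_neg_simple i).2 _ ?_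
        have h2 : D.α i + (-D.α i (D.H i)) • D.α i = -D.α i := by
          rw [D.α_H]
          module
        have h3 := D.map_mem_rootSpace i φ hφ (D.E_mem i)
        rwa [h2] at h3
      obtain ⟨d, hd⟩ := Submodule.mem_span_singleton.1 h1
      rw [hr, map_add, map_smul, ← hd, rAct_add_left, rAct_smul_left, rAct_smul_left,
        D.xi_add i hA, D.xi_smul i hA, D.xi_smul i hA, D.xi_rAct_F i hA,
        D.xi_rAct_nPlusOff i (D.map_mem_nPlusOff i φ hφ hY), smul_zero, smul_zero, add_zero]

include hA hφ hl in
/-- `ξ_i` is semilinear for the shifted action of `s_i`. -/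
theorem xi_comp_smul (a : U 𝔱) (m : M 𝔤 V) :
    D.xi i (σ (a • m)) = frac (D.shifted i a) • D.xi i (σ m) := by
  let A : Subalgebra ℂ (U 𝔱) :=
    { carrier := {a | ∀ m, D.xi i (σ (a • m)) = frac (D.shifted i a) • D.xi i (σ m)}
      mul_mem' := fun {a b} ha hb m => by
        rw [mul_smul, ha, hb, smul_smul, map_mul, map_mul]
      add_mem' := fun {a b} ha hb m => by
        rw [add_smul, map_add, D.xi_add i hA, ha, hb, map_add, map_add, add_smul]
      algebraMap_mem' := fun c m => by
        rw [algebraMap_smul, map_smul, D.xi_smul i hA, AlgHom.commutes] }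
  refine U.mem_of_subalgebra A (fun h m => ?_) a m
  rw [ι_smul, hl, hφ, D.xi_lAct_cartan i hA, shifted_ι, s_dual, map_neg, map_neg, map_sub,
    sub_eq_add_neg]

include hA in
theorem XiEq_iff (z : D.Z V) (w : D.Zbar V) :
    D.XiEq V i σ z w ↔ ∀ m : M 𝔤 V, (D.J V).mkQ m = z → D.xi i (σ m) = w := by
  refine forall₂_congr fun m _ => ?_
  rw [D.projBar_η i (hA _)]

end SimpleRoots

end Induced

/-! ### Invariants of the Zhelobenko operators -/

section Invariants

open LieModule

variable {𝔤 : Type*} [LieRing 𝔤] [LieAlgebra ℂ 𝔤] {𝔱 : LieSubalgebra ℂ 𝔤} [IsLieAbelian 𝔱]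
variable {r : ℕ} (D : SimpleRoots 𝔱 r)
variable {V : Type*} [AddCommGroup V] [Module ℂ V] [LieRingModule 𝔤 V] [LieModule ℂ 𝔤 V]

namespace SimpleRoots

variable (i : Fin r)

theorem shifted_Ψ (j : ℕ) :
    D.shifted i (D.Ψ i j) = ∏ l ∈ Finset.range j, ((l : U 𝔱) - ι (D.H i)) := by
  rw [Ψ, map_prod]
  refine Finset.prod_congr rfl fun l _ => ?_
  have h1 : D.s i (D.H i) = -D.H i := by
    simp only [s, LinearMap.sub_apply, LinearMap.id_apply, LinearMap.smulRight_apply, D.α_H]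
    module
  rw [map_add, shifted_ι, map_natCast, D.α_H, h1, ι, map_neg, map_ofNat]
  push_cast
  ring

theorem shifted_Ψ_eq_den (j : ℕ) :
    D.shifted i (D.Ψ i j) = algebraMap ℂ (U 𝔱) ((-1) ^ j) * (D.den i j : U 𝔱) := by
  change _ = _ * ∏ l ∈ Finset.range j, (ι (D.H i) - (l : U 𝔱))
  rw [shifted_Ψ, map_pow, map_neg, map_one, ← Finset.card_range j, ← Finset.prod_const,
    Finset.card_range, ← Finset.prod_mul_distrib]
  refine Finset.prod_congr rfl fun l _ => ?_
  ring

variable [FiniteDimensional ℂ 𝔤] [𝔱.IsCartanSubalgebra] [LieAlgebra.HasCentralRadical ℂ 𝔤]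

theorem shifted_Ψ_ne_zero (j : ℕ) : D.shifted i (D.Ψ i j) ≠ 0 := by
  rw [shifted_Ψ_eq_den]
  refine mul_ne_zero ?_ (denominators_ne_zero (D.den i j).2)
  rw [map_ne_zero_iff _ (FaithfulSMul.algebraMap_injective ℂ (U 𝔱))]
  exact pow_ne_zero _ (by norm_num)

/-- `Ψ` is a product of factors `H_i + l + 2`, its transform of factors `m - H_i`, and the sum of two
such factors is a nonzero constant. -/
theorem isCoprime_Ψ (j : ℕ) : IsCoprime (D.Ψ i j) (D.shifted i (D.Ψ i j)) := by
  rw [shifted_Ψ, Ψ]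
  refine IsCoprime.prod_left fun l _ => IsCoprime.prod_right fun m _ => ?_
  have h1 : algebraMap ℂ (U 𝔱) ((l + 2 + m : ℕ) : ℂ)⁻¹ * ((l + 2 + m : ℕ) : U 𝔱) = 1 := by
    rw [← map_natCast (algebraMap ℂ (U 𝔱)), ← map_mul,
      inv_mul_cancel₀ (Nat.cast_ne_zero.2 (by omega)), map_one]
  refine ⟨algebraMap ℂ (U 𝔱) ((l + 2 + m : ℕ) : ℂ)⁻¹,
    algebraMap ℂ (U 𝔱) ((l + 2 + m : ℕ) : ℂ)⁻¹, ?_⟩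
  rw [← h1]
  push_cast
  ring

/-- An element `Θ` with `(s_i ∘ Θ) Ψ = (s_i ∘ Ψ) Θ` is an invariant multiple of `Ψ`. -/
theorem exists_invariant {j : ℕ} {Θ : U 𝔱}
    (h : D.shifted i Θ * D.Ψ i j = D.shifted i (D.Ψ i j) * Θ) :
    ∃ Θ', D.shifted i Θ' = Θ' ∧ Θ = Θ' * D.Ψ i j := by
  obtain ⟨Θ', rfl⟩ : D.Ψ i j ∣ Θ :=
    (D.isCoprime_Ψ i j).dvd_of_dvd_mul_left ⟨D.shifted i Θ, by rw [← h, mul_comm]⟩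
  have hΨ : D.Ψ i j ≠ 0 := fun h0 => D.shifted_Ψ_ne_zero i j (by rw [h0, map_zero])
  refine ⟨Θ', ?_, mul_comm _ _⟩
  rw [map_mul] at h
  refine mul_left_cancel₀ (mul_ne_zero (D.shifted_Ψ_ne_zero i j) hΨ) ?_
  linear_combination h

variable (hA : ∀ m : M 𝔤 V, ∃ N, (ad V (D.F i) ^ N) m = 0)
  (hF : ∀ v : V, ∃ k, (toEnd ℂ 𝔤 V (D.F i) ^ k) v = 0)
  (φ : 𝔤 →ₗ⁅ℂ⁆ 𝔤) (hφ : ∀ h : 𝔱, φ h = (D.s i h : 𝔤)) (σ : M 𝔤 V →ₗ[ℂ] M 𝔤 V)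
  (hl : ∀ X m, σ (lAct V X m) = lAct V (φ X) (σ m))
  (hr : ∀ X m, σ (rAct V X m) = rAct V (φ X) (σ m))
  (hσ : ∀ (v : V) (j : ℕ), ⁅(D.H i : 𝔤), v⁆ = 0 → ⁅D.F i, ⁅D.E i, v⁆⁆ = casimirValue j • v →
    σ ((1 : U 𝔤) ⊗ₜ v) = (-1 : ℂ) ^ j • ((1 : U 𝔤) ⊗ₜ[ℂ] v))

include hA hF hσ in
/-- `ξ_i(v) = (Ψ / (s_i ∘ Ψ)) v` for the zero weight vectors `v` of an isotypic component. -/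
theorem shifted_Ψ_smul_xi {v : V} (hv : ⁅(D.H i : 𝔤), v⁆ = 0) {j : ℕ}
    (hj : ⁅D.F i, ⁅D.E i, v⁆⁆ = casimirValue j • v) :
    frac (D.shifted i (D.Ψ i j)) • D.xi i (σ ((1 : U 𝔤) ⊗ₜ v)) =
      frac (D.Ψ i j) • D.toZbar V (D.ofV V v) := by
  have h1 := D.den_smul_xi_one_tmul i hF hv hj
  have h2 : (algebraMap ℂ (U 𝔱)) ((-1) ^ j) * (algebraMap ℂ (U 𝔱)) ((-1) ^ j) = 1 := by
    rw [← map_mul, ← mul_pow]; simp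
  rw [hσ v j hv hj, D.xi_smul i hA, shifted_Ψ_eq_den, smul_smul, ← map_mul, mul_right_comm, h2,
    one_mul, h1]
  rfl

include hA hφ hl in
theorem xi_sum {κ : Type*} (S : Finset κ) (Θ : κ → U 𝔱) (v : κ → V) :
    D.xi i (σ (∑ a ∈ S, Θ a • ((1 : U 𝔤) ⊗ₜ v a))) =
      ∑ a ∈ S, frac (D.shifted i (Θ a)) • D.xi i (σ ((1 : U 𝔤) ⊗ₜ v a)) := by
  classical
  induction S using Finset.induction_on with
  | empty =>
    rw [Finset.sum_empty, Finset.sum_empty, map_zero, D.xi_eq_sum i (N := 0) (map_zero _),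
      Finset.sum_range_zero]
  | insert a S ha ih =>
    rw [Finset.sum_insert ha, Finset.sum_insert ha, map_add, D.xi_add i hA, ih,
      D.xi_comp_smul i hA φ hφ σ hl]

include hA hφ hl hr in
theorem XiEq_sum_iff {κ : Type*} (S : Finset κ) (Θ : κ → U 𝔱) (v : κ → V) (w : D.Zbar V) :
    D.XiEq V i σ (∑ a ∈ S, Θ a • D.ofV V (v a)) w ↔
      ∑ a ∈ S, frac (D.shifted i (Θ a)) • D.xi i (σ ((1 : U 𝔤) ⊗ₜ v a)) = w := by
  have hm : (D.J V).mkQ (∑ a ∈ S, Θ a • ((1 : U 𝔤) ⊗ₜ[ℂ] v a)) =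
      ∑ a ∈ S, Θ a • D.ofV V (v a) := by
    rw [map_sum]; rfl
  rw [D.XiEq_iff i hA, ← D.xi_sum i hA φ hφ σ hl]
  refine ⟨fun h => h _ hm, fun h m' hm' => ?_⟩
  rw [← h, ← sub_add_cancel m' (∑ a ∈ S, Θ a • ((1 : U 𝔤) ⊗ₜ[ℂ] v a)), map_add, D.xi_add i hA,
    D.xi_comp_eq_zero i hA φ hφ σ hl hr, zero_add]
  rw [← (D.J V).ker_mkQ, LinearMap.mem_ker, map_sub, hm, hm', sub_self]

include hA hF hφ hl hr hσ in
/-- Sums of products of invariants, the polynomials `Ψ` and zero weight vectors are fixed by `ξ_i`. -/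
theorem XiEq_of_invariant {κ : Type*} (S : Finset κ) (Θ : κ → U 𝔱) (j : κ → ℕ) (v : κ → V)
    (hv : ∀ a ∈ S, ⁅(D.H i : 𝔤), v a⁆ = 0)
    (hj : ∀ a ∈ S, ⁅D.F i, ⁅D.E i, v a⁆⁆ = casimirValue (j a) • v a)
    (hΘ : ∀ a ∈ S, D.shifted i (Θ a) = Θ a) :
    D.XiEq V i σ (∑ a ∈ S, (Θ a * D.Ψ i (j a)) • D.ofV V (v a))
      (D.toZbar V (∑ a ∈ S, (Θ a * D.Ψ i (j a)) • D.ofV V (v a))) := by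
  rw [D.XiEq_sum_iff i hA φ hφ σ hl hr, map_sum]
  refine Finset.sum_congr rfl fun a ha => ?_
  rw [map_mul, hΘ a ha, map_mul, mul_smul,
    D.shifted_Ψ_smul_xi i hA hF σ hσ (hv a ha) (hj a ha), smul_smul, ← map_mul, map_smul,
    algebraMap_smul]

include hA hF hφ hl hr hσ in
/-- A combination of independent zero weight eigenvectors which is fixed by `ξ_i` has invariant multiples
of the polynomials `Ψ` as coefficients. -/
theorem exists_invariant_of_XiEq {n : ℕ} (f : 𝔤 →ₗ⁅ℂ⁆ Matrix (Fin n) (Fin n) ℂ)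
    (hf : Function.Injective f) {κ : Type*} (S : Finset κ) (Θ : κ → U 𝔱) (j : κ → ℕ) (v : κ → V)
    (hind : LinearIndependent ℂ v)
    (hv : ∀ a ∈ S, ⁅(D.H i : 𝔤), v a⁆ = 0)
    (hj : ∀ a ∈ S, ⁅D.F i, ⁅D.E i, v a⁆⁆ = casimirValue (j a) • v a)
    (h : D.XiEq V i σ (∑ a ∈ S, Θ a • D.ofV V (v a))
      (D.toZbar V (∑ a ∈ S, Θ a • D.ofV V (v a)))) :
    ∀ a ∈ S, ∃ Θ', D.shifted i Θ' = Θ' ∧ Θ a = Θ' * D.Ψ i (j a) := by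
  classical
  rw [D.XiEq_sum_iff i hA φ hφ σ hl hr] at h
  -- clear the denominators `s_i ∘ Ψ`
  let q : κ → U 𝔱 := fun a => D.shifted i (D.Ψ i (j a))
  have h1 := congrArg (fun w => frac (∏ a ∈ S, q a) • w) h
  have h2 : frac (∏ a ∈ S, q a) •
      (∑ a ∈ S, frac (D.shifted i (Θ a)) • D.xi i (σ ((1 : U 𝔤) ⊗ₜ v a))) =
      D.toZbar V (∑ a ∈ S, ((∏ b ∈ S.erase a, q b) * (D.shifted i (Θ a) * D.Ψ i (j a))) •
        D.ofV V (v a)) := by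
    rw [Finset.smul_sum, map_sum]
    refine Finset.sum_congr rfl fun a ha => ?_
    have h3 := D.shifted_Ψ_smul_xi i hA hF σ hσ (hv a ha) (hj a ha)
    rw [← Finset.prod_erase_mul S q ha, smul_smul, ← map_mul,
      show (∏ b ∈ S.erase a, q b) * q a * D.shifted i (Θ a) =
        (∏ b ∈ S.erase a, q b) * D.shifted i (Θ a) * q a by ring, map_mul, mul_smul, h3, smul_smul,
      ← map_mul, map_smul, algebraMap_smul, mul_assoc]
  simp only [h2] at h1
  rw [algebraMap_smul, ← map_smul] at h1
  have h3 := D.toZbar_injective f hf h1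
  rw [Finset.smul_sum, ← sub_eq_zero, ← Finset.sum_sub_distrib] at h3
  simp only [smul_smul, ← sub_smul] at h3
  intro a ha
  have h4 := linearIndependent_iff'.1 (D.linearIndependent_ofV f hf hind) S _ h3 a ha
  rw [← Finset.prod_erase_mul S q ha, mul_assoc, ← mul_sub, mul_eq_zero, sub_eq_zero] at h4
  exact D.exists_invariant i (h4.resolve_left
    (Finset.prod_ne_zero_iff.2 fun b _ => D.shifted_Ψ_ne_zero i (j b)))

end SimpleRoots

end Invariants

/-! ### Eigenvectors in the zero weight space -/

section Decomposition

open LieModule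

variable {𝔤 : Type*} [LieRing 𝔤] [LieAlgebra ℂ 𝔤] {𝔱 : LieSubalgebra ℂ 𝔤} [IsLieAbelian 𝔱]
  [LieRing.IsNilpotent 𝔱]
variable {r : ℕ} (D : SimpleRoots 𝔱 r)
variable {V : Type*} [AddCommGroup V] [Module ℂ V] [LieRingModule 𝔤 V] [LieModule ℂ 𝔤 V]

namespace SimpleRoots

theorem lie_eq_zero_of_mem_weightSpace {v : V} (hv : v ∈ weightSpace V (0 : 𝔱 → ℂ)) (h : 𝔱) :
    ⁅(h : 𝔤), v⁆ = 0 := by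
  have := (mem_weightSpace _ _).1 hv h
  simpa using this

theorem ofV_zero : D.ofV V 0 = 0 := by
  rw [ofV, TensorProduct.tmul_zero, map_zero]

theorem ofV_add (v w : V) : D.ofV V (v + w) = D.ofV V v + D.ofV V w := by
  rw [ofV, TensorProduct.tmul_add, map_add]; rfl

theorem ofV_smul (c : ℂ) (v : V) :
    D.ofV V (c • v) = algebraMap ℂ (U 𝔱) c • D.ofV V v := by
  rw [ofV, TensorProduct.tmul_smul, ← algebraMap_smul (U 𝔱), map_smul]; rfl

theorem lie_F_lie_E_mem_weightSpace (i : Fin r) {v : V} (hv : v ∈ weightSpace V (0 : 𝔱 → ℂ)) :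
    ⁅D.F i, ⁅D.E i, v⁆⁆ ∈ weightSpace V (0 : 𝔱 → ℂ) := by
  rw [mem_weightSpace]
  intro h
  change ⁅(h : 𝔤), ⁅D.F i, ⁅D.E i, v⁆⁆⁆ = _
  rw [leibniz_lie (h : 𝔤), leibniz_lie (h : 𝔤), D.lie_E, D.lie_F,
    lie_eq_zero_of_mem_weightSpace hv]
  simp

/-- The zero weight space is spanned by the eigenvectors of `F_i E_i`. -/
theorem weightSpace_le_span (i : Fin r) (hE : ∀ v : V, ∃ k, (toEnd ℂ 𝔤 V (D.E i) ^ k) v = 0) :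
    (weightSpace V (0 : 𝔱 → ℂ)).toSubmodule ≤ Submodule.span ℂ
      {v : V | v ∈ weightSpace V (0 : 𝔱 → ℂ) ∧ ∃ j, ⁅D.F i, ⁅D.E i, v⁆⁆ = casimirValue j • v} := by
  intro v hv
  obtain ⟨k, hk⟩ := hE v
  let T : (weightSpace V (0 : 𝔱 → ℂ)).toSubmodule →ₗ[ℂ] (weightSpace V (0 : 𝔱 → ℂ)).toSubmodule :=
    LinearMap.restrict (toEnd ℂ 𝔤 V (D.F i) ∘ₗ toEnd ℂ 𝔤 V (D.E i))
      fun v hv => D.lie_F_lie_E_mem_weightSpace i hv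
  have h1 := mem_iSup_eigenspace (D.sl2Triple i)
    (fun v hv => lie_eq_zero_of_mem_weightSpace hv (D.H i)) T (fun _ => rfl) k ⟨v, hv⟩ hk
  have h2 : (⨆ l : Fin k, Module.End.eigenspace T (casimirValue l)) ≤
      (Submodule.span ℂ {v : V | v ∈ weightSpace V (0 : 𝔱 → ℂ) ∧
        ∃ j, ⁅D.F i, ⁅D.E i, v⁆⁆ = casimirValue j • v}).comap
          (weightSpace V (0 : 𝔱 → ℂ)).toSubmodule.subtype := by
    refine iSup_le fun l w hw => Submodule.subset_span ⟨w.2, l, ?_⟩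
    exact congrArg Subtype.val (Module.End.mem_eigenspace_iff.1 hw)
  exact h2 h1

end SimpleRoots

end Decomposition

/-! ### The diagonal action -/

section Diagonal

variable {n : ℕ} {G : Subgroup (GL (Fin n) ℂ)}
  {𝔤 : LieSubalgebra ℂ (Matrix (Fin n) (Fin n) ℂ)} (h𝔤 : IsLieAlgebraOf 𝔤 G)
variable {V : Type*} [AddCommGroup V] [Module ℂ V] [LieRingModule 𝔤 V] [LieModule ℂ 𝔤 V]
variable (ρ : Representation ℂ G V) (hdiff : IsDifferential 𝔤 ρ)

theorem diagonal_lAct (g : G) (X : 𝔤) (m : M 𝔤 V) :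
    diagonal h𝔤 ρ g (lAct V X m) = lAct V (Ad h𝔤 g X) (diagonal h𝔤 ρ g m) := by
  induction m using TensorProduct.induction_on with
  | zero => simp
  | add x y hx hy => simp only [map_add, hx, hy]
  | tmul u v =>
    rw [diagonal, lAct_tmul, TensorProduct.map_tmul, TensorProduct.map_tmul, lAct_tmul,
      AlgHom.toLinearMap_apply, AlgHom.toLinearMap_apply, map_mul, U.map_ι]

include hdiff in
theorem diagonal_rAct (g : G) (X : 𝔤) (m : M 𝔤 V) :
    diagonal h𝔤 ρ g (rAct V X m) = rAct V (Ad h𝔤 g X) (diagonal h𝔤 ρ g m) := by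
  induction m using TensorProduct.induction_on with
  | zero => simp
  | add x y hx hy => simp only [map_add, hx, hy]
  | tmul u v =>
    rw [diagonal, rAct_tmul, map_sub, TensorProduct.map_tmul, TensorProduct.map_tmul,
      TensorProduct.map_tmul, rAct_tmul, AlgHom.toLinearMap_apply, AlgHom.toLinearMap_apply,
      map_mul, U.map_ι, rho_lie h𝔤 hdiff]

end Diagonal

end HarishChandra

end

theorem proposition4 {n r : ℕ}
    (G : Subgroup (GL (Fin n) ℂ)) (hG : HarishChandra.IsConnectedReductive G)
    (𝔤 : LieSubalgebra ℂ (Matrix (Fin n) (Fin n) ℂ)) (h𝔤 : HarishChandra.IsLieAlgebraOf 𝔤 G)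
    [LieAlgebra.HasCentralRadical ℂ 𝔤]
    (𝔱 : LieSubalgebra ℂ 𝔤) [𝔱.IsCartanSubalgebra] [IsLieAbelian 𝔱]
    (D : HarishChandra.SimpleRoots 𝔱 r)
    {V : Type*} [AddCommGroup V] [Module ℂ V] [LieRingModule 𝔤 V] [LieModule ℂ 𝔤 V]
    (ρ : Representation ℂ G V) (hρ : HarishChandra.IsLocallyFiniteModule ρ)
    (hdiff : HarishChandra.IsDifferential 𝔤 ρ)
    (s : Fin r → G)
    (hs : ∀ i, (s i : GL (Fin n) ℂ) ∈ HarishChandra.connectedSubgroup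
      ((fun X : 𝔤 => (X : Matrix (Fin n) (Fin n) ℂ)) '' (D.sl2 i : Set 𝔤)))
    (hs' : ∀ (i : Fin r) (h : 𝔱), HarishChandra.Ad h𝔤 (s i) (h : 𝔤) = (D.s i h : 𝔤)) :
    D.Z0 V = Submodule.span (HarishChandra.U 𝔱)
        (D.ofV V '' (LieModule.weightSpace V (0 : 𝔱 → ℂ) : Set V)) ∧
      ∀ z ∈ D.Z0 V,
        z ∈ D.Q V (fun i => HarishChandra.diagonal h𝔤 ρ (s i)) ↔
          ∀ i : Fin r, ∃ (N : ℕ) (j : Fin N → ℕ) (Θ : Fin N → HarishChandra.U 𝔱) (v : Fin N → V),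
            (∀ a, v a ∈ LieModule.weightSpace V (0 : 𝔱 → ℂ) ∧ v a ∈ D.isotypic V i (j a) ∧
              D.shifted i (Θ a) = Θ a) ∧
            z = ∑ a, (Θ a * D.Ψ i (j a)) • D.ofV V (v a) := by
  classical
  have hZ0 := D.Z0_eq_span (V := V) 𝔤.incl Subtype.val_injective
  refine ⟨hZ0, fun z hz => ?_⟩
  have hE : ∀ i (v : V), ∃ k, (LieModule.toEnd ℂ 𝔤 V (D.E i) ^ k) v = 0 := fun i =>
    HarishChandra.exists_pow_toEnd_eq_zero h𝔤 hdiff hρ two_ne_zero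
      ((D.sl2Triple i).lie_h_e_smul ℂ)
  have hFH : ∀ i, ⁅(D.H i : 𝔤), D.F i⁆ = (-2 : ℂ) • D.F i := fun i => by
    rw [(D.sl2Triple i).lie_lie_smul_f ℂ, neg_smul]
  have hF : ∀ i (v : V), ∃ k, (LieModule.toEnd ℂ 𝔤 V (D.F i) ^ k) v = 0 := fun i =>
    HarishChandra.exists_pow_toEnd_eq_zero h𝔤 hdiff hρ (by norm_num) (hFH i)
  have hA : ∀ i (m : HarishChandra.M 𝔤 V), ∃ N, (HarishChandra.ad V (D.F i) ^ N) m = 0 :=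
    fun i => HarishChandra.exists_pow_ad_eq_zero
      (HarishChandra.isNilpotent_ad (c := -2) (by norm_num) (hFH i)) (hF i)
  have hl := fun i => HarishChandra.diagonal_lAct h𝔤 ρ (s i)
  have hr := fun i => HarishChandra.diagonal_rAct h𝔤 ρ hdiff (s i)
  have hσ : ∀ i (v : V) (j : ℕ), ⁅(D.H i : 𝔤), v⁆ = 0 →
      ⁅D.F i, ⁅D.E i, v⁆⁆ = HarishChandra.casimirValue j • v →
      HarishChandra.diagonal h𝔤 ρ (s i) (TensorProduct.tmul ℂ (1 : HarishChandra.U 𝔤) v) =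
        (-1 : ℂ) ^ j • TensorProduct.tmul ℂ (1 : HarishChandra.U 𝔤) v := fun i v j hv hj => by
    rw [HarishChandra.diagonal, TensorProduct.map_tmul, AlgHom.toLinearMap_apply, map_one,
      HarishChandra.rho_reflection h𝔤 D (hE i) (hF i) hdiff (hs i) (hs' i) hv hj,
      TensorProduct.tmul_smul]
  have hH : ∀ i {v : V}, v ∈ LieModule.weightSpace V (0 : 𝔱 → ℂ) → ⁅(D.H i : 𝔤), v⁆ = 0 :=
    fun i v hv => HarishChandra.SimpleRoots.lie_eq_zero_of_mem_weightSpace hv _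
  constructor
  · rintro ⟨-, hξ⟩ i
    -- a basis of the zero weight space which consists of eigenvectors of `F_i E_i`
    obtain ⟨B, hBS, hBspan, hBind⟩ := exists_linearIndependent ℂ
      {v : V | v ∈ LieModule.weightSpace V (0 : 𝔱 → ℂ) ∧
        ∃ j, ⁅D.F i, ⁅D.E i, v⁆⁆ = HarishChandra.casimirValue j • v}
    choose j hj using fun b : B => (hBS b.2).2
    have h1 : z ∈ Submodule.span (HarishChandra.U 𝔱)
        (Set.range fun b : B => D.ofV V (b : V)) := by
      rw [hZ0] at hz
      refine Submodule.span_le.2 ?_ hz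
      rintro _ ⟨v, hv, rfl⟩
      have h2 := D.weightSpace_le_span i (hE i) hv
      rw [← hBspan] at h2
      clear hv
      induction h2 using Submodule.span_induction with
      | mem x hx => exact Submodule.subset_span ⟨⟨x, hx⟩, rfl⟩
      | zero => rw [D.ofV_zero]; exact zero_mem _
      | add x y _ _ hx hy => rw [D.ofV_add]; exact add_mem hx hy
      | smul c x _ hx => rw [D.ofV_smul]; exact Submodule.smul_mem _ _ hx
    obtain ⟨c, rfl⟩ := Finsupp.mem_span_range_iff_exists_finsupp.1 h1
    have h2 := D.exists_invariant_of_XiEq i (hA i) (hF i) _ (hs' i) _ (hl i) (hr i) (hσ i) 𝔤.incl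
      Subtype.val_injective c.support c j (fun b : B => (b : V)) hBind
      (fun b _ => hH i (hBS b.2).1) (fun b _ => hj b) (hξ i)
    choose! Θ hΘ hcΘ using h2
    let e := c.support.equivFin.symm
    refine ⟨c.support.card, fun a => j (e a), fun a => Θ (e a), fun a => (e a : B), fun a =>
      ⟨(hBS (e a : B).2).1, ?_, hΘ _ (e a).2⟩, ?_⟩
    · exact (D.mem_isotypic_iff (hE i) (hF i) (hH i (hBS (e a : B).2).1)).2 (hj _)
    · rw [Equiv.sum_comp e (fun b : c.support => (Θ b * D.Ψ i (j b)) • D.ofV V (b : V)),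
        Finset.sum_coe_sort c.support (fun b : B => (Θ b * D.Ψ i (j b)) • D.ofV V (b : V))]
      exact Finset.sum_congr rfl fun b hb => by rw [← hcΘ b hb]
  · intro h
    refine ⟨hz, fun i => ?_⟩
    obtain ⟨N, j, Θ, v, h1, rfl⟩ := h i
    exact D.XiEq_of_invariant i (hA i) (hF i) _ (hs' i) _ (hl i) (hr i) (hσ i) Finset.univ Θ j v
      (fun a _ => hH i (h1 a).1)
      (fun a _ => (D.mem_isotypic_iff (hE i) (hF i) (hH i (h1 a).1)).1 (h1 a).2.1)
      (fun a _ => (h1 a).2.2)
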